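/- Let $n\ge 2$ and write $B_r=\{x\in\mathbb R^n:|x|<r\}$. Set $p_n=n$ if $2\le n\le 5$ and $p_n=\dfrac{n}{n-4\sqrt{n-1}+4}$ if $n\ge 6$. There is a constant $C=C(n)$, depending only on $n$, with the following property. Let $f\in C^1(\mathbb R)$ and let $u\in W^{3,1}_{\mathrm{loc}}(B_2)$ be a stable weak solution of $$\operatorname{div}\left(\frac{\nabla u}{\sqrt{1+|\nabla u|^2}}\right)=-f(u)\quad\text{in }B_2,$$ that is, $f(u),f'(u)\in L^1_{\mathrm{loc}}(B_2)$, $$\int_{B_2}\frac{\nabla u\cdot\nabla\varphi}{\sqrt{1+|\nabla u|^2}}\,dx=\int_{B_2}f(u)\varphi\,dx\qquad\forall\,\varphi\in C_c^\infty(B_2),$$ and $$\int_{B_2}f'(u)\xi^2\,dx\le\int_{B_2}\left(\frac{|\nabla\xi|^2}{\sqrt{1+|\nabla u|^2}}-\frac{(\nabla u\cdot\nabla\xi)^2}{(1+|\nabla u|^2)^{3/2}}\right)dx\qquad\forall\,\xi\in C_c^\infty(B_2).$$ Then $\nabla u$ belongs to the Morrey space $M^{p_n}(B_1)$, and $$\|\nabla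 u\|_{M^{p_n}(B_1)}\le C\left(1+\|\nabla u\|_{L^1(B_2)}\right),$$ where the right-hand side may be $+\infty$. Here, for $1\le p<\infty$ and a bounded open set $\Omega\subset\mathbb R^n$, a function $g\in L^1_{\mathrm{loc}}(\Omega)$ belongs to $M^p(\Omega)$ if there is a constant $K>0$ such that $$\int_{B_\rho(x_0)\cap\Omega}|g|\,dx\le K\rho^{\,n(1-1/p)}\qquad\text{for all }x_0\in\Omega,\ 0<\rho\le\operatorname{diam}\Omega,$$ and $\|g\|_{M^p(\Omega)}$ is the infimum of such constants $K$. -/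

import Mathlib

open MeasureTheory TopologicalSpace
open scoped ENNReal NNReal Distributions Gradient

noncomputable section

namespace MeanCurvature

/-- The open ball `B_r` of radius `r` centred at the origin of `ℝⁿ`. -/
def B (n : ℕ) (r : ℝ) : Opens (EuclideanSpace ℝ (Fin n)) :=
  ⟨Metric.ball 0 r, Metric.isOpen_ball⟩

/-- `u, v ∈ L¹_loc(Ω)` and `v` is the weak partial derivative `∂ᵢ u` in `Ω`. -/
structure HasWeakPartial {n : ℕ} (Ω : Opens (EuclideanSpace ℝ (Fin n))) (i : Fin n)
    (u v : EuclideanSpace ℝ (Fin n) → ℝ) : Prop where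
  locInt : LocallyIntegrableOn u Ω volume
  locInt_partial : LocallyIntegrableOn v Ω volume
  integral_eq : ∀ φ : 𝓓(Ω, ℝ),
    ∫ x in Ω, u x * fderiv ℝ φ x (EuclideanSpace.single i 1) = -∫ x in Ω, v x * φ x

/-- `u ∈ W^{k,1}_loc(Ω)`: all weak partial derivatives of `u` of order at most `k` exist and
belong to `L¹_loc(Ω)`. -/
def MemW1Loc {n : ℕ} (Ω : Opens (EuclideanSpace ℝ (Fin n))) :
    ℕ → (EuclideanSpace ℝ (Fin n) → ℝ) → Prop
  | 0, u => LocallyIntegrableOn u Ω volume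
  | k + 1, u => LocallyIntegrableOn u Ω volume ∧
      ∀ i : Fin n, ∃ v, HasWeakPartial Ω i u v ∧ MemW1Loc Ω k v

/-- `u ∈ W^{1,1}_loc(Ω)` and the vector field `G` is (a version of) its weak gradient `∇u`. -/
structure HasWeakGradient {n : ℕ} (Ω : Opens (EuclideanSpace ℝ (Fin n)))
    (u : EuclideanSpace ℝ (Fin n) → ℝ)
    (G : EuclideanSpace ℝ (Fin n) → EuclideanSpace ℝ (Fin n)) : Prop where
  locInt : LocallyIntegrableOn u Ω volume
  locInt_grad : LocallyIntegrableOn G Ω volume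
  weakPartial : ∀ i : Fin n, HasWeakPartial Ω i u (fun x => G x i)

/-- `u ∈ W^{1,1}_loc(Ω)`, with weak gradient `G`, is a weak solution of
`div (∇u / √(1 + |∇u|²)) = -f(u)` in `Ω`. -/
structure IsWeakSolution {n : ℕ} (Ω : Opens (EuclideanSpace ℝ (Fin n))) (f : ℝ → ℝ)
    (u : EuclideanSpace ℝ (Fin n) → ℝ)
    (G : EuclideanSpace ℝ (Fin n) → EuclideanSpace ℝ (Fin n)) : Prop where
  weakGradient : HasWeakGradient Ω u G
  locInt_f : LocallyIntegrableOn (fun x => f (u x)) Ω volume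
  weak_eq : ∀ φ : 𝓓(Ω, ℝ),
    ∫ x in Ω, inner ℝ (G x) (∇ φ x) / √(1 + ‖G x‖ ^ 2) = ∫ x in Ω, f (u x) * φ x

/-- `u`, with weak gradient `G`, is a stable solution of
`div (∇u / √(1 + |∇u|²)) = -f(u)` in `Ω`. -/
structure IsStableSolution {n : ℕ} (Ω : Opens (EuclideanSpace ℝ (Fin n))) (f : ℝ → ℝ)
    (u : EuclideanSpace ℝ (Fin n) → ℝ)
    (G : EuclideanSpace ℝ (Fin n) → EuclideanSpace ℝ (Fin n)) : Prop where
  weakSolution : IsWeakSolution Ω f u G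
  locInt_deriv : LocallyIntegrableOn (fun x => deriv f (u x)) Ω volume
  stable : ∀ ξ : 𝓓(Ω, ℝ),
    ∫ x in Ω, deriv f (u x) * ξ x ^ 2 ≤
      ∫ x in Ω, (‖∇ ξ x‖ ^ 2 / √(1 + ‖G x‖ ^ 2)
        - inner ℝ (G x) (∇ ξ x) ^ 2 / (1 + ‖G x‖ ^ 2) ^ (3 / 2 : ℝ))

/-- The constant `K` is admissible in the Morrey condition for `g` in `Ω` with exponent `p`:
`∫_{B_ρ(x₀) ∩ Ω} |g| ≤ K ρ^{n(1 - 1/p)}` for all `x₀ ∈ Ω` and `0 < ρ ≤ diam Ω`. -/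
def MorreyBound {n : ℕ} (Ω : Opens (EuclideanSpace ℝ (Fin n))) (p : ℝ)
    (g : EuclideanSpace ℝ (Fin n) → EuclideanSpace ℝ (Fin n)) (K : ℝ≥0∞) : Prop :=
  ∀ x₀ ∈ Ω, ∀ ρ : ℝ, 0 < ρ → ENNReal.ofReal ρ ≤ Metric.ediam (Ω : Set (EuclideanSpace ℝ (Fin n))) →
    ∫⁻ x in Metric.ball x₀ ρ ∩ Ω, ‖g x‖ₑ ≤ K * ENNReal.ofReal (ρ ^ ((n : ℝ) * (1 - 1 / p)))

/-- The vector field `g` belongs to the Morrey space `M^p(Ω)`. -/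
def MemMorrey {n : ℕ} (Ω : Opens (EuclideanSpace ℝ (Fin n))) (p : ℝ)
    (g : EuclideanSpace ℝ (Fin n) → EuclideanSpace ℝ (Fin n)) : Prop :=
  LocallyIntegrableOn g Ω volume ∧ ∃ K : ℝ≥0, 0 < K ∧ MorreyBound Ω p g K

/-- The Morrey norm: the infimum of the admissible constants (`∞` if no finite one exists). -/
def morreyNorm {n : ℕ} (Ω : Opens (EuclideanSpace ℝ (Fin n))) (p : ℝ)
    (g : EuclideanSpace ℝ (Fin n) → EuclideanSpace ℝ (Fin n)) : ℝ≥0∞ :=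
  sInf {K : ℝ≥0∞ | MorreyBound Ω p g K}

/-- The exponent `p_n` (used for `n ≥ 2`). -/
def morreyExponent (n : ℕ) : ℝ :=
  if n ≤ 5 then n else n / (n - 4 * √((n : ℝ) - 1) + 4)

end MeanCurvature

end

/-! Write `G` for the gradient of u, w = √(1+|G|²), y = x - x₀, and A for the Hessian of the area
integrand at `G`. The classical argument tests stability with ξ = η (y·∇u). Differentiating the
equation gives a linearized equation for each ∂ₖu. Testing it with yₖ η² (y·∇u), summing over k, and
adding the equation itself tested with η² (y·∇u) removes both f(u) and f'(u). The remaining second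
derivatives of u form the exact derivative y·∇(w - 1/w), so one integration by parts leaves an
inequality 0 ≤ ∫ `stabIntegrand` that involves only `G`, η and ∇η
(`StableSystem.stabIntegrand_nonneg`).

Now take η² close to |y|^(-a), regularized at scale ρ and cut off at unit scale. With s the squared
cosine of the angle between y and `G`, the leading part of the integrand is -η² (|G|²/w) times n - 1
- (1-s)(a + (a²/4)s), up to the regularization. If (1-s)(a + (a²/4)s) ≤ n-1 on [0,1], this is
nonpositive, and the regularization leaves a strictly negative multiple of ρ^(-a)|G| on the ball of
radius ρ. The other contributions are bounded by |y|^(-a), which is integrable because a < n, and by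
|G| on a ball of fixed radius. Hence the integral of |G| over that ball is at most C ρ^a (1 + ∫|G|).
The largest a allowed by the scalar inequality is n-1 for n ≤ 5 and 4(√(n-1)-1) for n ≥ 6, and a =
n(1-1/p) gives the exponent in the theorem (`morreyExponent_spec`).

The analytic difficulty is that ξ need not be an admissible test function: u is only in W^{3,1}, and
A degenerates where |G| is large. Two devices deal with this. First, the energy density A∂ⱼG·∂ⱼG is
locally integrable (`StableSystem.locInt_energy`): integrate ∂ⱼ of flux(G) paired with a damped ∂ⱼG,
use |flux| ≤ 1 and the integrability of third derivatives, and remove the damping by Fatou.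
Consequently A∂ⱼG and f(u) are in L²_loc. Second, the test functions use `G` multiplied by a
negative power of 1 + τ|G|². These are bounded with square integrable gradient, hence admissible by
mollification (`IsW12Test`). The inequality is proved for τ > 0
(`StableSystem.dampIntegrand_nonneg`), and τ → 0 follows by dominated convergence, with a majorant
built from |G|, |D²u| and the energy (`abs_dampIntegrand_le`). -/

open Filter Set Metric ContinuousLinearMap
open scoped Topology ContDiff Convolution

namespace MeanCurvature

local notation "𝔼" n => EuclideanSpace ℝ (Fin n)

/-! ### Mollification -/

section Mollification

variable {n : ℕ} {F : Type*} [NormedAddCommGroup F] [NormedSpace ℝ F]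

/-- A smooth bump function at the origin with outer radius `2 / (k + 1)`. -/
noncomputable def mollBump (n k : ℕ) : ContDiffBump (0 : 𝔼 n) where
  rIn := 1 / ((k : ℝ) + 1)
  rOut := 2 / ((k : ℝ) + 1)
  rIn_pos := by positivity
  rIn_lt_rOut := by gcongr; norm_num

/-- The kernel of the `k`-th mollification. -/
noncomputable def mollKernel (n k : ℕ) : (𝔼 n) → ℝ := (mollBump n k).normed volume

/-- The `k`-th mollification of `g`. -/
noncomputable def moll (k : ℕ) (g : (𝔼 n) → F) : (𝔼 n) → F :=
  mollKernel n k ⋆[lsmul ℝ ℝ, volume] g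

lemma tendsto_mollBump_rOut (n : ℕ) : Tendsto (fun k => (mollBump n k).rOut) atTop (𝓝 0) := by
  change Tendsto (fun k : ℕ => 2 / ((k : ℝ) + 1)) atTop (𝓝 0)
  exact tendsto_const_nhds.div_atTop
    (tendsto_atTop_add_const_right _ _ tendsto_natCast_atTop_atTop)

lemma mollKernel_nonneg (k : ℕ) (x : 𝔼 n) : 0 ≤ mollKernel n k x := (mollBump n k).nonneg_normed x

lemma contDiff_mollKernel (k : ℕ) : ContDiff ℝ ∞ (mollKernel n k) :=
  (mollBump n k).contDiff_normed (n := ⊤)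

lemma continuous_mollKernel (k : ℕ) : Continuous (mollKernel n k) :=
  (mollBump n k).continuous_normed

lemma hasCompactSupport_mollKernel (k : ℕ) : HasCompactSupport (mollKernel n k) :=
  (mollBump n k).hasCompactSupport_normed

lemma integral_mollKernel (k : ℕ) : ∫ x, mollKernel n k x = 1 := (mollBump n k).integral_normed

lemma lintegral_mollKernel (k : ℕ) : ∫⁻ x, ENNReal.ofReal (mollKernel n k x) = 1 := by
  have hi : Integrable (mollKernel n k) := (mollBump n k).integrable_normed
  rw [← ofReal_integral_eq_lintegral_ofReal hi
    (Eventually.of_forall (mollKernel_nonneg k)), integral_mollKernel, ENNReal.ofReal_one]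

lemma mollKernel_eq_zero {k : ℕ} {x : 𝔼 n} (h : (mollBump n k).rOut ≤ ‖x‖) :
    mollKernel n k x = 0 := by
  by_contra h'
  have : x ∈ Function.support (mollKernel n k) := h'
  rw [mollKernel, ContDiffBump.support_normed_eq] at this
  simp only [mem_ball, dist_zero_right] at this
  linarith

lemma moll_apply (k : ℕ) (g : (𝔼 n) → F) (x : 𝔼 n) :
    moll k g x = ∫ t, mollKernel n k t • g (x - t) := rfl

lemma moll_apply_swap (k : ℕ) (g : (𝔼 n) → F) (x : 𝔼 n) :
    moll k g x = ∫ t, mollKernel n k (x - t) • g t := by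
  rw [moll, convolution_eq_swap]; rfl

lemma contDiff_moll (k : ℕ) {g : (𝔼 n) → F} [CompleteSpace F] (hg : LocallyIntegrable g) :
    ContDiff ℝ ∞ (moll k g) :=
  (hasCompactSupport_mollKernel k).contDiff_convolution_left (n := ⊤) _ (contDiff_mollKernel k) hg

lemma integrable_mollKernel_smul (k : ℕ) {g : (𝔼 n) → F} (hg : LocallyIntegrable g) (x : 𝔼 n) :
    Integrable (fun t => mollKernel n k t • g (x - t)) :=
  (hasCompactSupport_mollKernel k).convolutionExists_left (lsmul ℝ ℝ)
    (continuous_mollKernel k) hg x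

lemma moll_sub (k : ℕ) {g h : (𝔼 n) → F} (hg : LocallyIntegrable g) (hh : LocallyIntegrable h) :
    moll k (g - h) = moll k g - moll k h := by
  ext x
  simp only [moll_apply, Pi.sub_apply, smul_sub]
  exact integral_sub (integrable_mollKernel_smul k hg x) (integrable_mollKernel_smul k hh x)

lemma ae_tendsto_moll [CompleteSpace F] {g : (𝔼 n) → F} (hg : LocallyIntegrable g) :
    ∀ᵐ x, Tendsto (fun k => moll k g x) atTop (𝓝 (g x)) := by
  -- Lebesgue differentiation needs the ratio of outer to inner radius to stay bounded; here it is
  -- exactly 2.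
  refine ContDiffBump.ae_convolution_tendsto_right_of_locallyIntegrable (K := 2)
    (tendsto_mollBump_rOut n) (Eventually.of_forall fun k => ?_) hg
  change 2 / ((k : ℝ) + 1) ≤ 2 * (1 / ((k : ℝ) + 1))
  rw [mul_one_div]

lemma norm_moll_le {g : (𝔼 n) → F} {B : ℝ} (hB : ∀ x, ‖g x‖ ≤ B) (k : ℕ) (x : 𝔼 n) :
    ‖moll k g x‖ ≤ B := by
  rw [moll_apply]
  calc ‖∫ t, mollKernel n k t • g (x - t)‖ ≤ ∫ t, mollKernel n k t * B := by
        refine norm_integral_le_of_norm_le ((mollBump n k).integrable_normed.mul_const B)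
          (Eventually.of_forall fun t => ?_)
        rw [norm_smul, Real.norm_of_nonneg (mollKernel_nonneg k t)]
        exact mul_le_mul_of_nonneg_left (hB _) (mollKernel_nonneg k t)
    _ = B := by rw [integral_mul_const, integral_mollKernel, one_mul]

lemma moll_eq_zero {g : (𝔼 n) → F} {k : ℕ} {x : 𝔼 n}
    (h : ∀ z, dist z x < (mollBump n k).rOut → g z = 0) : moll k g x = 0 := by
  rw [moll_apply]
  refine integral_eq_zero_of_ae (Eventually.of_forall fun t => ?_)
  by_cases ht : ‖t‖ < (mollBump n k).rOut
  · simp [h (x - t) (by simpa [dist_eq_norm] using ht)]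
  · simp [mollKernel_eq_zero (not_lt.1 ht)]

lemma support_moll_subset {g : (𝔼 n) → F} {K : Set (𝔼 n)} (hg : ∀ x ∉ K, g x = 0) {k : ℕ}
    {δ : ℝ} (hk : (mollBump n k).rOut ≤ δ) : Function.support (moll k g) ⊆ cthickening δ K := by
  intro x hx
  by_contra hxK
  refine hx (moll_eq_zero fun z hz => hg z fun hzK => hxK ?_)
  exact mem_cthickening_of_dist_le x z δ K hzK (by rw [dist_comm]; linarith)

/-- Jensen's inequality for the probability measure whose density is the kernel, in the form of
monotonicity of L^p norms in p. -/
lemma enorm_moll_rpow_le {p : ℝ≥0∞} (hp : 1 ≤ p) (hp' : p ≠ ⊤) {g : (𝔼 n) → F}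
    (hg : AEStronglyMeasurable g) (k : ℕ) (x : 𝔼 n) :
    ‖moll k g x‖ₑ ^ p.toReal ≤
      ∫⁻ t, ENNReal.ofReal (mollKernel n k t) * ‖g (x - t)‖ₑ ^ p.toReal := by
  have hmeas : Measurable fun t => ENNReal.ofReal (mollKernel n k t) :=
    (continuous_mollKernel k).measurable.ennreal_ofReal
  set μ : Measure (𝔼 n) := volume.withDensity fun t => ENNReal.ofReal (mollKernel n k t) with hμ
  have hprob : IsProbabilityMeasure μ := ⟨by
    rw [hμ, withDensity_apply _ MeasurableSet.univ, Measure.restrict_univ, lintegral_mollKernel]⟩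
  have hg' : AEStronglyMeasurable (fun t => g (x - t)) volume :=
    hg.comp_quasiMeasurePreserving
      (quasiMeasurePreserving_sub_left_of_right_invariant volume x)
  have hgμ : AEStronglyMeasurable (fun t => g (x - t)) μ :=
    hg'.mono_ac (withDensity_absolutelyContinuous _ _)
  have h1 : ‖moll k g x‖ₑ ≤ eLpNorm (fun t => g (x - t)) 1 μ := by
    rw [moll_apply, eLpNorm_one_eq_lintegral_enorm, hμ,
      lintegral_withDensity_eq_lintegral_mul₀ hmeas.aemeasurable hg'.enorm]
    refine (enorm_integral_le_lintegral_enorm _).trans_eq (lintegral_congr fun t => ?_)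
    rw [enorm_smul, Pi.mul_apply, Real.enorm_of_nonneg (mollKernel_nonneg k t)]
  have hp0 : p ≠ 0 := (zero_lt_one.trans_le hp).ne'
  have hpr : 0 < p.toReal := ENNReal.toReal_pos hp0 hp'
  have h2 := h1.trans (eLpNorm_le_eLpNorm_of_exponent_le hp hgμ)
  rw [eLpNorm_eq_lintegral_rpow_enorm_toReal hp0 hp', one_div,
    ENNReal.le_rpow_inv_iff hpr] at h2
  refine h2.trans_eq ?_
  rw [hμ, lintegral_withDensity_eq_lintegral_mul₀ hmeas.aemeasurable
    (hg'.enorm.pow_const _)]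
  rfl

lemma eLpNorm_moll_le {p : ℝ≥0∞} (hp : 1 ≤ p) (hp' : p ≠ ⊤) {g : (𝔼 n) → F}
    (hg : AEStronglyMeasurable g) (k : ℕ) : eLpNorm (moll k g) p ≤ eLpNorm g p := by
  have hp0 : p ≠ 0 := (zero_lt_one.trans_le hp).ne'
  have hpr : 0 < p.toReal := ENNReal.toReal_pos hp0 hp'
  have hmeas : Measurable fun t => ENNReal.ofReal (mollKernel n k t) :=
    (continuous_mollKernel k).measurable.ennreal_ofReal
  rw [eLpNorm_eq_lintegral_rpow_enorm_toReal hp0 hp',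
    eLpNorm_eq_lintegral_rpow_enorm_toReal hp0 hp']
  refine ENNReal.rpow_le_rpow ?_ (by positivity)
  calc ∫⁻ x, ‖moll k g x‖ₑ ^ p.toReal
      ≤ ∫⁻ x, ∫⁻ t, ENNReal.ofReal (mollKernel n k t) * ‖g (x - t)‖ₑ ^ p.toReal :=
        lintegral_mono fun x => enorm_moll_rpow_le hp hp' hg k x
    _ = ∫⁻ t, ∫⁻ x, ENNReal.ofReal (mollKernel n k t) * ‖g (x - t)‖ₑ ^ p.toReal := by
        refine lintegral_lintegral_swap ?_
        refine (hmeas.comp measurable_snd).aemeasurable.mul ?_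
        exact (hg.comp_quasiMeasurePreserving
          (quasiMeasurePreserving_sub_of_right_invariant volume volume)).enorm.pow_const _
    _ = ∫⁻ t, ENNReal.ofReal (mollKernel n k t) * ∫⁻ x, ‖g x‖ₑ ^ p.toReal := by
        refine lintegral_congr fun t => ?_
        rw [lintegral_const_mul' _ _ ENNReal.ofReal_ne_top,
          lintegral_sub_right_eq_self (fun x => ‖g x‖ₑ ^ p.toReal) t]
    _ = ∫⁻ x, ‖g x‖ₑ ^ p.toReal := by
        rw [lintegral_mul_const _ hmeas, lintegral_mollKernel, one_mul]

/-- Uniform continuity gives a uniformly small difference, and all supports eventually lie in one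
compact set of finite measure. Density of such functions then yields the general case. -/
lemma tendsto_eLpNorm_moll_sub_of_contDiff [CompleteSpace F] {p : ℝ≥0∞} (hp : p ≠ ⊤)
    {h : (𝔼 n) → F} (hc : HasCompactSupport h) (hh : Continuous h) :
    Tendsto (fun k => eLpNorm (moll k h - h) p) atTop (𝓝 0) := by
  have hK : IsCompact (cthickening 2 (tsupport h)) := hc.isCompact.cthickening
  set v : ℝ≥0∞ := volume (cthickening 2 (tsupport h)) ^ (1 / p.toReal) with hv
  have hvt : v ≠ ⊤ := ENNReal.rpow_ne_top_of_nonneg (by positivity) hK.measure_ne_top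
  have hkey : ∀ ε > 0, ∀ᶠ k in atTop, eLpNorm (moll k h - h) p ≤ ENNReal.ofReal ε * v := by
    intro ε hε
    obtain ⟨δ, hδ, hδ'⟩ := Metric.uniformContinuous_iff.1 (hc.uniformContinuous_of_continuous hh) ε hε
    filter_upwards [(tendsto_mollBump_rOut n).eventually_le_const hδ,
      (tendsto_mollBump_rOut n).eventually_le_const (show (0 : ℝ) < 2 by norm_num)] with k hk hk2
    refine eLpNorm_sub_le_of_dist_bdd volume hp hK.measurableSet hε.le (fun x => ?_) ?_ ?_
    · exact ContDiffBump.dist_normed_convolution_le hh.aestronglyMeasurable fun z hz =>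
        (hδ' (lt_of_lt_of_le hz hk)).le
    · exact support_moll_subset (fun x hx => image_eq_zero_of_notMem_tsupport hx) hk2
    · exact (subset_tsupport h).trans (self_subset_cthickening _)
  rw [ENNReal.tendsto_nhds_zero]
  intro ε hε
  obtain ⟨δ, hδ, hδε⟩ : ∃ δ > 0, ENNReal.ofReal δ * v ≤ ε := by
    have : Tendsto (fun δ : ℝ => ENNReal.ofReal δ * v) (𝓝[>] 0) (𝓝 0) := by
      have := ENNReal.Tendsto.mul_const (b := v)
        ((ENNReal.continuous_ofReal.tendsto 0).mono_left (nhdsWithin_le_nhds (s := Ioi 0)))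
        (Or.inr hvt)
      simpa using this
    obtain ⟨δ, h1, h2⟩ := ((this.eventually_le_const hε).and self_mem_nhdsWithin).exists
    exact ⟨δ, h2, h1⟩
  filter_upwards [hkey δ hδ] with k hk using hk.trans hδε

/-- Mollifications converge in `L^p` for finite `p`. -/
lemma tendsto_eLpNorm_moll_sub [CompleteSpace F] {p : ℝ≥0∞} (hp : 1 ≤ p) (hp' : p ≠ ⊤)
    {g : (𝔼 n) → F} (hg : MemLp g p) :
    Tendsto (fun k => eLpNorm (moll k g - g) p) atTop (𝓝 0) := by
  rw [ENNReal.tendsto_nhds_zero]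
  intro ε hε
  obtain ⟨δ, hδ, hδε⟩ : ∃ δ : ℝ, 0 < δ ∧ ENNReal.ofReal δ ≤ ε / 3 := by
    rcases eq_or_ne ε ⊤ with rfl | hεt
    · exact ⟨1, one_pos, by simp [ENNReal.top_div]⟩
    · refine ⟨(ε / 3).toReal, ENNReal.toReal_pos (ENNReal.div_pos hε.ne' (by simp)).ne'
        (ENNReal.div_ne_top hεt (by simp)), ?_⟩
      rw [ENNReal.ofReal_toReal (ENNReal.div_ne_top hεt (by simp))]
  obtain ⟨h, hc, hh, hgh⟩ := hg.exist_eLpNorm_sub_le hp' hp hδ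
  have hhp : MemLp h p := hh.continuous.memLp_of_hasCompactSupport hc
  have hgl := hg.locallyIntegrable hp
  have hhl := hh.continuous.locallyIntegrable (μ := (volume : Measure (𝔼 n)))
  have h3 : (0 : ℝ≥0∞) < ε / 3 := ENNReal.div_pos hε.ne' (by simp)
  filter_upwards [(ENNReal.tendsto_nhds_zero.1
    (tendsto_eLpNorm_moll_sub_of_contDiff hp' hc hh.continuous)) _ h3] with k hk
  -- The usual three-term splitting, with `h` smooth and close to `g`; mollification does not
  -- increase the norm of `g - h`.
  have e : moll k g - g = (moll k (g - h) + (moll k h - h)) - (g - h) := by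
    rw [moll_sub k hgl hhl]
    ext x
    simp only [Pi.sub_apply, Pi.add_apply]
    abel
  have m1 : AEStronglyMeasurable (moll k (g - h)) volume :=
    (contDiff_moll k (hgl.sub hhl)).continuous.aestronglyMeasurable
  have m2 : AEStronglyMeasurable (moll k h - h) volume :=
    ((contDiff_moll k hhl).continuous.sub hh.continuous).aestronglyMeasurable
  have m3 := hg.aestronglyMeasurable.sub hhp.aestronglyMeasurable
  have s1 := (eLpNorm_sub_le (m1.add m2) m3 hp).trans
    (add_le_add_left (eLpNorm_add_le m1 m2 hp) _)
  rw [← e] at s1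
  have s2 := (eLpNorm_moll_le hp hp' m3 k).trans (hgh.trans hδε)
  refine s1.trans ((add_le_add (add_le_add s2 hk) (hgh.trans hδε)).trans_eq ?_)
  exact ENNReal.add_thirds ε

end Mollification

end MeanCurvature

open Filter Set Metric ContinuousLinearMap
open scoped Topology ContDiff Convolution

namespace MeanCurvature

local notation "𝔼" n => EuclideanSpace ℝ (Fin n)

/-! ### Weak directional derivatives of vector-valued functions -/

section WeakDeriv

set_option linter.unusedSectionVars false

variable {n : ℕ} {F F' : Type*} [NormedAddCommGroup F] [NormedSpace ℝ F]
  [NormedAddCommGroup F'] [NormedSpace ℝ F']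

/-- `v` is the weak derivative of `g` in the direction `e` on `Ω`. -/
structure HasWeakDeriv (Ω : Opens (𝔼 n)) (e : 𝔼 n) (g v : (𝔼 n) → F) : Prop where
  locInt : LocallyIntegrableOn g Ω volume
  locInt_deriv : LocallyIntegrableOn v Ω volume
  integral_eq : ∀ φ : (𝔼 n) → ℝ, ContDiff ℝ ∞ φ → HasCompactSupport φ → tsupport φ ⊆ Ω →
    ∫ x, fderiv ℝ φ x e • g x = -∫ x, φ x • v x

lemma locallyIntegrableOn_opens_iff {Ω : Opens (𝔼 n)} {g : (𝔼 n) → F} :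
    LocallyIntegrableOn g Ω volume ↔ ∀ K ⊆ (Ω : Set (𝔼 n)), IsCompact K → IntegrableOn g K :=
  locallyIntegrableOn_iff Ω.isOpen.isLocallyClosed

lemma integrable_smul_of_tsupport_subset {Ω : Opens (𝔼 n)} {g : (𝔼 n) → F} {φ : (𝔼 n) → ℝ}
    (hg : LocallyIntegrableOn g Ω volume) (hφ : Continuous φ) (hc : HasCompactSupport φ)
    (hs : tsupport φ ⊆ Ω) : Integrable fun x => φ x • g x := by
  have h1 : IntegrableOn (fun x => φ x • g x) (tsupport φ) :=
    (locallyIntegrableOn_opens_iff.1 hg _ hs hc).continuousOn_smul hφ.continuousOn hc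
  exact (integrableOn_iff_integrable_of_support_subset (fun x hx => subset_tsupport φ
    (fun h0 => hx (by simp [h0])))).1 h1

lemma tsupport_fderiv_apply_subset' {φ : (𝔼 n) → F} (e : 𝔼 n) :
    tsupport (fun x => fderiv ℝ φ x e) ⊆ tsupport φ :=
  tsupport_fderiv_apply_subset ℝ e

lemma hasCompactSupport_fderiv_apply {φ : (𝔼 n) → F} (hc : HasCompactSupport φ) (e : 𝔼 n) :
    HasCompactSupport fun x => fderiv ℝ φ x e := hc.fderiv_apply ℝ e

lemma contDiff_fderiv_apply_const {φ : (𝔼 n) → F} (h : ContDiff ℝ ∞ φ) (e : 𝔼 n) :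
    ContDiff ℝ ∞ fun x => fderiv ℝ φ x e :=
  (h.fderiv_right (m := ∞) (by simp)).clm_apply contDiff_const

/-- When the kernel centred at `x` is supported inside `K`, its reflected translate is an admissible
test function and never sees the cut made by the indicator. The sign from the reflection cancels the
sign in the weak derivative. -/
lemma fderiv_moll_indicator [CompleteSpace F] {Ω : Opens (𝔼 n)} {e : 𝔼 n} {g v : (𝔼 n) → F}
    (h : HasWeakDeriv Ω e g v) {K : Set (𝔼 n)} (hK : IsCompact K) (hKΩ : K ⊆ Ω) {k : ℕ} {x : 𝔼 n}
    (hx : closedBall x (mollBump n k).rOut ⊆ K) :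
    fderiv ℝ (moll k (K.indicator g)) x e = moll k (K.indicator v) x := by
  have hgi : Integrable (K.indicator g) :=
    (integrable_indicator_iff hK.measurableSet).2 (locallyIntegrableOn_opens_iff.1 h.locInt K hKΩ hK)
  have hρ1 : ContDiff ℝ 1 (mollKernel n k) := (contDiff_mollKernel k).of_le (by simp)
  have hd := (hasCompactSupport_mollKernel (n := n) k).hasFDerivAt_convolution_right
    (lsmul ℝ ℝ).flip hgi.locallyIntegrable hρ1 x
  have hmoll : moll k (K.indicator g)
      = (K.indicator g) ⋆[(lsmul ℝ ℝ).flip, volume] (mollKernel n k) := by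
    rw [convolution_flip]; rfl
  rw [hmoll, hd.fderiv, convolution_precompR_apply _ hgi.locallyIntegrable
    ((hasCompactSupport_mollKernel k).fderiv ℝ) (hρ1.continuous_fderiv one_ne_zero)]
  set φ : (𝔼 n) → ℝ := fun t => mollKernel n k (x - t) with hφ
  have hφs : ContDiff ℝ ∞ φ := (contDiff_mollKernel k).comp (contDiff_const.sub contDiff_id)
  have hφ0 : ∀ t ∉ closedBall x (mollBump n k).rOut, φ t = 0 := fun t ht =>
    mollKernel_eq_zero (by
      rw [mem_closedBall, not_le, dist_comm, dist_eq_norm] at ht; exact ht.le)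
  have hts : tsupport φ ⊆ closedBall x (mollBump n k).rOut :=
    closure_minimal (fun t ht => by_contra fun h' => ht (hφ0 t h')) isClosed_closedBall
  have hφc : HasCompactSupport φ :=
    (isCompact_closedBall x _).of_isClosed_subset (isClosed_tsupport φ) hts
  have hfd : ∀ t, fderiv ℝ φ t e = -fderiv ℝ (mollKernel n k) (x - t) e := by
    intro t
    have h1 : HasFDerivAt (fun t => x - t) (-ContinuousLinearMap.id ℝ (𝔼 n)) t := by
      simpa using (hasFDerivAt_id t).const_sub x
    have h2 := ((hρ1.differentiable one_ne_zero (x - t)).hasFDerivAt.comp t h1).fderiv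
    rw [hφ]
    simp only [Function.comp_def] at h2
    rw [h2]; simp
  have hmain := h.integral_eq φ hφs hφc ((hts.trans hx).trans hKΩ)
  rw [moll_apply_swap, convolution_def]
  simp only [ContinuousLinearMap.flip_apply, lsmul_apply]
  have e1 : ∀ t, fderiv ℝ (mollKernel n k) (x - t) e • K.indicator g t
      = -(fderiv ℝ φ t e • g t) := by
    intro t
    by_cases ht : t ∈ K
    · rw [indicator_of_mem ht, hfd, neg_smul, neg_neg]
    · have : fderiv ℝ φ t e = 0 := image_eq_zero_of_notMem_tsupport
        (f := fun t => fderiv ℝ φ t e) fun h' =>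
          ht (hx (hts (tsupport_fderiv_apply_subset' e h')))
      rw [indicator_of_notMem ht, this]; simp
  have e2 : ∀ t, mollKernel n k (x - t) • K.indicator v t = φ t • v t := by
    intro t
    by_cases ht : t ∈ K
    · rw [indicator_of_mem ht]
    · rw [indicator_of_notMem ht, hφ0 t fun h' => ht (hx h')]; simp
  simp only [e1, e2, integral_neg, hmain, neg_neg]

lemma norm_sub_le_of_norm_fderiv_le {Ψ : F → F'} (hΨ : ContDiff ℝ 1 Ψ) {C : ℝ}
    (hC : ∀ z, ‖fderiv ℝ Ψ z‖ ≤ C) (a b : F) : ‖Ψ a - Ψ b‖ ≤ C * ‖a - b‖ :=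
  convex_univ.norm_image_sub_le_of_norm_fderiv_le
    (fun z _ => hΨ.differentiable one_ne_zero z) (fun z _ => hC z) (mem_univ b) (mem_univ a)

lemma integrableOn_comp_of_norm_fderiv_le {Ψ : F → F'} (hΨ : ContDiff ℝ 1 Ψ) {C : ℝ}
    (hC : ∀ z, ‖fderiv ℝ Ψ z‖ ≤ C) {g : (𝔼 n) → F} {K : Set (𝔼 n)} (hK : IsCompact K)
    (hg : IntegrableOn g K) : IntegrableOn (fun x => Ψ (g x)) K := by
  have hconst : IntegrableOn (fun _ : 𝔼 n => ‖Ψ 0‖) K := integrableOn_const hK.measure_ne_top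
  refine Integrable.mono' ((hg.norm.const_mul C).add hconst)
    (hΨ.continuous.comp_aestronglyMeasurable hg.aestronglyMeasurable)
    (Eventually.of_forall fun x => ?_)
  have h1 := norm_sub_le_of_norm_fderiv_le hΨ hC (g x) 0
  have h2 := norm_sub_norm_le (Ψ (g x)) (Ψ 0)
  simp only [Pi.add_apply]
  rw [sub_zero] at h1
  linarith

lemma continuous_fderiv_uncurry {Ψ : F → F'} (hΨ : ContDiff ℝ 1 Ψ) :
    Continuous fun z : F × F => fderiv ℝ Ψ z.1 z.2 :=
  ((hΨ.continuous_fderiv one_ne_zero).comp continuous_fst).clm_apply continuous_snd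

lemma integrableOn_fderiv_comp {Ψ : F → F'} (hΨ : ContDiff ℝ 1 Ψ) {C : ℝ}
    (hC : ∀ z, ‖fderiv ℝ Ψ z‖ ≤ C) {g v : (𝔼 n) → F} {K : Set (𝔼 n)}
    (hg : IntegrableOn g K) (hv : IntegrableOn v K) :
    IntegrableOn (fun x => fderiv ℝ Ψ (g x) (v x)) K := by
  refine Integrable.mono' (hv.norm.const_mul C)
    ((continuous_fderiv_uncurry hΨ).comp_aestronglyMeasurable
      (hg.aestronglyMeasurable.prodMk hv.aestronglyMeasurable))
    (Eventually.of_forall fun x => ?_)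
  exact (le_opNorm _ _).trans (mul_le_mul_of_nonneg_right (hC _) (norm_nonneg _))

lemma tendsto_lintegral_enorm_of_le {α : Type*} [MeasurableSpace α] {μ : Measure α}
    {f : ℕ → α → F} {g : ℕ → α → F'} (C : ℝ) (hfg : ∀ k x, ‖f k x‖ ≤ C * ‖g k x‖)
    (hg : Tendsto (fun k => eLpNorm (g k) 1 μ) atTop (𝓝 0)) :
    Tendsto (fun k => ∫⁻ x, ‖f k x‖ₑ ∂μ) atTop (𝓝 0) := by
  have h0 : Tendsto (fun k => ENNReal.ofReal C * eLpNorm (g k) 1 μ) atTop (𝓝 0) := by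
    simpa using ENNReal.Tendsto.const_mul (a := ENNReal.ofReal C) hg
      (Or.inr ENNReal.ofReal_ne_top)
  refine tendsto_of_tendsto_of_tendsto_of_le_of_le tendsto_const_nhds h0
    (fun k => zero_le) fun k => ?_
  change ∫⁻ x, ‖f k x‖ₑ ∂μ ≤ ENNReal.ofReal C * eLpNorm (g k) 1 μ
  rw [eLpNorm_one_eq_lintegral_enorm, ← lintegral_const_mul' _ _ ENNReal.ofReal_ne_top]
  refine lintegral_mono fun x => ?_
  rw [← ofReal_norm, ← ofReal_norm]
  by_cases hC : 0 ≤ C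
  · rw [← ENNReal.ofReal_mul hC]; exact ENNReal.ofReal_le_ofReal (hfg k x)
  · have : ‖f k x‖ ≤ 0 := (hfg k x).trans
      (mul_nonpos_of_nonpos_of_nonneg (not_le.1 hC).le (norm_nonneg _))
    simp [ENNReal.ofReal_of_nonpos this]

/-- Chain rule for weak derivatives: composition with a `C¹` map with bounded derivative. -/
theorem HasWeakDeriv.comp [CompleteSpace F] [CompleteSpace F'] {Ω : Opens (𝔼 n)} {e : 𝔼 n}
    {g v : (𝔼 n) → F} (h : HasWeakDeriv Ω e g v) {Ψ : F → F'} (hΨ : ContDiff ℝ 1 Ψ) {C : ℝ}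
    (hC : ∀ z, ‖fderiv ℝ Ψ z‖ ≤ C) :
    HasWeakDeriv Ω e (fun x => Ψ (g x)) fun x => fderiv ℝ Ψ (g x) (v x) := by
  refine ⟨?_, ?_, ?_⟩
  · rw [locallyIntegrableOn_opens_iff]
    exact fun K hKΩ hK => integrableOn_comp_of_norm_fderiv_le hΨ hC hK
      (locallyIntegrableOn_opens_iff.1 h.locInt K hKΩ hK)
  · rw [locallyIntegrableOn_opens_iff]
    exact fun K hKΩ hK => integrableOn_fderiv_comp hΨ hC
      (locallyIntegrableOn_opens_iff.1 h.locInt K hKΩ hK)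
      (locallyIntegrableOn_opens_iff.1 h.locInt_deriv K hKΩ hK)
  intro φ hφ hφc hφΩ
  have hC0 : 0 ≤ C := (norm_nonneg _).trans (hC 0)
  -- The margin δ keeps the mollification balls around points of the support inside `K`, where the
  -- truncated functions agree with the original ones.
  obtain ⟨δ, hδ, hδΩ⟩ := hφc.isCompact.exists_cthickening_subset_open Ω.isOpen hφΩ
  set K := cthickening δ (tsupport φ) with hKdef
  have hK : IsCompact K := hφc.isCompact.cthickening
  have hgK := locallyIntegrableOn_opens_iff.1 h.locInt K hδΩ hK
  have hvK := locallyIntegrableOn_opens_iff.1 h.locInt_deriv K hδΩ hK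
  set g' := K.indicator g with hg'
  set v' := K.indicator v with hv'
  have hgi : Integrable g' := (integrable_indicator_iff hK.measurableSet).2 hgK
  have hvi : Integrable v' := (integrable_indicator_iff hK.measurableSet).2 hvK
  have hsK : tsupport φ ⊆ K := self_subset_cthickening _
  set dφ : (𝔼 n) → ℝ := fun x => fderiv ℝ φ x e with hdφ
  have hdφs : ContDiff ℝ ∞ dφ := contDiff_fderiv_apply_const hφ e
  have hdφc : HasCompactSupport dφ := hasCompactSupport_fderiv_apply hφc e
  have hdφt : tsupport dφ ⊆ tsupport φ := tsupport_fderiv_apply_subset' e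
  obtain ⟨B, hB⟩ := hφc.exists_bound_of_continuous hφ.continuous
  obtain ⟨B', hB'⟩ := hdφc.exists_bound_of_continuous hdφs.continuous
  have hB0 : 0 ≤ B := (norm_nonneg _).trans (hB 0)
  have hB0' : 0 ≤ B' := (norm_nonneg _).trans (hB' 0)
  have hgL : Tendsto (fun k => eLpNorm (moll k g' - g') 1) atTop (𝓝 0) :=
    tendsto_eLpNorm_moll_sub le_rfl ENNReal.one_ne_top (memLp_one_iff_integrable.2 hgi)
  have hvL : Tendsto (fun k => eLpNorm (moll k v' - v') 1) atTop (𝓝 0) :=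
    tendsto_eLpNorm_moll_sub le_rfl ENNReal.one_ne_top (memLp_one_iff_integrable.2 hvi)
  have hcg : ∀ k, Continuous (moll k g') := fun k =>
    (contDiff_moll k hgi.locallyIntegrable).continuous
  have hcv : ∀ k, Continuous (moll k v') := fun k =>
    (contDiff_moll k hvi.locallyIntegrable).continuous
  -- integrability of the limits
  have hint1 : Integrable fun x => dφ x • Ψ (g' x) := by
    have : LocallyIntegrableOn (fun x => Ψ (g' x)) ((⊤ : Opens (𝔼 n)) : Set (𝔼 n)) volume :=
      locallyIntegrableOn_opens_iff.2 fun K' _ hK' =>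
        integrableOn_comp_of_norm_fderiv_le hΨ hC hK' hgi.integrableOn
    exact integrable_smul_of_tsupport_subset this hdφs.continuous hdφc (subset_univ _)
  have hfi : Integrable fun x => fderiv ℝ Ψ (g' x) (v' x) := by
    have := integrableOn_fderiv_comp hΨ hC (K := univ) hgi.integrableOn hvi.integrableOn
    rwa [integrableOn_univ] at this
  have hint2 : Integrable fun x => φ x • fderiv ℝ Ψ (g' x) (v' x) := by
    refine hfi.bdd_smul B hφ.continuous.aestronglyMeasurable (Eventually.of_forall hB)
  -- convergence of the left-hand sides
  have hL : Tendsto (fun k => ∫ x, dφ x • Ψ (moll k g' x)) atTop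
      (𝓝 (∫ x, dφ x • Ψ (g' x))) := by
    refine tendsto_integral_of_L1 _ hint1.aestronglyMeasurable (Eventually.of_forall fun k => ?_) ?_
    · exact (hdφs.continuous.smul (hΨ.continuous.comp (hcg k))).integrable_of_hasCompactSupport
        hdφc.smul_right
    · refine tendsto_lintegral_enorm_of_le (B' * C) (fun k x => ?_) hgL
      rw [← smul_sub, norm_smul, mul_assoc]
      exact mul_le_mul (hB' x) (norm_sub_le_of_norm_fderiv_le hΨ hC _ _) (norm_nonneg _) hB0'
  have hR : Tendsto (fun k => ∫ x, φ x • fderiv ℝ Ψ (moll k g' x) (moll k v' x)) atTop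
      (𝓝 (∫ x, φ x • fderiv ℝ Ψ (g' x) (v' x))) := by
    -- The derivative of Ψ is only continuous, so the limit is taken in two stages: replace the
    -- mollified `v'` by `v'` using L¹ convergence, then let the base point converge almost
    -- everywhere under domination.
    have hmid : ∀ k, Integrable fun x => φ x • fderiv ℝ Ψ (moll k g' x) (v' x) := by
      intro k
      refine Integrable.mono' (hvi.norm.const_mul (B * C)) ?_ (Eventually.of_forall fun x => ?_)
      · exact hφ.continuous.aestronglyMeasurable.smul
          ((continuous_fderiv_uncurry hΨ).comp_aestronglyMeasurable
            ((hcg k).aestronglyMeasurable.prodMk hvi.aestronglyMeasurable))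
      · rw [norm_smul, mul_assoc]
        exact mul_le_mul (hB x) ((le_opNorm _ _).trans
          (mul_le_mul_of_nonneg_right (hC _) (norm_nonneg _))) (norm_nonneg _) hB0
    have hmid' : ∀ k, Integrable fun x => φ x • fderiv ℝ Ψ (moll k g' x) (moll k v' x) := fun k =>
      (hφ.continuous.smul ((continuous_fderiv_uncurry hΨ).comp
        ((hcg k).prodMk (hcv k)))).integrable_of_hasCompactSupport hφc.smul_right
    have h1 : Tendsto (fun k => ∫ x, (φ x • fderiv ℝ Ψ (moll k g' x) (moll k v' x)
        - φ x • fderiv ℝ Ψ (moll k g' x) (v' x))) atTop (𝓝 0) := by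
      have := tendsto_integral_of_L1 (μ := volume) (fun _ : 𝔼 n => (0 : F')) aestronglyMeasurable_const
        (l := atTop) (F := fun k x => φ x • fderiv ℝ Ψ (moll k g' x) (moll k v' x)
        - φ x • fderiv ℝ Ψ (moll k g' x) (v' x))
        (Eventually.of_forall fun k => (hmid' k).sub (hmid k)) ?_
      · simpa using this
      · refine tendsto_lintegral_enorm_of_le (B * C) (fun k x => ?_) hvL
        rw [sub_zero, ← smul_sub, ← map_sub, norm_smul, mul_assoc]
        exact mul_le_mul (hB x) ((le_opNorm _ _).trans
          (mul_le_mul_of_nonneg_right (hC _) (norm_nonneg _))) (norm_nonneg _) hB0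
    have h2 : Tendsto (fun k => ∫ x, φ x • fderiv ℝ Ψ (moll k g' x) (v' x)) atTop
        (𝓝 (∫ x, φ x • fderiv ℝ Ψ (g' x) (v' x))) := by
      refine tendsto_integral_of_dominated_convergence (fun x => B * (C * ‖v' x‖))
        (fun k => (hmid k).aestronglyMeasurable) ((hvi.norm.const_mul C).const_mul B)
        (fun k => Eventually.of_forall fun x => ?_) ?_
      · rw [norm_smul]
        exact mul_le_mul (hB x) ((le_opNorm _ _).trans
          (mul_le_mul_of_nonneg_right (hC _) (norm_nonneg _))) (norm_nonneg _) hB0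
      · filter_upwards [ae_tendsto_moll hgi.locallyIntegrable] with x hx
        refine Tendsto.const_smul ?_ _
        exact ((continuous_fderiv_uncurry hΨ).tendsto (g' x, v' x)).comp
          (hx.prodMk_nhds tendsto_const_nhds)
    have h3 := h1.add h2
    rw [zero_add] at h3
    refine h3.congr fun k => ?_
    rw [integral_sub (hmid' k) (hmid k)]; abel
  -- the identity for mollifications
  have hid : ∀ᶠ k in atTop, ∫ x, dφ x • Ψ (moll k g' x)
      = -∫ x, φ x • fderiv ℝ Ψ (moll k g' x) (moll k v' x) := by
    filter_upwards [(tendsto_mollBump_rOut n).eventually_le_const hδ] with k hk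
    have hs1 : ContDiff ℝ 1 (moll k g') := (contDiff_moll k hgi.locallyIntegrable).of_le (by simp)
    have hcomp : ContDiff ℝ 1 fun x => Ψ (moll k g' x) := hΨ.comp hs1
    have hfd : ∀ x ∈ tsupport φ, fderiv ℝ (fun x => Ψ (moll k g' x)) x e
        = fderiv ℝ Ψ (moll k g' x) (moll k v' x) := by
      intro x hx
      have hb : closedBall x (mollBump n k).rOut ⊆ K :=
        (closedBall_subset_closedBall hk).trans (closedBall_subset_cthickening hx δ)
      rw [hv', ← fderiv_moll_indicator h hK hδΩ hb]
      have := fderiv_comp x (hΨ.differentiable one_ne_zero (moll k g' x))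
        (hs1.differentiable one_ne_zero x)
      simp only [Function.comp_def] at this
      rw [this]; rfl
    have hibp := integral_smul_fderiv_eq_neg_fderiv_smul_of_integrable (μ := volume) (v := e)
      (f := φ) (g := fun x => Ψ (moll k g' x))
      ((hdφs.continuous.smul hcomp.continuous).integrable_of_hasCompactSupport hdφc.smul_right)
      ((hφ.continuous.smul ((hcomp.continuous_fderiv one_ne_zero).clm_apply
        continuous_const)).integrable_of_hasCompactSupport hφc.smul_right)
      ((hφ.continuous.smul hcomp.continuous).integrable_of_hasCompactSupport hφc.smul_right)
      (fun x _ => hφ.differentiable (by simp) x)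
      (fun x _ => hcomp.differentiable one_ne_zero x)
    rw [eq_neg_iff_add_eq_zero, ← eq_neg_iff_add_eq_zero.1 hibp, add_comm]
    congr 1
    refine integral_congr_ae (Eventually.of_forall fun x => ?_)
    by_cases hx : x ∈ tsupport φ
    · simp only; rw [hfd x hx]
    · simp [image_eq_zero_of_notMem_tsupport hx]
  have hlim := tendsto_nhds_unique (hL.congr' hid) hR.neg
  have e1 : ∀ x, dφ x • Ψ (g' x) = dφ x • Ψ (g x) := by
    intro x
    by_cases hx : x ∈ K
    · rw [hg', indicator_of_mem hx]
    · rw [image_eq_zero_of_notMem_tsupport fun h' => hx (hsK (hdφt h'))]; simp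
  have e2 : ∀ x, φ x • fderiv ℝ Ψ (g' x) (v' x) = φ x • fderiv ℝ Ψ (g x) (v x) := by
    intro x
    by_cases hx : x ∈ K
    · rw [hg', hv', indicator_of_mem hx, indicator_of_mem hx]
    · rw [image_eq_zero_of_notMem_tsupport fun h' => hx (hsK h')]; simp
  simpa only [e1, e2] using hlim

end WeakDeriv

end MeanCurvature

open Filter Set Metric ContinuousLinearMap
open scoped Topology ContDiff Convolution

namespace MeanCurvature

local notation "𝔼" n => EuclideanSpace ℝ (Fin n)

/-! ### Gradients, and weak derivatives of pairs, components and inner products. -/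

section WeakDerivTools

set_option linter.unusedSectionVars false

variable {n : ℕ} {F F' : Type*} [NormedAddCommGroup F] [NormedSpace ℝ F]
  [NormedAddCommGroup F'] [NormedSpace ℝ F']

/-- The `i`-th vector of the standard basis. -/
noncomputable abbrev bv (i : Fin n) : 𝔼 n := EuclideanSpace.single i (1 : ℝ)

lemma gradient_apply (φ : (𝔼 n) → ℝ) (x : 𝔼 n) (i : Fin n) :
    ∇ φ x i = fderiv ℝ φ x (bv i) := by
  have h : inner ℝ (∇ φ x) (bv i) = fderiv ℝ φ x (bv i) := by
    rw [gradient, InnerProductSpace.toDual_symm_apply]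
  rw [← h, EuclideanSpace.inner_single_right]
  simp

lemma inner_gradient (φ : (𝔼 n) → ℝ) (x e : 𝔼 n) : inner ℝ (∇ φ x) e = fderiv ℝ φ x e := by
  rw [gradient, InnerProductSpace.toDual_symm_apply]

lemma continuous_gradient {φ : (𝔼 n) → ℝ} (hφ : ContDiff ℝ ∞ φ) : Continuous fun x => ∇ φ x :=
  (InnerProductSpace.toDual ℝ (𝔼 n)).symm.continuous.comp (hφ.continuous_fderiv (by simp))

lemma gradient_eq_zero_of_notMem_tsupport {φ : (𝔼 n) → ℝ} {x : 𝔼 n} (hx : x ∉ tsupport φ) :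
    ∇ φ x = 0 := by
  have : fderiv ℝ φ x = 0 := image_eq_zero_of_notMem_tsupport
    (f := fderiv ℝ φ) fun h => hx (tsupport_fderiv_subset ℝ h)
  rw [gradient, this, map_zero]

/-- Pairing allows the one-variable chain rule to be applied to nonlinear functions of (∇u, ∂ⱼ∇u)
and of (u, ∇u). -/
lemma HasWeakDeriv.prodMk [CompleteSpace F] [CompleteSpace F'] {Ω : Opens (𝔼 n)} {e : 𝔼 n}
    {g v : (𝔼 n) → F} {g' v' : (𝔼 n) → F'} (h : HasWeakDeriv Ω e g v)
    (h' : HasWeakDeriv Ω e g' v') :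
    HasWeakDeriv Ω e (fun x => (g x, g' x)) fun x => (v x, v' x) := by
  have hl : ∀ {a : (𝔼 n) → F} {b : (𝔼 n) → F'}, LocallyIntegrableOn a Ω volume →
      LocallyIntegrableOn b Ω volume → LocallyIntegrableOn (fun x => (a x, b x)) Ω volume := by
    intro a b ha hb
    rw [locallyIntegrableOn_opens_iff] at *
    exact fun K h1 h2 => (ha K h1 h2).prodMk (hb K h1 h2)
  have h1 := hl h.locInt h'.locInt
  have h2 := hl h.locInt_deriv h'.locInt_deriv
  refine ⟨h1, h2, fun φ hφ hc hs => ?_⟩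
  have i1 := integrable_smul_of_tsupport_subset h1 (contDiff_fderiv_apply_const hφ e).continuous
    (hasCompactSupport_fderiv_apply hc e) ((tsupport_fderiv_apply_subset' e).trans hs)
  have i2 := integrable_smul_of_tsupport_subset h2 hφ.continuous hc hs
  refine Prod.ext ?_ ?_
  · have e1 := (ContinuousLinearMap.fst ℝ F F').integral_comp_comm i1
    have e2 := (ContinuousLinearMap.fst ℝ F F').integral_comp_comm i2
    simp only [ContinuousLinearMap.coe_fst', Prod.smul_fst] at e1 e2
    rw [Prod.fst_neg, ← e1, ← e2]
    exact h.integral_eq φ hφ hc hs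
  · have e1 := (ContinuousLinearMap.snd ℝ F F').integral_comp_comm i1
    have e2 := (ContinuousLinearMap.snd ℝ F F').integral_comp_comm i2
    simp only [ContinuousLinearMap.coe_snd', Prod.smul_snd] at e1 e2
    rw [Prod.snd_neg, ← e1, ← e2]
    exact h'.integral_eq φ hφ hc hs

lemma HasWeakDeriv.apply {Ω : Opens (𝔼 n)} {e : 𝔼 n} {g v : (𝔼 n) → 𝔼 n}
    (h : HasWeakDeriv Ω e g v) (i : Fin n) :
    HasWeakDeriv Ω e (fun x => g x i) fun x => v x i := by
  have hl : ∀ {a : (𝔼 n) → 𝔼 n}, LocallyIntegrableOn a Ω volume →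
      LocallyIntegrableOn (fun x => a x i) Ω volume := by
    intro a ha
    rw [locallyIntegrableOn_opens_iff] at *
    exact fun K h1 h2 => (EuclideanSpace.proj (𝕜 := ℝ) i).integrable_comp (ha K h1 h2)
  refine ⟨hl h.locInt, hl h.locInt_deriv, fun φ hφ hc hs => ?_⟩
  have i1 := integrable_smul_of_tsupport_subset h.locInt
    (contDiff_fderiv_apply_const hφ e).continuous
    (hasCompactSupport_fderiv_apply hc e) ((tsupport_fderiv_apply_subset' e).trans hs)
  have i2 := integrable_smul_of_tsupport_subset h.locInt_deriv hφ.continuous hc hs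
  have e1 := (EuclideanSpace.proj (𝕜 := ℝ) i).integral_comp_comm i1
  have e2 := (EuclideanSpace.proj (𝕜 := ℝ) i).integral_comp_comm i2
  have e3 := congrArg (fun z : 𝔼 n => z i) (h.integral_eq φ hφ hc hs)
  simp only [PiLp.proj_apply, PiLp.smul_apply, PiLp.neg_apply] at e1 e2 e3
  rw [e1, e2, e3]

lemma integrable_inner_of_tsupport_subset {Ω : Opens (𝔼 n)} {g a : (𝔼 n) → 𝔼 n}
    (hg : LocallyIntegrableOn g Ω volume) (ha : Continuous a) (hc : HasCompactSupport a)
    (hs : tsupport a ⊆ Ω) : Integrable fun x => inner ℝ (a x) (g x) := by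
  obtain ⟨B, hB⟩ := hc.exists_bound_of_continuous ha
  have h1 : IntegrableOn g (tsupport a) := locallyIntegrableOn_opens_iff.1 hg _ hs hc
  have h2 : IntegrableOn (fun x => inner ℝ (a x) (g x)) (tsupport a) := by
    refine Integrable.mono' (h1.norm.const_mul B)
      (ha.aestronglyMeasurable.inner h1.aestronglyMeasurable) (Eventually.of_forall fun x => ?_)
    exact (norm_inner_le_norm _ _).trans (mul_le_mul_of_nonneg_right (hB x) (norm_nonneg _))
  exact (integrableOn_iff_integrable_of_support_subset (fun x hx => subset_tsupport a
    (fun h0 => hx (by simp [h0])))).1 h2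

/-- Integration by parts against a smooth compactly supported vector field. -/
lemma HasWeakDeriv.integral_inner {Ω : Opens (𝔼 n)} {e : 𝔼 n} {g v : (𝔼 n) → 𝔼 n}
    (h : HasWeakDeriv Ω e g v) {a : (𝔼 n) → 𝔼 n} (ha : ContDiff ℝ ∞ a) (hc : HasCompactSupport a)
    (hs : tsupport a ⊆ Ω) :
    Integrable (fun x => inner ℝ (fderiv ℝ a x e) (g x)) ∧
    Integrable (fun x => inner ℝ (a x) (v x)) ∧
    ∫ x, inner ℝ (fderiv ℝ a x e) (g x) = -∫ x, inner ℝ (a x) (v x) := by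
  have i1 := integrable_inner_of_tsupport_subset h.locInt
    (contDiff_fderiv_apply_const ha e).continuous
    (hasCompactSupport_fderiv_apply hc e) ((tsupport_fderiv_apply_subset' e).trans hs)
  have i2 := integrable_inner_of_tsupport_subset h.locInt_deriv ha.continuous hc hs
  refine ⟨i1, i2, ?_⟩
  have hai : ∀ i, ContDiff ℝ ∞ fun x => a x i := fun i =>
    (EuclideanSpace.proj (𝕜 := ℝ) i).contDiff.comp ha
  have hci : ∀ i, HasCompactSupport fun x => a x i := fun i =>
    hc.comp_left (g := fun z : 𝔼 n => z i) rfl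
  have hsi : ∀ i, tsupport (fun x => a x i) ⊆ Ω := fun i =>
    (tsupport_comp_subset (g := fun z : 𝔼 n => z i) rfl a).trans hs
  have hfd : ∀ i x, fderiv ℝ (fun x => a x i) x e = fderiv ℝ a x e i := by
    intro i x
    have := ((EuclideanSpace.proj (𝕜 := ℝ) i).hasFDerivAt.comp x
      (ha.differentiable (by simp) x).hasFDerivAt).fderiv
    simp only [Function.comp_def, PiLp.proj_apply] at this
    rw [this]; rfl
  have key := fun i => (h.apply i).integral_eq _ (hai i) (hci i) (hsi i)
  simp only [hfd, smul_eq_mul] at key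
  have hin : ∀ z z' : 𝔼 n, inner ℝ z z' = ∑ i, z i * z' i := by
    intro z z'
    rw [PiLp.inner_apply]
    exact Finset.sum_congr rfl fun i _ => by simp [mul_comm]
  simp only [hin]
  rw [integral_finsetSum, integral_finsetSum, ← Finset.sum_neg_distrib]
  · exact Finset.sum_congr rfl fun i _ => key i
  · intro i _
    simpa using integrable_smul_of_tsupport_subset (h.apply i).locInt_deriv (hai i).continuous
      (hci i) (hsi i)
  · intro i _
    simpa [hfd] using integrable_smul_of_tsupport_subset (h.apply i).locInt
      (contDiff_fderiv_apply_const (hai i) e).continuous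
      (hasCompactSupport_fderiv_apply (hci i) e) ((tsupport_fderiv_apply_subset' e).trans (hsi i))

/-- The inner product of a weakly differentiable field with a smooth compactly supported field. -/
lemma HasWeakDeriv.inner_smooth {Ω : Opens (𝔼 n)} {e : 𝔼 n} {g v : (𝔼 n) → 𝔼 n}
    (h : HasWeakDeriv Ω e g v) {a : (𝔼 n) → 𝔼 n} (ha : ContDiff ℝ ∞ a) (hc : HasCompactSupport a)
    (hs : tsupport a ⊆ Ω) :
    HasWeakDeriv ⊤ e (fun x => inner ℝ (a x) (g x))
      fun x => inner ℝ (fderiv ℝ a x e) (g x) + inner ℝ (a x) (v x) := by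
  obtain ⟨i1, i2, -⟩ := h.integral_inner ha hc hs
  refine ⟨(integrable_inner_of_tsupport_subset h.locInt ha.continuous hc hs).locallyIntegrable.locallyIntegrableOn _,
    (i1.add i2).locallyIntegrable.locallyIntegrableOn _, fun φ hφ hφc _ => ?_⟩
  have hb : ContDiff ℝ ∞ fun x => φ x • a x := hφ.smul ha
  have hsub : tsupport (fun x => φ x • a x) ⊆ tsupport a :=
    closure_mono fun x hx h0 => hx (by simp only [h0, smul_zero])
  have hbc : HasCompactSupport fun x => φ x • a x :=
    hc.isCompact.of_isClosed_subset (isClosed_tsupport _) hsub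
  have hbs : tsupport (fun x => φ x • a x) ⊆ Ω := hsub.trans hs
  obtain ⟨j1, j2, j3⟩ := h.integral_inner hb hbc hbs
  have hfd : ∀ x, fderiv ℝ (fun x => φ x • a x) x e
      = φ x • fderiv ℝ a x e + fderiv ℝ φ x e • a x := by
    intro x
    have := ((hφ.differentiable (by simp) x).hasFDerivAt.smul
      (ha.differentiable (by simp) x).hasFDerivAt).fderiv
    have h2 : (φ • a) = fun x => φ x • a x := rfl
    rw [h2] at this
    rw [this]; simp
  obtain ⟨B, hB⟩ := hφc.exists_bound_of_continuous hφ.continuous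
  have k1 : Integrable fun x => φ x * inner ℝ (fderiv ℝ a x e) (g x) :=
    i1.bdd_mul hφ.continuous.aestronglyMeasurable (Eventually.of_forall hB)
  have k2 : Integrable fun x => φ x * inner ℝ (a x) (v x) :=
    i2.bdd_mul hφ.continuous.aestronglyMeasurable (Eventually.of_forall hB)
  have e1 : ∀ x, inner ℝ (fderiv ℝ (fun x => φ x • a x) x e) (g x)
      = φ x * inner ℝ (fderiv ℝ a x e) (g x) + fderiv ℝ φ x e * inner ℝ (a x) (g x) := by
    intro x
    rw [hfd, inner_add_left, real_inner_smul_left, real_inner_smul_left]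
  simp only [real_inner_smul_left] at j3
  have k3 : Integrable fun x => fderiv ℝ φ x e * inner ℝ (a x) (g x) := by
    refine (j1.sub k1).congr (Eventually.of_forall fun x => ?_)
    simp only [Pi.sub_apply, e1]; ring
  simp only [e1] at j3
  rw [integral_add k1 k3] at j3
  simp only [smul_eq_mul, mul_add]
  rw [integral_add k1 k2]
  linarith

end WeakDerivTools

/-! ### Bounded test functions with square integrable weak gradient -/

section TestClass

variable {n : ℕ}

/-- `ψ` is bounded, has compact support in `Ω` and has the square integrable weak gradient `D`. -/
structure IsW12Test (Ω : Opens (𝔼 n)) (ψ : (𝔼 n) → ℝ) (D : (𝔼 n) → 𝔼 n) : Prop where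
  bdd : ∃ B, ∀ x, ‖ψ x‖ ≤ B
  supp : ∃ K, IsCompact K ∧ K ⊆ (Ω : Set (𝔼 n)) ∧ (∀ x ∉ K, ψ x = 0) ∧ ∀ x ∉ K, D x = 0
  memLp : MemLp D 2
  weak : ∀ i, HasWeakDeriv ⊤ (bv i) ψ fun x => D x i

lemma gradient_moll {Ω : Opens (𝔼 n)} {ψ : (𝔼 n) → ℝ} {D : (𝔼 n) → 𝔼 n} (h : IsW12Test Ω ψ D)
    (k : ℕ) (x : 𝔼 n) : ∇ (moll k ψ) x = moll k D x := by
  obtain ⟨K, hK, -, h0, h1⟩ := h.supp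
  ext i
  set K' := K ∪ closedBall x (mollBump n k).rOut with hK'
  have hind : ∀ {a : (𝔼 n) → ℝ}, (∀ x ∉ K, a x = 0) → K'.indicator a = a := by
    intro a ha
    ext z
    by_cases hz : z ∈ K'
    · rw [indicator_of_mem hz]
    · rw [indicator_of_notMem hz, ha z fun h => hz (Or.inl h)]
  have := fderiv_moll_indicator (h.weak i) (hK.union (isCompact_closedBall x _)) (subset_univ _)
    (subset_union_right : closedBall x (mollBump n k).rOut ⊆ K')
  rw [hind h0, hind fun z hz => by rw [h1 z hz]; rfl] at this
  rw [gradient_apply, this, moll_apply, moll_apply]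
  have hint := integrable_mollKernel_smul k (h.memLp.locallyIntegrable (by norm_num)) x
  have e1 := (EuclideanSpace.proj (𝕜 := ℝ) i).integral_comp_comm hint
  simp only [PiLp.proj_apply, PiLp.smul_apply] at e1
  rw [← e1]

/-- Mollification gives uniform bounds and one common compact support in Ω, almost everywhere
convergence of values and L² convergence of gradients. These are the modes needed against a merely
L¹ potential and an L² flux. -/
lemma IsW12Test.exists_approx {Ω : Opens (𝔼 n)} {ψ : (𝔼 n) → ℝ} {D : (𝔼 n) → 𝔼 n}
    (h : IsW12Test Ω ψ D) :
    ∃ (Φ : ℕ → (𝔼 n) → ℝ) (K : Set (𝔼 n)) (B : ℝ), IsCompact K ∧ K ⊆ Ω ∧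
      (∀ x ∉ K, ψ x = 0) ∧ (∀ x ∉ K, D x = 0) ∧
      (∀ k, ContDiff ℝ ∞ (Φ k)) ∧ (∀ k, tsupport (Φ k) ⊆ K) ∧ (∀ k x, ‖Φ k x‖ ≤ B) ∧
      (∀ᵐ x, Tendsto (fun k => Φ k x) atTop (𝓝 (ψ x))) ∧
      Tendsto (fun k => eLpNorm (fun x => ∇ (Φ k) x - D x) 2) atTop (𝓝 0) := by
  obtain ⟨K, hK, hKΩ, h0, h1⟩ := h.supp
  obtain ⟨B, hB⟩ := h.bdd
  obtain ⟨δ, hδ, hδΩ⟩ := hK.exists_cthickening_subset_open Ω.isOpen hKΩ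
  obtain ⟨k₀, hk₀⟩ := eventually_atTop.1 ((tendsto_mollBump_rOut n).eventually_le_const hδ)
  have hloc : LocallyIntegrable ψ := by
    -- In dimension zero there is no weak derivative from which to read off local integrability.
    rcases isEmpty_or_nonempty (Fin n) with hn | ⟨⟨i⟩⟩
    · have hψ : Continuous ψ := continuous_of_const fun a b => congrArg ψ (Subsingleton.elim a b)
      exact hψ.locallyIntegrable
    · have := (h.weak i).locInt
      rwa [show (((⊤ : Opens (𝔼 n)) : Set (𝔼 n))) = univ from rfl, locallyIntegrableOn_univ] at this
  refine ⟨fun k => moll (k + k₀) ψ, cthickening δ K, B, hK.cthickening, hδΩ,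
    fun x hx => h0 x fun h => hx (self_subset_cthickening _ h),
    fun x hx => h1 x fun h => hx (self_subset_cthickening _ h),
    fun k => contDiff_moll _ hloc, fun k => ?_, fun k x => norm_moll_le hB _ x, ?_, ?_⟩
  · exact closure_minimal (support_moll_subset h0 (hk₀ _ (by omega))) isClosed_cthickening
  · filter_upwards [ae_tendsto_moll hloc] with x hx
    exact hx.comp (tendsto_add_atTop_nat k₀)
  · simp only [gradient_moll h]
    exact (tendsto_eLpNorm_moll_sub (p := 2) (by norm_num) (by norm_num) h.memLp).comp
      (tendsto_add_atTop_nat k₀)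

lemma lintegral_enorm_mul_enorm_le {α F F' : Type*} [NormedAddCommGroup F]
    [NormedAddCommGroup F'] [MeasurableSpace α] {μ : Measure α} {f : α → F} {g : α → F'}
    (hf : AEStronglyMeasurable f μ) (hg : AEStronglyMeasurable g μ) :
    ∫⁻ x, ‖f x‖ₑ * ‖g x‖ₑ ∂μ ≤ eLpNorm f 2 μ * eLpNorm g 2 μ := by
  have := ENNReal.lintegral_mul_le_Lp_mul_Lq μ (p := 2) (q := 2)
    (Real.HolderConjugate.two_two) hf.enorm hg.enorm
  rw [eLpNorm_eq_lintegral_rpow_enorm_toReal (by norm_num) (by norm_num),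
    eLpNorm_eq_lintegral_rpow_enorm_toReal (by norm_num) (by norm_num)]
  simpa using this

/-- A weak equation tested with smooth functions may be tested with bounded `W^{1,2}` functions. -/
lemma IsW12Test.integral_inner_eq {Ω : Opens (𝔼 n)} {ψ : (𝔼 n) → ℝ} {D : (𝔼 n) → 𝔼 n}
    (h : IsW12Test Ω ψ D) {b : (𝔼 n) → ℝ} {X : (𝔼 n) → 𝔼 n} (hb : LocallyIntegrableOn b Ω volume)
    (hX : ∀ K ⊆ (Ω : Set (𝔼 n)), IsCompact K → MemLp X 2 (volume.restrict K))
    (heq : ∀ φ : (𝔼 n) → ℝ, ContDiff ℝ ∞ φ → HasCompactSupport φ → tsupport φ ⊆ Ω →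
      ∫ x, inner ℝ (X x) (∇ φ x) = ∫ x, b x * φ x) :
    ∫ x, inner ℝ (X x) (D x) = ∫ x, b x * ψ x := by
  obtain ⟨Φ, K, B, hK, hKΩ, h0, h1, hΦ, hts, hB, hae, hL2⟩ := h.exists_approx
  have hc : ∀ k, HasCompactSupport (Φ k) := fun k =>
    hK.of_isClosed_subset (isClosed_tsupport _) (hts k)
  have hz : ∀ k, ∀ x ∉ K, Φ k x = 0 := fun k x hx =>
    image_eq_zero_of_notMem_tsupport fun h => hx (hts k h)
  have hz' : ∀ k, ∀ x ∉ K, ∇ (Φ k) x = 0 := fun k x hx =>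
    gradient_eq_zero_of_notMem_tsupport fun h => hx (hts k h)
  have hXK := hX K hKΩ hK
  have hbK := locallyIntegrableOn_opens_iff.1 hb K hKΩ hK
  have hmD : AEStronglyMeasurable D (volume.restrict K) := h.memLp.aestronglyMeasurable.restrict
  have hmΦ : ∀ k, AEStronglyMeasurable (fun x => ∇ (Φ k) x) (volume.restrict K) := fun k =>
    (continuous_gradient (hΦ k)).aestronglyMeasurable
  have r1 : ∫ x, inner ℝ (X x) (D x) = ∫ x in K, inner ℝ (X x) (D x) :=
    (setIntegral_eq_integral_of_forall_compl_eq_zero fun x hx => by simp [h1 x hx]).symm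
  have r2 : ∫ x, b x * ψ x = ∫ x in K, b x * ψ x :=
    (setIntegral_eq_integral_of_forall_compl_eq_zero fun x hx => by simp [h0 x hx]).symm
  have r3 : ∀ k, ∫ x in K, inner ℝ (X x) (∇ (Φ k) x) = ∫ x in K, b x * Φ k x := by
    intro k
    rw [setIntegral_eq_integral_of_forall_compl_eq_zero fun x hx => by simp [hz' k x hx],
      setIntegral_eq_integral_of_forall_compl_eq_zero fun x hx => by simp [hz k x hx]]
    exact heq _ (hΦ k) (hc k) ((hts k).trans hKΩ)
  rw [r1, r2]
  have t1 : Tendsto (fun k => ∫ x in K, inner ℝ (X x) (∇ (Φ k) x)) atTop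
      (𝓝 (∫ x in K, inner ℝ (X x) (D x))) := by
    refine tendsto_integral_of_L1 _ (hXK.aestronglyMeasurable.inner hmD)
      (Eventually.of_forall fun k => ?_) ?_
    · have : MemLp (fun x => ∇ (Φ k) x) 2 (volume.restrict K) :=
        ((continuous_gradient (hΦ k)).memLp_of_hasCompactSupport
          (HasCompactSupport.intro hK (hz' k))).restrict K
      exact Integrable.mono' (hXK.norm.integrable_mul this.norm)
        (hXK.aestronglyMeasurable.inner (hmΦ k))
        (Eventually.of_forall fun x => norm_inner_le_norm _ _)
    · have hup : Tendsto (fun k => eLpNorm X 2 (volume.restrict K) *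
          eLpNorm (fun x => ∇ (Φ k) x - D x) 2) atTop (𝓝 0) := by
        simpa using ENNReal.Tendsto.const_mul hL2 (Or.inr hXK.eLpNorm_ne_top)
      refine tendsto_of_tendsto_of_tendsto_of_le_of_le tendsto_const_nhds hup
        (fun k => zero_le) fun k => ?_
      calc ∫⁻ x in K, ‖inner ℝ (X x) (∇ (Φ k) x) - inner ℝ (X x) (D x)‖ₑ
          ≤ ∫⁻ x in K, ‖X x‖ₑ * ‖∇ (Φ k) x - D x‖ₑ := by
            refine lintegral_mono fun x => ?_
            rw [← inner_sub_right, ← ofReal_norm, ← ofReal_norm, ← ofReal_norm,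
              ← ENNReal.ofReal_mul (norm_nonneg _)]
            exact ENNReal.ofReal_le_ofReal (norm_inner_le_norm _ _)
        _ ≤ _ := lintegral_enorm_mul_enorm_le hXK.aestronglyMeasurable ((hmΦ k).sub hmD)
        _ ≤ _ := by gcongr; exact Measure.restrict_le_self
  have t2 : Tendsto (fun k => ∫ x in K, b x * Φ k x) atTop (𝓝 (∫ x in K, b x * ψ x)) := by
    refine tendsto_integral_of_dominated_convergence (fun x => ‖b x‖ * B)
      (fun k => hbK.aestronglyMeasurable.mul (hΦ k).continuous.aestronglyMeasurable)
      (hbK.norm.mul_const B) (fun k => Eventually.of_forall fun x => ?_) ?_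
    · rw [norm_mul]; exact mul_le_mul_of_nonneg_left (hB k x) (norm_nonneg _)
    · filter_upwards [ae_restrict_of_ae hae] with x hx using hx.const_mul _
  exact tendsto_nhds_unique t1 (t2.congr fun k => (r3 k).symm)

/-- A quadratic inequality tested with smooth functions may be tested with bounded `W^{1,2}`
functions. -/
lemma IsW12Test.integral_sq_le {Ω : Opens (𝔼 n)} {ψ : (𝔼 n) → ℝ} {D : (𝔼 n) → 𝔼 n}
    (h : IsW12Test Ω ψ D) {b : (𝔼 n) → ℝ} {q : (𝔼 n) → (𝔼 n) → ℝ}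
    (hb : LocallyIntegrableOn b Ω volume)
    (hq : ∀ x X Y, |q x X - q x Y| ≤ ‖X - Y‖ * (‖X‖ + ‖Y‖)) (hq0 : ∀ x, q x 0 = 0)
    (hqm : ∀ X : (𝔼 n) → 𝔼 n, AEStronglyMeasurable X volume →
      AEStronglyMeasurable (fun x => q x (X x)) volume)
    (hle : ∀ φ : (𝔼 n) → ℝ, ContDiff ℝ ∞ φ → HasCompactSupport φ → tsupport φ ⊆ Ω →
      ∫ x, b x * φ x ^ 2 ≤ ∫ x, q x (∇ φ x)) :
    ∫ x, b x * ψ x ^ 2 ≤ ∫ x, q x (D x) := by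
  obtain ⟨Φ, K, B, hK, hKΩ, h0, h1, hΦ, hts, hB, hae, hL2⟩ := h.exists_approx
  have hc : ∀ k, HasCompactSupport (Φ k) := fun k =>
    hK.of_isClosed_subset (isClosed_tsupport _) (hts k)
  have hz : ∀ k, ∀ x ∉ K, Φ k x = 0 := fun k x hx =>
    image_eq_zero_of_notMem_tsupport fun h => hx (hts k h)
  have hz' : ∀ k, ∀ x ∉ K, ∇ (Φ k) x = 0 := fun k x hx =>
    gradient_eq_zero_of_notMem_tsupport fun h => hx (hts k h)
  have hbK := locallyIntegrableOn_opens_iff.1 hb K hKΩ hK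
  have hmD := h.memLp.aestronglyMeasurable
  have hmΦ : ∀ k, AEStronglyMeasurable (fun x => ∇ (Φ k) x) volume := fun k =>
    (continuous_gradient (hΦ k)).aestronglyMeasurable
  have hΦ2 : ∀ k, MemLp (fun x => ∇ (Φ k) x) 2 volume := fun k =>
    (continuous_gradient (hΦ k)).memLp_of_hasCompactSupport (HasCompactSupport.intro hK (hz' k))
  have r2 : ∫ x, b x * ψ x ^ 2 = ∫ x in K, b x * ψ x ^ 2 :=
    (setIntegral_eq_integral_of_forall_compl_eq_zero fun x hx => by simp [h0 x hx]).symm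
  have t1 : Tendsto (fun k => ∫ x, q x (∇ (Φ k) x)) atTop (𝓝 (∫ x, q x (D x))) := by
    refine tendsto_integral_of_L1 _ (hqm D hmD) (Eventually.of_forall fun k => ?_) ?_
    · refine Integrable.mono' ((hΦ2 k).integrable_norm_pow two_ne_zero) (hqm _ (hmΦ k))
        (Eventually.of_forall fun x => ?_)
      have := hq x (∇ (Φ k) x) 0
      simpa [hq0, pow_two] using this
    -- By Cauchy–Schwarz the difference of quadratic terms is at most the norm of the gradient
    -- difference times a factor that stays bounded.
    · have hup : Tendsto (fun k => eLpNorm (fun x => ∇ (Φ k) x - D x) 2 *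
          (eLpNorm (fun x => ∇ (Φ k) x - D x) 2 + 2 * eLpNorm D 2)) atTop (𝓝 0) := by
        have h2 : Tendsto (fun k => eLpNorm (fun x => ∇ (Φ k) x - D x) 2 + 2 * eLpNorm D 2) atTop
            (𝓝 (0 + 2 * eLpNorm D 2)) := hL2.add tendsto_const_nhds
        have h3 : (0 : ℝ≥0∞) + 2 * eLpNorm D 2 ≠ ⊤ := by
          simpa using ENNReal.mul_ne_top (by simp) h.memLp.eLpNorm_ne_top
        simpa using ENNReal.Tendsto.mul hL2 (Or.inr h3) h2 (Or.inr (by simp))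
      refine tendsto_of_tendsto_of_tendsto_of_le_of_le tendsto_const_nhds hup
        (fun k => zero_le) fun k => ?_
      have hm2 : AEStronglyMeasurable (fun x => ‖∇ (Φ k) x‖ + ‖D x‖) volume :=
        (hmΦ k).norm.add hmD.norm
      calc ∫⁻ x, ‖q x (∇ (Φ k) x) - q x (D x)‖ₑ
          ≤ ∫⁻ x, ‖∇ (Φ k) x - D x‖ₑ * ‖(‖∇ (Φ k) x‖ + ‖D x‖)‖ₑ := by
            refine lintegral_mono fun x => ?_
            rw [← ofReal_norm, ← ofReal_norm, ← ofReal_norm, ← ENNReal.ofReal_mul (norm_nonneg _)]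
            refine ENNReal.ofReal_le_ofReal ?_
            rw [Real.norm_of_nonneg (show 0 ≤ ‖∇ (Φ k) x‖ + ‖D x‖ by positivity)]
            exact hq x _ _
        _ ≤ _ := lintegral_enorm_mul_enorm_le ((hmΦ k).sub hmD) hm2
        _ ≤ _ := by
            refine mul_le_mul_right ?_ _
            have e1 : eLpNorm (fun x => ‖∇ (Φ k) x‖ + ‖D x‖) 2 volume
                ≤ eLpNorm (fun x => ‖∇ (Φ k) x - D x‖ + 2 * ‖D x‖) 2 volume := by
              refine eLpNorm_mono_real fun x => ?_
              rw [Real.norm_of_nonneg (by positivity)]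
              have := norm_add_le (∇ (Φ k) x - D x) (D x)
              rw [sub_add_cancel] at this
              linarith
            refine e1.trans ((eLpNorm_add_le ((hmΦ k).sub hmD).norm (hmD.norm.const_mul 2)
              (by norm_num)).trans ?_)
            refine add_le_add (eLpNorm_norm _).le ?_
            have := eLpNorm_const_smul_le (c := (2 : ℝ)) (f := fun x => ‖D x‖) (p := 2)
              (μ := (volume : Measure (𝔼 n)))
            have e2 : ‖(2 : ℝ)‖ₑ = 2 := by
              rw [← ofReal_norm]; simp
            rw [eLpNorm_norm, e2] at this
            exact this
  have t2 : Tendsto (fun k => ∫ x in K, b x * Φ k x ^ 2) atTop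
      (𝓝 (∫ x in K, b x * ψ x ^ 2)) := by
    refine tendsto_integral_of_dominated_convergence (fun x => ‖b x‖ * B ^ 2)
      (fun k => hbK.aestronglyMeasurable.mul ((hΦ k).continuous.pow 2).aestronglyMeasurable)
      (hbK.norm.mul_const _) (fun k => Eventually.of_forall fun x => ?_) ?_
    · rw [norm_mul, norm_pow]
      exact mul_le_mul_of_nonneg_left (pow_le_pow_left₀ (norm_nonneg _) (hB k x) 2) (norm_nonneg _)
    · filter_upwards [ae_restrict_of_ae hae] with x hx using (hx.pow 2).const_mul _
  rw [r2]
  refine le_of_tendsto_of_tendsto' t2 t1 fun k => ?_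
  rw [setIntegral_eq_integral_of_forall_compl_eq_zero fun x hx => by simp [hz k x hx]]
  exact hle _ (hΦ k) (hc k) ((hts k).trans hKΩ)

end TestClass

end MeanCurvature

open Filter Set Metric ContinuousLinearMap
open scoped Topology ContDiff Convolution

namespace MeanCurvature

local notation "𝔼" n => EuclideanSpace ℝ (Fin n)

/-! ### The area integrand and its derivatives -/

section AreaIntegrand

variable {n : ℕ}

/-- The area element `√(1 + |p|²)`. -/
noncomputable def areaElt (p : 𝔼 n) : ℝ := √(1 + ‖p‖ ^ 2)

/-- The flux `p / √(1 + |p|²)`. -/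
noncomputable def flux (p : 𝔼 n) : 𝔼 n := (areaElt p)⁻¹ • p

/-- The derivative of the flux, which is the Hessian of the area integrand. -/
noncomputable def areaHess (p : 𝔼 n) : (𝔼 n) →L[ℝ] 𝔼 n :=
  (areaElt p)⁻¹ • ContinuousLinearMap.id ℝ (𝔼 n)
    - (areaElt p)⁻¹ ^ 3 • (innerSL ℝ p).smulRight p

lemma areaHess_apply (p q : 𝔼 n) :
    areaHess p q = (areaElt p)⁻¹ • q - ((areaElt p)⁻¹ ^ 3 * inner ℝ p q) • p := by
  simp [areaHess, smul_smul]

lemma areaElt_sq (p : 𝔼 n) : areaElt p ^ 2 = 1 + ‖p‖ ^ 2 := Real.sq_sqrt (by positivity)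

lemma areaElt_pos (p : 𝔼 n) : 0 < areaElt p := Real.sqrt_pos.2 (by positivity)

lemma one_le_areaElt (p : 𝔼 n) : 1 ≤ areaElt p := by
  rw [areaElt, Real.one_le_sqrt]; nlinarith [sq_nonneg ‖p‖]

lemma norm_le_areaElt (p : 𝔼 n) : ‖p‖ ≤ areaElt p :=
  Real.le_sqrt_of_sq_le (by linarith)

lemma areaElt_inv_pos (p : 𝔼 n) : 0 < (areaElt p)⁻¹ := inv_pos.2 (areaElt_pos p)

lemma areaElt_inv_le_one (p : 𝔼 n) : (areaElt p)⁻¹ ≤ 1 := inv_le_one_of_one_le₀ (one_le_areaElt p)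

lemma areaElt_inv_sq_mul (p : 𝔼 n) : (areaElt p)⁻¹ ^ 2 * ‖p‖ ^ 2 = 1 - (areaElt p)⁻¹ ^ 2 := by
  have h := areaElt_sq p
  have h0 := (areaElt_pos p).ne'
  have : ‖p‖ ^ 2 = areaElt p ^ 2 - 1 := by linarith
  rw [this]; field_simp

lemma norm_flux_le (p : 𝔼 n) : ‖flux p‖ ≤ 1 := by
  rw [flux, norm_smul, Real.norm_of_nonneg (areaElt_inv_pos p).le, inv_mul_le_iff₀ (areaElt_pos p),
    mul_one]
  exact norm_le_areaElt p

lemma contDiff_areaElt : ContDiff ℝ ∞ (areaElt : (𝔼 n) → ℝ) :=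
  (contDiff_const.add (contDiff_norm_sq ℝ)).sqrt fun p => by positivity

lemma hasFDerivAt_areaElt (p : 𝔼 n) :
    HasFDerivAt areaElt ((areaElt p)⁻¹ • innerSL ℝ p) p := by
  have h1 : HasFDerivAt (fun p : 𝔼 n => 1 + ‖p‖ ^ 2) (2 • innerSL ℝ p) p :=
    (hasStrictFDerivAt_norm_sq p).hasFDerivAt.const_add 1
  have h2 := h1.sqrt (by positivity)
  refine h2.congr_fderiv ?_
  ext q
  simp only [smul_apply, innerSL_apply_apply, smul_eq_mul, nsmul_eq_mul]
  rw [areaElt]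
  have : √(1 + ‖p‖ ^ 2) ≠ 0 := (areaElt_pos p).ne'
  field_simp
  norm_num

lemma hasFDerivAt_areaElt_inv (p : 𝔼 n) :
    HasFDerivAt (fun p : 𝔼 n => (areaElt p)⁻¹) (-((areaElt p)⁻¹ ^ 3 • innerSL ℝ p)) p := by
  have h := (hasDerivAt_inv (areaElt_pos p).ne').comp_hasFDerivAt p (hasFDerivAt_areaElt p)
  refine h.congr_fderiv ?_
  ext q
  simp only [smul_apply, neg_apply, smul_eq_mul]
  have := (areaElt_pos p).ne'
  field_simp

lemma contDiff_areaElt_inv : ContDiff ℝ ∞ fun p : 𝔼 n => (areaElt p)⁻¹ :=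
  contDiff_areaElt.inv fun p => (areaElt_pos p).ne'

lemma contDiff_flux : ContDiff ℝ ∞ (flux : (𝔼 n) → 𝔼 n) :=
  contDiff_areaElt_inv.smul contDiff_id

lemma hasFDerivAt_flux (p : 𝔼 n) : HasFDerivAt flux (areaHess p) p := by
  have h := (hasFDerivAt_areaElt_inv p).smul (hasFDerivAt_id p)
  refine h.congr_fderiv ?_
  ext1 q
  rw [areaHess_apply]
  simp only [add_apply, smul_apply,
    ContinuousLinearMap.smulRight_apply, neg_apply, innerSL_apply_apply,
    ContinuousLinearMap.id_apply, id, smul_eq_mul, neg_smul]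
  abel

lemma fderiv_flux (p : 𝔼 n) : fderiv ℝ flux p = areaHess p := (hasFDerivAt_flux p).fderiv

lemma inner_areaHess (p q r : 𝔼 n) : inner ℝ (areaHess p q) r
    = (areaElt p)⁻¹ * inner ℝ q r - (areaElt p)⁻¹ ^ 3 * inner ℝ p q * inner ℝ p r := by
  rw [areaHess_apply, inner_sub_left, real_inner_smul_left, real_inner_smul_left]

lemma inner_areaHess_comm (p q r : 𝔼 n) :
    inner ℝ (areaHess p q) r = inner ℝ (areaHess p r) q := by
  rw [inner_areaHess, inner_areaHess, real_inner_comm q r]; ring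

lemma inner_areaHess_self_eq (p q : 𝔼 n) : inner ℝ (areaHess p q) q
    = (areaElt p)⁻¹ * ‖q‖ ^ 2 - (areaElt p)⁻¹ ^ 3 * (inner ℝ p q) ^ 2 := by
  rw [inner_areaHess, real_inner_self_eq_norm_sq]; ring

lemma inner_sq_le (p q : 𝔼 n) : (inner ℝ p q) ^ 2 ≤ ‖p‖ ^ 2 * ‖q‖ ^ 2 := by
  rw [← mul_pow]; exact sq_le_sq' (neg_le_of_abs_le (abs_real_inner_le_norm p q))
    (le_of_abs_le (abs_real_inner_le_norm p q))

/-- The eigenvalues of the Hessian are w^(-3) along `p` and w^(-1) across it, so the ellipticity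
degenerates like w^(-3). -/
lemma inner_areaHess_self_ge (p q : 𝔼 n) :
    (areaElt p)⁻¹ ^ 3 * ‖q‖ ^ 2 ≤ inner ℝ (areaHess p q) q := by
  rw [inner_areaHess_self_eq]
  have h1 := mul_le_mul_of_nonneg_left (inner_sq_le p q) (pow_pos (areaElt_inv_pos p) 3).le
  have h2 := areaElt_inv_sq_mul p
  have : (areaElt p)⁻¹ ^ 3 * (‖p‖ ^ 2 * ‖q‖ ^ 2)
      = (areaElt p)⁻¹ * (1 - (areaElt p)⁻¹ ^ 2) * ‖q‖ ^ 2 := by rw [← h2]; ring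
  rw [this] at h1
  linarith

lemma inner_areaHess_self_nonneg (p q : 𝔼 n) : 0 ≤ inner ℝ (areaHess p q) q :=
  (mul_nonneg (pow_pos (areaElt_inv_pos p) 3).le (sq_nonneg _)).trans (inner_areaHess_self_ge p q)

lemma inner_areaHess_self_le (p q : 𝔼 n) :
    inner ℝ (areaHess p q) q ≤ (areaElt p)⁻¹ * ‖q‖ ^ 2 := by
  rw [inner_areaHess_self_eq]
  have := mul_nonneg (pow_pos (areaElt_inv_pos p) 3).le (sq_nonneg (inner ℝ p q))
  linarith

/-- The Hessian A is symmetric with eigenvalues in (0,1], so A² ≤ A. This turns integrability of the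
energy into square integrability of the differentiated flux. -/
lemma norm_areaHess_sq_le (p q : 𝔼 n) : ‖areaHess p q‖ ^ 2 ≤ inner ℝ (areaHess p q) q := by
  have e : ‖areaHess p q‖ ^ 2 = (areaElt p)⁻¹ ^ 2 * ‖q‖ ^ 2
      - 2 * ((areaElt p)⁻¹ ^ 4 * (inner ℝ p q) ^ 2)
      + (areaElt p)⁻¹ ^ 4 * ((areaElt p)⁻¹ ^ 2 * ‖p‖ ^ 2) * (inner ℝ p q) ^ 2 := by
    rw [areaHess_apply, norm_sub_sq_real, norm_smul, norm_smul, real_inner_smul_left,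
      real_inner_smul_right, real_inner_comm p q, mul_pow, mul_pow, Real.norm_eq_abs,
      Real.norm_eq_abs, sq_abs, sq_abs]
    ring
  rw [e, inner_areaHess_self_eq, areaElt_inv_sq_mul]
  have h1 := inner_sq_le p q
  have h2 := areaElt_inv_sq_mul p
  have hi := areaElt_inv_pos p
  have hi1 := areaElt_inv_le_one p
  set i := (areaElt p)⁻¹
  set s := (inner ℝ p q) ^ 2
  have hs : 0 ≤ s := sq_nonneg _
  have h3 : i ^ 2 * s ≤ ‖q‖ ^ 2 := by
    have : i ^ 2 * s ≤ i ^ 2 * (‖p‖ ^ 2 * ‖q‖ ^ 2) := mul_le_mul_of_nonneg_left h1 (by positivity)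
    nlinarith [sq_nonneg ‖q‖, mul_nonneg (sq_nonneg i) (sq_nonneg ‖q‖)]
  have h4 : 0 ≤ i * (1 - i) * (‖q‖ ^ 2 - i ^ 2 * s) :=
    mul_nonneg (mul_nonneg hi.le (by linarith)) (by linarith)
  have h5 : 0 ≤ i ^ 6 * s := by positivity
  nlinarith

lemma norm_areaHess_le (p q : 𝔼 n) : ‖areaHess p q‖ ≤ ‖q‖ := by
  refine le_of_sq_le_sq ?_ (norm_nonneg _)
  calc ‖areaHess p q‖ ^ 2 ≤ (areaElt p)⁻¹ * ‖q‖ ^ 2 :=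
        (norm_areaHess_sq_le p q).trans (inner_areaHess_self_le p q)
    _ ≤ 1 * ‖q‖ ^ 2 := mul_le_mul_of_nonneg_right (areaElt_inv_le_one p) (sq_nonneg _)
    _ = ‖q‖ ^ 2 := one_mul _

lemma continuous_areaHess : Continuous fun z : (𝔼 n) × (𝔼 n) => areaHess z.1 z.2 := by
  simp only [← fderiv_flux]
  exact continuous_fderiv_uncurry (contDiff_flux.of_le (by simp))

/-- The smooth field `(1 + τ |p|²)^{-m} p`. -/
noncomputable def damp (τ : ℝ) (m : ℕ) (p : 𝔼 n) : 𝔼 n := ((1 + τ * ‖p‖ ^ 2) ^ m)⁻¹ • p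

lemma one_le_dampDen {τ : ℝ} (hτ : 0 ≤ τ) (p : 𝔼 n) : 1 ≤ 1 + τ * ‖p‖ ^ 2 :=
  le_add_of_nonneg_right (by positivity)

lemma contDiff_damp {τ : ℝ} (hτ : 0 ≤ τ) (m : ℕ) : ContDiff ℝ ∞ (damp τ m : (𝔼 n) → 𝔼 n) := by
  refine ContDiff.smul (f := fun p : 𝔼 n => ((1 + τ * ‖p‖ ^ 2) ^ m)⁻¹) (g := id)
    (ContDiff.inv (𝕜 := ℝ) ?_ fun p => ?_) contDiff_id
  · exact (contDiff_const.add (contDiff_const.mul (contDiff_norm_sq ℝ))).pow m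
  · have := one_le_dampDen hτ p; positivity

lemma fderiv_damp_apply {τ : ℝ} (hτ : 0 ≤ τ) (m : ℕ) (p q : 𝔼 n) :
    fderiv ℝ (damp τ m) p q = ((1 + τ * ‖p‖ ^ 2) ^ m)⁻¹ • q
      - (2 * m * τ * ((1 + τ * ‖p‖ ^ 2) ^ (m + 1))⁻¹ * inner ℝ p q) • p := by
  have hσ := one_le_dampDen hτ p
  have h0 : (1 + τ * ‖p‖ ^ 2) ≠ 0 := by positivity
  have h1 : HasFDerivAt (fun p : 𝔼 n => 1 + τ * ‖p‖ ^ 2) (τ • (2 • innerSL ℝ p)) p :=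
    ((hasStrictFDerivAt_norm_sq p).hasFDerivAt.const_mul τ).const_add 1
  have h2 := (HasDerivAt.inv (c := fun y : ℝ => y ^ m) (hasDerivAt_pow m (1 + τ * ‖p‖ ^ 2))
    (pow_ne_zero m h0)).comp_hasFDerivAt p h1
  have h3 : HasFDerivAt (damp τ m) _ p := h2.smul (hasFDerivAt_id p)
  rw [h3.fderiv]
  simp only [add_apply, smul_apply, nsmul_eq_mul,
    ContinuousLinearMap.smulRight_apply, innerSL_apply_apply, Pi.inv_apply, Function.comp_apply,
    ContinuousLinearMap.id_apply, smul_eq_mul]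
  rw [sub_eq_add_neg, ← neg_smul]
  congr 2
  rcases m with _ | m
  · simp
  · simp only [Nat.add_sub_cancel]
    push_cast
    field_simp
    ring

/-- The bound does not depend on τ; this uniformity is what lets the damping be removed in the
energy estimate. -/
lemma norm_fderiv_damp_le {τ : ℝ} (hτ : 0 ≤ τ) (m : ℕ) (p : 𝔼 n) :
    ‖fderiv ℝ (damp τ m) p‖ ≤ 1 + 2 * m := by
  refine opNorm_le_bound _ (by positivity) fun q => ?_
  rw [fderiv_damp_apply hτ]
  have hσ := one_le_dampDen hτ p
  have hpm : ((1 + τ * ‖p‖ ^ 2) ^ m)⁻¹ ≤ 1 := inv_le_one_of_one_le₀ (one_le_pow₀ hσ)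
  have hpm0 : 0 ≤ ((1 + τ * ‖p‖ ^ 2) ^ m)⁻¹ := by positivity
  have h2 : ‖((1 + τ * ‖p‖ ^ 2) ^ m)⁻¹ • q‖ ≤ 1 * ‖q‖ := by
    rw [norm_smul, Real.norm_of_nonneg hpm0]
    exact mul_le_mul_of_nonneg_right hpm (norm_nonneg _)
  have h3 : ‖(2 * m * τ * ((1 + τ * ‖p‖ ^ 2) ^ (m + 1))⁻¹ * inner ℝ p q) • p‖
      ≤ 2 * m * ‖q‖ := by
    have h4 : τ * ‖p‖ ^ 2 * (1 + τ * ‖p‖ ^ 2)⁻¹ ≤ 1 := by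
      rw [← div_eq_mul_inv, div_le_one (by positivity)]; linarith
    rw [norm_smul, norm_mul, Real.norm_of_nonneg (by positivity)]
    calc 2 * m * τ * ((1 + τ * ‖p‖ ^ 2) ^ (m + 1))⁻¹ * ‖inner ℝ p q‖ * ‖p‖
        ≤ 2 * m * τ * ((1 + τ * ‖p‖ ^ 2) ^ (m + 1))⁻¹ * (‖p‖ * ‖q‖) * ‖p‖ := by
          gcongr; exact norm_inner_le_norm p q
      _ = 2 * m * ((1 + τ * ‖p‖ ^ 2) ^ m)⁻¹ * (τ * ‖p‖ ^ 2 * (1 + τ * ‖p‖ ^ 2)⁻¹) * ‖q‖ := by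
          rw [pow_succ, mul_inv]; ring
      _ ≤ 2 * m * 1 * 1 * ‖q‖ := by gcongr
      _ = 2 * m * ‖q‖ := by ring
  calc _ ≤ 1 * ‖q‖ + 2 * m * ‖q‖ := (norm_sub_le _ _).trans (add_le_add h2 h3)
    _ = (1 + 2 * m) * ‖q‖ := by ring

lemma norm_mul_dampDen_inv_le {τ : ℝ} (hτ : 0 < τ) (p : 𝔼 n) :
    ‖p‖ * (1 + τ * ‖p‖ ^ 2)⁻¹ ≤ 1 + τ⁻¹ := by
  rw [← div_eq_mul_inv, div_le_iff₀ (by positivity)]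
  have : τ⁻¹ * (1 + τ * ‖p‖ ^ 2) = τ⁻¹ + ‖p‖ ^ 2 := by field_simp
  rw [add_mul, this]
  have := inv_pos.2 hτ
  nlinarith [sq_nonneg (‖p‖ - 1), mul_nonneg hτ.le (sq_nonneg ‖p‖)]

lemma norm_damp_le {τ : ℝ} (hτ : 0 < τ) {m : ℕ} (hm : 1 ≤ m) (p : 𝔼 n) :
    ‖damp τ m p‖ ≤ 1 + τ⁻¹ := by
  have hσ := one_le_dampDen hτ.le p
  rw [damp, norm_smul, Real.norm_of_nonneg (by positivity), mul_comm]
  refine le_trans ?_ (norm_mul_dampDen_inv_le hτ p)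
  gcongr
  exact le_self_pow₀ hσ (by omega)

lemma hasFDerivAt_damp {τ : ℝ} (hτ : 0 ≤ τ) (m : ℕ) (p : 𝔼 n) :
    HasFDerivAt (damp τ m) (fderiv ℝ (damp τ m) p) p :=
  ((contDiff_damp hτ m).differentiable (by simp) p).hasFDerivAt

/-- The truncated pairing used for the second-order energy estimate. -/
noncomputable def fluxPair (τ : ℝ) (z : (𝔼 n) × (𝔼 n)) : ℝ := inner ℝ (flux z.1) (damp τ 1 z.2)

lemma contDiff_fluxPair {τ : ℝ} (hτ : 0 ≤ τ) :
    ContDiff ℝ 1 (fluxPair τ : (𝔼 n) × (𝔼 n) → ℝ) :=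
  (ContDiff.inner ℝ ((contDiff_flux.of_le (by simp)).comp contDiff_fst)
    (((contDiff_damp hτ 1).of_le (by simp)).comp contDiff_snd))

lemma fderiv_fluxPair {τ : ℝ} (hτ : 0 ≤ τ) (z z' : (𝔼 n) × (𝔼 n)) :
    fderiv ℝ (fluxPair τ) z z' = inner ℝ (areaHess z.1 z'.1) (damp τ 1 z.2)
      + inner ℝ (flux z.1) (fderiv ℝ (damp τ 1) z.2 z'.2) := by
  have h1 : HasFDerivAt (fun z : (𝔼 n) × (𝔼 n) => flux z.1) _ z :=
    (hasFDerivAt_flux z.1).comp z hasFDerivAt_fst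
  have h2 : HasFDerivAt (fun z : (𝔼 n) × (𝔼 n) => damp τ 1 z.2) _ z :=
    (hasFDerivAt_damp hτ 1 z.2).comp z hasFDerivAt_snd
  have h3 := (h1.inner ℝ h2).fderiv
  have h4 : (fluxPair τ : (𝔼 n) × (𝔼 n) → ℝ)
    = fun z => inner ℝ (flux z.1) (damp τ 1 z.2) := rfl
  rw [h4, h3]
  simp [fderivInnerCLM_apply, add_comm]

/-- The bound blows up as τ → 0, but it serves only to license the chain rule for fixed τ. -/
lemma norm_fderiv_fluxPair_le {τ : ℝ} (hτ : 0 < τ) (z : (𝔼 n) × (𝔼 n)) :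
    ‖fderiv ℝ (fluxPair τ) z‖ ≤ (1 + τ⁻¹) + 3 := by
  have hτ' := inv_pos.2 hτ
  refine opNorm_le_bound _ (by positivity) fun z' => ?_
  rw [fderiv_fluxPair hτ.le]
  have h1 : ‖inner ℝ (areaHess z.1 z'.1) (damp τ 1 z.2)‖ ≤ ‖z'‖ * (1 + τ⁻¹) :=
    (norm_inner_le_norm _ _).trans (mul_le_mul ((norm_areaHess_le _ _).trans (norm_fst_le z'))
      (norm_damp_le hτ le_rfl _) (norm_nonneg _) (norm_nonneg _))
  have h2 : ‖inner ℝ (flux z.1) (fderiv ℝ (damp τ 1) z.2 z'.2)‖ ≤ 1 * (3 * ‖z'‖) := by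
    refine (norm_inner_le_norm _ _).trans (mul_le_mul (norm_flux_le _) ?_ (norm_nonneg _)
      zero_le_one)
    have h3 := norm_fderiv_damp_le hτ.le 1 z.2
    refine (le_opNorm _ _).trans (mul_le_mul (h3.trans (by norm_num)) (norm_snd_le z')
      (norm_nonneg _) (by norm_num))
  exact (norm_add_le _ _).trans (by linarith)

/-- The truncated nonlinearity times the damped field. -/
noncomputable def scalarDamp (F : ℝ → ℝ) (τ : ℝ) (m : ℕ) (z : ℝ × (𝔼 n)) : 𝔼 n :=
  F z.1 • damp τ m z.2

lemma contDiff_scalarDamp {F : ℝ → ℝ} (hF : ContDiff ℝ 1 F) {τ : ℝ} (hτ : 0 ≤ τ) (m : ℕ) :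
    ContDiff ℝ 1 (scalarDamp F τ m : ℝ × (𝔼 n) → 𝔼 n) :=
  (hF.comp contDiff_fst).smul (((contDiff_damp hτ m).of_le (by simp)).comp contDiff_snd)

lemma fderiv_scalarDamp {F : ℝ → ℝ} (hF : ContDiff ℝ 1 F) {τ : ℝ} (hτ : 0 ≤ τ) (m : ℕ)
    (z z' : ℝ × (𝔼 n)) :
    fderiv ℝ (scalarDamp F τ m) z z' = F z.1 • fderiv ℝ (damp τ m) z.2 z'.2
      + (deriv F z.1 * z'.1) • damp τ m z.2 := by
  have h0 : HasFDerivAt (Prod.fst : ℝ × (𝔼 n) → ℝ) (ContinuousLinearMap.fst ℝ ℝ (𝔼 n)) z :=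
    hasFDerivAt_fst
  have h1 := ((hF.differentiable one_ne_zero z.1).hasDerivAt).comp_hasFDerivAt z h0
  have h2 : HasFDerivAt (fun z : ℝ × (𝔼 n) => damp τ m z.2) _ z :=
    (hasFDerivAt_damp hτ m z.2).comp z hasFDerivAt_snd
  have h3 : HasFDerivAt (scalarDamp F τ m) _ z := h1.smul h2
  rw [h3.fderiv]
  simp

lemma norm_fderiv_scalarDamp_le {F : ℝ → ℝ} (hF : ContDiff ℝ 1 F) {B B' : ℝ}
    (hB : ∀ s, ‖F s‖ ≤ B) (hB' : ∀ s, ‖deriv F s‖ ≤ B') {τ : ℝ} (hτ : 0 < τ) {m : ℕ} (hm : 1 ≤ m)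
    (z : ℝ × (𝔼 n)) :
    ‖fderiv ℝ (scalarDamp F τ m) z‖ ≤ B * (1 + 2 * m) + B' * (1 + τ⁻¹) := by
  have hτ' := inv_pos.2 hτ
  have hB0 : 0 ≤ B := (norm_nonneg _).trans (hB 0)
  have hB0' : 0 ≤ B' := (norm_nonneg _).trans (hB' 0)
  refine opNorm_le_bound _ (by positivity) fun z' => ?_
  rw [fderiv_scalarDamp hF hτ.le]
  refine (norm_add_le _ _).trans ?_
  rw [norm_smul, norm_smul, norm_mul, add_mul]
  refine add_le_add ?_ ?_
  · rw [mul_assoc]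
    refine mul_le_mul (hB _) ((le_opNorm _ _).trans (mul_le_mul (norm_fderiv_damp_le hτ.le m _)
      (norm_snd_le z') (norm_nonneg _) (by positivity))) (norm_nonneg _) hB0
  · calc ‖deriv F z.1‖ * ‖z'.1‖ * ‖damp τ m z.2‖ ≤ B' * ‖z'‖ * (1 + τ⁻¹) := by
          gcongr
          · exact hB' _
          · exact norm_fst_le z'
          · exact norm_damp_le hτ hm _
      _ = B' * (1 + τ⁻¹) * ‖z'‖ := by ring

/-- The function `w - 1/w` of the area element `w`. -/
noncomputable def areaGap (p : 𝔼 n) : ℝ := areaElt p - (areaElt p)⁻¹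

lemma contDiff_areaGap : ContDiff ℝ ∞ (areaGap : (𝔼 n) → ℝ) :=
  contDiff_areaElt.sub contDiff_areaElt_inv

lemma fderiv_areaGap (p q : 𝔼 n) :
    fderiv ℝ areaGap p q = ((areaElt p)⁻¹ + (areaElt p)⁻¹ ^ 3) * inner ℝ p q := by
  have h := ((hasFDerivAt_areaElt p).sub (hasFDerivAt_areaElt_inv p)).fderiv
  have h4 : (areaGap : (𝔼 n) → ℝ) = areaElt - fun p => (areaElt p)⁻¹ := rfl
  rw [h4, h]
  simp [add_mul]

lemma norm_fderiv_areaGap_le (p : 𝔼 n) : ‖fderiv ℝ areaGap p‖ ≤ 2 := by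
  refine opNorm_le_bound _ (by norm_num) fun q => ?_
  have hi := areaElt_inv_pos p
  have hi1 := areaElt_inv_le_one p
  have h2 : (areaElt p)⁻¹ * ‖p‖ ≤ 1 := by
    rw [inv_mul_le_iff₀ (areaElt_pos p), mul_one]; exact norm_le_areaElt p
  rw [fderiv_areaGap, norm_mul, Real.norm_of_nonneg (by positivity)]
  calc ((areaElt p)⁻¹ + (areaElt p)⁻¹ ^ 3) * ‖inner ℝ p q‖
      ≤ ((areaElt p)⁻¹ + (areaElt p)⁻¹ ^ 3) * (‖p‖ * ‖q‖) := by
        gcongr; exact norm_inner_le_norm p q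
    _ = (1 + (areaElt p)⁻¹ ^ 2) * ((areaElt p)⁻¹ * ‖p‖) * ‖q‖ := by ring
    _ ≤ (1 + 1 ^ 2) * 1 * ‖q‖ := by gcongr
    _ = 2 * ‖q‖ := by ring

end AreaIntegrand

end MeanCurvature

open Filter Set Metric ContinuousLinearMap
open scoped Topology ContDiff Convolution Manifold

namespace MeanCurvature

local notation "𝔼" n => EuclideanSpace ℝ (Fin n)

/-! ### Stable solutions: second-order estimates and the linearized equation -/

section StableSystem

variable {n : ℕ}

lemma exists_cutoff {Ω : Opens (𝔼 n)} {K : Set (𝔼 n)} (hK : IsCompact K) (hKΩ : K ⊆ Ω) :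
    ∃ ζ : (𝔼 n) → ℝ, ContDiff ℝ ∞ ζ ∧ HasCompactSupport ζ ∧ tsupport ζ ⊆ Ω ∧
      (∀ x, 0 ≤ ζ x) ∧ ∀ x ∈ K, ζ x = 1 := by
  obtain ⟨δ, hδ, hδΩ⟩ := hK.exists_cthickening_subset_open Ω.isOpen hKΩ
  obtain ⟨ζ, h1, h2, h3, h4⟩ := exists_contMDiff_support_eq_eq_one_iff 𝓘(ℝ, 𝔼 n)
    (isOpen_thickening (δ := δ) (E := K)) hK.isClosed (self_subset_thickening hδ K)
  have hts : tsupport ζ ⊆ cthickening δ K := by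
    rw [tsupport, h3]; exact closure_thickening_subset_cthickening δ K
  exact ⟨ζ, h1.contDiff, hK.cthickening.of_isClosed_subset (isClosed_tsupport _) hts,
    hts.trans hδΩ, fun x => (h2 (mem_range_self x)).1, fun x hx => (h4 x).1 hx⟩

/-- The weak formulation of a stable solution `u` with weak gradient `G`, where `H i = ∂ᵢ G` and
`L i = ∂ᵢ ∂ᵢ G` in the weak sense. -/
structure StableSystem (Ω : Opens (𝔼 n)) (f : ℝ → ℝ) (u : (𝔼 n) → ℝ) (G : (𝔼 n) → 𝔼 n)
    (H L : Fin n → (𝔼 n) → 𝔼 n) : Prop where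
  contDiff_f : ContDiff ℝ 1 f
  meas_u : AEStronglyMeasurable u volume
  meas_G : AEStronglyMeasurable G volume
  meas_H : ∀ i, AEStronglyMeasurable (H i) volume
  weak_u : ∀ i, HasWeakDeriv Ω (bv i) u fun x => G x i
  weak_G : ∀ i, HasWeakDeriv Ω (bv i) G (H i)
  weak_H : ∀ i, HasWeakDeriv Ω (bv i) (H i) (L i)
  symm : ∀ i j, ∀ᵐ x, H i x j = H j x i
  locInt_f : LocallyIntegrableOn (fun x => f (u x)) Ω volume
  locInt_deriv : LocallyIntegrableOn (fun x => deriv f (u x)) Ω volume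
  weak_eq : ∀ φ : (𝔼 n) → ℝ, ContDiff ℝ ∞ φ → HasCompactSupport φ → tsupport φ ⊆ Ω →
    ∫ x, inner ℝ (flux (G x)) (∇ φ x) = ∫ x, f (u x) * φ x
  stable : ∀ φ : (𝔼 n) → ℝ, ContDiff ℝ ∞ φ → HasCompactSupport φ → tsupport φ ⊆ Ω →
    ∫ x, deriv f (u x) * φ x ^ 2 ≤ ∫ x, inner ℝ (areaHess (G x) (∇ φ x)) (∇ φ x)

namespace StableSystem

variable {Ω : Opens (𝔼 n)} {f : ℝ → ℝ} {u : (𝔼 n) → ℝ} {G : (𝔼 n) → 𝔼 n}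
  {H L : Fin n → (𝔼 n) → 𝔼 n}

lemma weak_flux (S : StableSystem Ω f u G H L) (i : Fin n) :
    HasWeakDeriv Ω (bv i) (fun x => flux (G x)) fun x => areaHess (G x) (H i x) := by
  have := (S.weak_G i).comp (Ψ := flux) (contDiff_flux.of_le (by simp)) (C := 1) fun z => by
    rw [fderiv_flux]
    exact opNorm_le_bound _ zero_le_one fun q => by
      rw [one_mul]; exact norm_areaHess_le z q
  simpa only [fderiv_flux] using this

lemma meas_areaHess (S : StableSystem Ω f u G H L) {X : (𝔼 n) → 𝔼 n}
    (hX : AEStronglyMeasurable X volume) :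
    AEStronglyMeasurable (fun x => areaHess (G x) (X x)) volume := by
  have h := S.meas_G.prodMk hX
  have h' := continuous_areaHess.comp_aestronglyMeasurable h
  exact h'

lemma meas_energy (S : StableSystem Ω f u G H L) (j : Fin n) :
    AEStronglyMeasurable (fun x => inner ℝ (areaHess (G x) (H j x)) (H j x)) volume :=
  (S.meas_areaHess (S.meas_H j)).inner (S.meas_H j)

/-- The second-order energy density is locally integrable. -/
lemma locInt_energy (S : StableSystem Ω f u G H L) (j : Fin n) :
    LocallyIntegrableOn (fun x => inner ℝ (areaHess (G x) (H j x)) (H j x)) Ω volume := by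
  rw [locallyIntegrableOn_opens_iff]
  intro K hKΩ hK
  obtain ⟨ζ, hζ, hζc, hζΩ, hζ0, hζ1⟩ := exists_cutoff hK hKΩ
  set a : (𝔼 n) → ℝ := fun x => inner ℝ (areaHess (G x) (H j x)) (H j x) with ha
  have ha0 : ∀ x, 0 ≤ a x := fun x => inner_areaHess_self_nonneg _ _
  set dζ : (𝔼 n) → ℝ := fun x => fderiv ℝ ζ x (bv j) with hdζ
  have hdζs := contDiff_fderiv_apply_const hζ (bv j)
  have hdζc := hasCompactSupport_fderiv_apply hζc (bv j)
  have hdζΩ := (tsupport_fderiv_apply_subset' (φ := ζ) (bv j)).trans hζΩ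
  have iH : Integrable fun x => ‖dζ x • H j x‖ :=
    (integrable_smul_of_tsupport_subset (S.weak_H j).locInt hdζs.continuous hdζc hdζΩ).norm
  have iL : Integrable fun x => ‖ζ x • L j x‖ :=
    (integrable_smul_of_tsupport_subset (S.weak_H j).locInt_deriv hζ.continuous hζc hζΩ).norm
  have iH' : Integrable fun x => ‖ζ x • H j x‖ :=
    (integrable_smul_of_tsupport_subset (S.weak_H j).locInt hζ.continuous hζc hζΩ).norm
  -- A bound free of τ: |flux| ≤ 1 and |damp q| ≤ |q| control the term with the derivative of ζ, and
  -- the factor 3 = 1 + 2·1 bounds the derivative of the damping, which falls on the third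
  -- derivatives of u.
  set C₀ := (∫ x, ‖dζ x • H j x‖) + 3 * ∫ x, ‖ζ x • L j x‖ with hC₀
  set den : ℝ → (𝔼 n) → ℝ := fun τ x => (1 + τ * ‖H j x‖ ^ 2)⁻¹ with hden
  have hdamp : ∀ τ (q : 𝔼 n), damp τ 1 q = (1 + τ * ‖q‖ ^ 2)⁻¹ • q := fun τ q => by
    rw [damp, pow_one]
  have hbound : ∀ τ > 0, Integrable (fun x => ζ x * (den τ x * a x)) ∧
      ∫ x, ζ x * (den τ x * a x) ≤ C₀ := by
    intro τ hτ
    -- Differentiating flux(G)·damp(∂ⱼG) in direction j produces the damped energy from the first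
    -- factor and a term linear in the third derivatives from the second.
    have hw := ((S.weak_G j).prodMk (S.weak_H j)).comp (contDiff_fluxPair hτ.le)
      (norm_fderiv_fluxPair_le hτ)
    have hid := hw.integral_eq ζ hζ hζc hζΩ
    have hi1 := integrable_smul_of_tsupport_subset hw.locInt_deriv hζ.continuous hζc hζΩ
    simp only [fderiv_fluxPair hτ.le, smul_eq_mul] at hid hi1
    have e1 : ∀ x, inner ℝ (areaHess (G x) (H j x)) (damp τ 1 (H j x)) = den τ x * a x := by
      intro x
      rw [hdamp, real_inner_smul_right]
    simp only [e1] at hid hi1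
    have hmd : AEStronglyMeasurable (fun x => den τ x * a x) volume := by
      have : AEStronglyMeasurable
          (fun x => inner ℝ (areaHess (G x) (H j x)) (damp τ 1 (H j x))) volume :=
        (S.meas_areaHess (S.meas_H j)).inner
          ((contDiff_damp hτ.le 1).continuous.comp_aestronglyMeasurable (S.meas_H j))
      simpa only [e1] using this
    have hi2 : Integrable fun x => ζ x * (den τ x * a x) := by
      refine Integrable.mono' (iH'.const_mul (1 + τ⁻¹))
        (hζ.continuous.aestronglyMeasurable.mul hmd) (Eventually.of_forall fun x => ?_)
      rw [norm_mul, norm_smul, ← e1, mul_left_comm]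
      refine mul_le_mul_of_nonneg_left ?_ (norm_nonneg _)
      rw [mul_comm]
      exact (norm_inner_le_norm _ _).trans (mul_le_mul (norm_areaHess_le _ _)
        (norm_damp_le hτ le_rfl _) (norm_nonneg _) (norm_nonneg _))
    have hi3 : Integrable fun x =>
        ζ x * inner ℝ (flux (G x)) (fderiv ℝ (damp τ 1) (H j x) (L j x)) := by
      refine (hi1.sub hi2).congr (Eventually.of_forall fun x => ?_)
      simp only [Pi.sub_apply]; ring
    refine ⟨hi2, ?_⟩
    simp only [mul_add] at hid
    rw [integral_add hi2 hi3] at hid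
    have b1 : |∫ x, fderiv ℝ ζ x (bv j) * fluxPair τ (G x, H j x)| ≤ ∫ x, ‖dζ x • H j x‖ := by
      rw [← Real.norm_eq_abs]
      refine norm_integral_le_of_norm_le iH (Eventually.of_forall fun x => ?_)
      rw [norm_mul, norm_smul]
      refine mul_le_mul_of_nonneg_left ?_ (norm_nonneg _)
      refine (norm_inner_le_norm _ _).trans ?_
      have hd : ‖damp τ 1 (H j x)‖ ≤ ‖H j x‖ := by
        rw [hdamp, norm_smul, Real.norm_of_nonneg (by positivity)]
        exact mul_le_of_le_one_left (norm_nonneg _)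
          (inv_le_one_of_one_le₀ (one_le_dampDen hτ.le _))
      calc ‖flux (G x)‖ * ‖damp τ 1 (H j x)‖ ≤ 1 * ‖H j x‖ :=
            mul_le_mul (norm_flux_le _) hd (norm_nonneg _) zero_le_one
        _ = ‖H j x‖ := one_mul _
    have b2 : |∫ x, ζ x * inner ℝ (flux (G x)) (fderiv ℝ (damp τ 1) (H j x) (L j x))|
        ≤ 3 * ∫ x, ‖ζ x • L j x‖ := by
      rw [← Real.norm_eq_abs, ← integral_const_mul]
      refine norm_integral_le_of_norm_le (iL.const_mul 3) (Eventually.of_forall fun x => ?_)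
      rw [norm_mul, norm_smul, mul_left_comm]
      refine mul_le_mul_of_nonneg_left ?_ (norm_nonneg _)
      refine (norm_inner_le_norm _ _).trans ?_
      have h3 : ‖fderiv ℝ (damp τ 1) (H j x) (L j x)‖ ≤ 3 * ‖L j x‖ :=
        (le_opNorm _ _).trans (mul_le_mul_of_nonneg_right
          ((norm_fderiv_damp_le hτ.le 1 _).trans (by norm_num)) (norm_nonneg _))
      calc ‖flux (G x)‖ * ‖fderiv ℝ (damp τ 1) (H j x) (L j x)‖ ≤ 1 * (3 * ‖L j x‖) :=
            mul_le_mul (norm_flux_le _) h3 (norm_nonneg _) zero_le_one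
        _ = 3 * ‖L j x‖ := one_mul _
    have := neg_le_of_abs_le b1
    have := neg_le_of_abs_le b2
    have := le_of_abs_le b1
    have := le_of_abs_le b2
    linarith
  -- Fatou's lemma along τ = 1/(k+1); the energy is nonnegative.
  have hfat : ∫⁻ x, ENNReal.ofReal (ζ x * a x) ≤ ENNReal.ofReal C₀ := by
    set τ : ℕ → ℝ := fun k => 1 / ((k : ℝ) + 1) with hτ
    have hτ0 : ∀ k, 0 < τ k := fun k => by positivity
    have hτt : Tendsto τ atTop (𝓝 0) := tendsto_one_div_add_atTop_nhds_zero_nat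
    have hpt : ∀ x, Tendsto (fun k => ENNReal.ofReal (ζ x * (den (τ k) x * a x))) atTop
        (𝓝 (ENNReal.ofReal (ζ x * a x))) := by
      intro x
      refine ENNReal.tendsto_ofReal (Tendsto.const_mul _ ?_)
      have : Tendsto (fun k => (1 + τ k * ‖H j x‖ ^ 2)⁻¹) atTop
          (𝓝 (1 + 0 * ‖H j x‖ ^ 2)⁻¹) :=
        ((hτt.mul_const _).const_add 1).inv₀ (by simp)
      simpa using this.mul_const (a x)
    calc ∫⁻ x, ENNReal.ofReal (ζ x * a x)
        = ∫⁻ x, liminf (fun k => ENNReal.ofReal (ζ x * (den (τ k) x * a x))) atTop :=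
          lintegral_congr fun x => (hpt x).liminf_eq.symm
      _ ≤ liminf (fun k => ∫⁻ x, ENNReal.ofReal (ζ x * (den (τ k) x * a x))) atTop :=
          lintegral_liminf_le' fun k => (hbound (τ k) (hτ0 k)).1.aestronglyMeasurable.aemeasurable.ennreal_ofReal
      _ ≤ ENNReal.ofReal C₀ := by
          refine liminf_le_of_le (by isBoundedDefault) fun b hb => ?_
          obtain ⟨k, hk⟩ := hb.exists
          refine hk.trans ?_
          rw [← ofReal_integral_eq_lintegral_ofReal (hbound _ (hτ0 k)).1
            (Eventually.of_forall fun x => mul_nonneg (hζ0 x)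
              (mul_nonneg (by rw [hden]; have := hτ0 k; positivity) (ha0 x)))]
          exact ENNReal.ofReal_le_ofReal (hbound _ (hτ0 k)).2
  have hint : Integrable fun x => ζ x * a x := by
    refine ⟨hζ.continuous.aestronglyMeasurable.mul (S.meas_energy j), ?_⟩
    rw [hasFiniteIntegral_iff_ofReal (Eventually.of_forall fun x => mul_nonneg (hζ0 x) (ha0 x))]
    exact hfat.trans_lt ENNReal.ofReal_lt_top
  exact (hint.integrableOn (s := K)).congr_fun (fun x hx => by simp [hζ1 x hx]) hK.measurableSet

lemma memLp_areaHess (S : StableSystem Ω f u G H L) (j : Fin n) {K : Set (𝔼 n)} (hKΩ : K ⊆ Ω)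
    (hK : IsCompact K) : MemLp (fun x => areaHess (G x) (H j x)) 2 (volume.restrict K) := by
  have hm := (S.meas_areaHess (S.meas_H j)).restrict (s := K)
  rw [memLp_two_iff_integrable_sq_norm hm]
  refine Integrable.mono' (locallyIntegrableOn_opens_iff.1 (S.locInt_energy j) K hKΩ hK)
    (hm.norm.pow 2) (Eventually.of_forall fun x => ?_)
  rw [Real.norm_of_nonneg (by positivity)]
  exact norm_areaHess_sq_le _ _

lemma inner_eq_sum (z z' : 𝔼 n) : inner ℝ z z' = ∑ i, z i * z' i := by
  rw [PiLp.inner_apply]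
  exact Finset.sum_congr rfl fun i _ => by simp [mul_comm]

/-- The equation holds pointwise almost everywhere. -/
lemma ae_eq (S : StableSystem Ω f u G H L) :
    ∀ᵐ x, x ∈ Ω → f (u x) = -∑ i, areaHess (G x) (H i x) i := by
  have hloc : LocallyIntegrableOn (fun x => ∑ i, areaHess (G x) (H i x) i) Ω volume := by
    rw [locallyIntegrableOn_opens_iff]
    intro K h1 h2
    exact integrable_finsetSum _ fun i _ =>
      locallyIntegrableOn_opens_iff.1 ((S.weak_flux i).apply i).locInt_deriv K h1 h2
  have hloc2 : LocallyIntegrableOn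
      (fun x => f (u x) + ∑ i, areaHess (G x) (H i x) i) Ω volume := S.locInt_f.add hloc
  -- The flux is weakly differentiable, so the weak equation can be integrated by parts and the
  -- fundamental lemma of the calculus of variations applies.
  have := Ω.isOpen.ae_eq_zero_of_integral_contDiff_smul_eq_zero hloc2 ?_
  · filter_upwards [this] with x hx hxΩ
    linarith [hx hxΩ]
  · intro φ hφ hc hs
    have i1 := integrable_smul_of_tsupport_subset S.locInt_f hφ.continuous hc hs
    have i2 := integrable_smul_of_tsupport_subset hloc hφ.continuous hc hs
    simp only [smul_add]
    rw [integral_add i1 i2]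
    simp only [smul_eq_mul, Finset.mul_sum]
    have e1 := S.weak_eq φ hφ hc hs
    simp only [inner_eq_sum, gradient_apply] at e1
    have e2 : ∀ i, ∫ x, flux (G x) i * fderiv ℝ φ x (bv i)
        = -∫ x, φ x * areaHess (G x) (H i x) i := by
      intro i
      have := ((S.weak_flux i).apply i).integral_eq φ hφ hc hs
      simpa only [smul_eq_mul, mul_comm] using this
    rw [integral_finsetSum] at e1 ⊢
    · simp only [e2] at e1
      rw [Finset.sum_neg_distrib] at e1
      simp only [mul_comm (φ _) (f _)]
      rw [← e1]
      ring
    · intro i _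
      exact integrable_smul_of_tsupport_subset ((S.weak_flux i).apply i).locInt_deriv
        hφ.continuous hc hs
    · intro i _
      have := integrable_smul_of_tsupport_subset ((S.weak_flux i).apply i).locInt
        (contDiff_fderiv_apply_const hφ (bv i)).continuous
        (hasCompactSupport_fderiv_apply hc (bv i)) ((tsupport_fderiv_apply_subset' (bv i)).trans hs)
      simpa only [smul_eq_mul, mul_comm] using this

/-- By the pointwise equation f(u) is minus the trace of the differentiated flux, which is in L² by
the energy bound. Thus f(u) can be paired with L² gradients although it is only assumed locally
integrable. -/
lemma memLp_f (S : StableSystem Ω f u G H L) {K : Set (𝔼 n)} (hKΩ : K ⊆ Ω)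
    (hK : IsCompact K) : MemLp (fun x => f (u x)) 2 (volume.restrict K) := by
  have h1 : MemLp (fun x => -∑ i, areaHess (G x) (H i x) i) 2 (volume.restrict K) := by
    have h0 : ∀ i, MemLp (fun x => areaHess (G x) (H i x) i) 2 (volume.restrict K) := fun i => by
      have h := S.memLp_areaHess i hKΩ hK
      refine h.mono ?_ (Eventually.of_forall fun x => PiLp.norm_apply_le _ i)
      exact (EuclideanSpace.proj (𝕜 := ℝ) i).continuous.comp_aestronglyMeasurable
        h.aestronglyMeasurable
    have h2 := memLp_finsetSum (p := 2) (μ := volume.restrict K)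
      (f := fun i x => areaHess (G x) (H i x) i) Finset.univ fun i _ => h0 i
    exact h2.neg
  refine (memLp_congr_ae ?_).1 h1
  rw [EventuallyEq, ae_restrict_iff' hK.measurableSet]
  filter_upwards [S.ae_eq] with x hx hxK
  exact (hx (hKΩ hxK)).symm

/-- The linearized equation satisfied by the partial derivatives, against smooth functions. -/
lemma linearized (S : StableSystem Ω f u G H L) (k : Fin n) {φ : (𝔼 n) → ℝ} (hφ : ContDiff ℝ ∞ φ)
    (hc : HasCompactSupport φ) (hs : tsupport φ ⊆ Ω) :
    ∫ x, inner ℝ (areaHess (G x) (H k x) + f (u x) • bv k) (∇ φ x) = 0 := by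
  set dφ : (𝔼 n) → ℝ := fun x => fderiv ℝ φ x (bv k) with hdφ
  have hdφs := contDiff_fderiv_apply_const hφ (bv k)
  have hdφc := hasCompactSupport_fderiv_apply hc (bv k)
  have hdφt := (tsupport_fderiv_apply_subset' (φ := φ) (bv k)).trans hs
  have hgs : ContDiff ℝ ∞ fun x => ∇ φ x :=
    (InnerProductSpace.toDual ℝ (𝔼 n)).symm.toContinuousLinearEquiv.contDiff.comp
      (hφ.fderiv_right (m := ∞) (by simp))
  have hgt : tsupport (fun x => ∇ φ x) ⊆ tsupport φ :=
    closure_minimal (fun x hx => by_contra fun h' => hx (gradient_eq_zero_of_notMem_tsupport h'))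
      (isClosed_tsupport φ)
  have hgc : HasCompactSupport fun x => ∇ φ x :=
    hc.isCompact.of_isClosed_subset (isClosed_tsupport _) hgt
  obtain ⟨j1, j2, j3⟩ := (S.weak_flux k).integral_inner hgs hgc (hgt.trans hs)
  have hcomm : ∀ x, fderiv ℝ (fun x => ∇ φ x) x (bv k) = ∇ dφ x := by
    intro x
    have hsym : IsSymmSndFDerivAt ℝ φ x :=
      (hφ.contDiffAt).isSymmSndFDerivAt
        (by simp only [minSmoothness_of_isRCLikeNormedField]; exact WithTop.coe_le_coe.2 (le_top (a := (2 : ℕ∞))))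
    have hdd : DifferentiableAt ℝ (fderiv ℝ φ) x :=
      (hφ.fderiv_right (m := 1) (by norm_cast)).differentiable one_ne_zero x
    have h1 : ∀ a b, fderiv ℝ (fun x => fderiv ℝ φ x a) x b = fderiv ℝ (fderiv ℝ φ) x b a := by
      intro a b
      have := (hdd.hasFDerivAt.clm_apply (hasFDerivAt_const a x)).fderiv
      rw [this]; simp
    ext i
    rw [gradient_apply, hdφ, h1]
    have h2 := ((EuclideanSpace.proj (𝕜 := ℝ) i).hasFDerivAt.comp x
      (hgs.differentiable (by simp) x).hasFDerivAt).fderiv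
    have h3 : (EuclideanSpace.proj (𝕜 := ℝ) i) ∘ (fun x => ∇ φ x)
        = fun x => fderiv ℝ φ x (bv i) := by
      ext z; simp [gradient_apply]
    rw [h3] at h2
    have h4 := h1 (bv i) (bv k)
    rw [h2] at h4
    have h5 : (fderiv ℝ (fun x => ∇ φ x) x (bv k)) i
      = fderiv ℝ (fderiv ℝ φ) x (bv k) (bv i) := h4
    rw [h5]
    exact hsym.eq _ _
  simp only [hcomm] at j3
  -- The weak equation tested with ∂ₖφ; moving ∂ₖ onto the flux gives the linearized equation. The
  -- nonlinearity stays undifferentiated for now, as f(u)eₖ.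
  have e1 := S.weak_eq dφ hdφs hdφc hdφt
  simp only [real_inner_comm] at j3
  have i1 : Integrable fun x => inner ℝ (areaHess (G x) (H k x)) (∇ φ x) := by
    simpa only [real_inner_comm] using j2
  have i2 : Integrable fun x => f (u x) * dφ x := by
    simpa only [smul_eq_mul, mul_comm] using
      integrable_smul_of_tsupport_subset S.locInt_f hdφs.continuous hdφc hdφt
  have e2 : ∀ x, inner ℝ (areaHess (G x) (H k x) + f (u x) • bv k) (∇ φ x)
      = inner ℝ (areaHess (G x) (H k x)) (∇ φ x) + f (u x) * dφ x := by
    intro x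
    rw [inner_add_left, real_inner_smul_left, real_inner_comm (∇ φ x) (bv k), inner_gradient]
  simp only [e2]
  rw [integral_add i1 i2]
  have e3 : ∫ x, inner ℝ (flux (G x)) (∇ dφ x) = -∫ x, inner ℝ (areaHess (G x) (H k x)) (∇ φ x) := by
    simpa only [real_inner_comm] using j3
  linarith

end StableSystem

end StableSystem

end MeanCurvature

open Filter Set Metric ContinuousLinearMap
open scoped Topology ContDiff Convolution

namespace MeanCurvature

local notation "𝔼" n => EuclideanSpace ℝ (Fin n)

/-! ### The stability inequality tested with a damped multiple of `(x - x₀) · ∇u` -/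

section DampedTest

variable {n : ℕ}

lemma norm_fderiv_damp_apply_le {τ : ℝ} (hτ : 0 ≤ τ) (m : ℕ) (p q : 𝔼 n) :
    ‖fderiv ℝ (damp τ m) p q‖ ≤ (1 + 2 * m) * (((1 + τ * ‖p‖ ^ 2) ^ m)⁻¹ * ‖q‖) := by
  rw [fderiv_damp_apply hτ]
  have hσ := one_le_dampDen hτ p
  have h2 : ‖((1 + τ * ‖p‖ ^ 2) ^ m)⁻¹ • q‖ = ((1 + τ * ‖p‖ ^ 2) ^ m)⁻¹ * ‖q‖ := by
    rw [norm_smul, Real.norm_of_nonneg (by positivity)]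
  have h3 : ‖(2 * m * τ * ((1 + τ * ‖p‖ ^ 2) ^ (m + 1))⁻¹ * inner ℝ p q) • p‖
      ≤ 2 * m * (((1 + τ * ‖p‖ ^ 2) ^ m)⁻¹ * ‖q‖) := by
    have h4 : τ * ‖p‖ ^ 2 * (1 + τ * ‖p‖ ^ 2)⁻¹ ≤ 1 := by
      rw [← div_eq_mul_inv, div_le_one (by positivity)]; linarith
    rw [norm_smul, norm_mul, Real.norm_of_nonneg (by positivity)]
    calc 2 * m * τ * ((1 + τ * ‖p‖ ^ 2) ^ (m + 1))⁻¹ * ‖inner ℝ p q‖ * ‖p‖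
        ≤ 2 * m * τ * ((1 + τ * ‖p‖ ^ 2) ^ (m + 1))⁻¹ * (‖p‖ * ‖q‖) * ‖p‖ := by
          gcongr; exact norm_inner_le_norm p q
      _ = 2 * m * ((1 + τ * ‖p‖ ^ 2) ^ m)⁻¹ * (τ * ‖p‖ ^ 2 * (1 + τ * ‖p‖ ^ 2)⁻¹) * ‖q‖ := by
          rw [pow_succ, mul_inv]; ring
      _ ≤ 2 * m * ((1 + τ * ‖p‖ ^ 2) ^ m)⁻¹ * 1 * ‖q‖ := by gcongr
      _ = _ := by ring
  have := norm_sub_le (((1 + τ * ‖p‖ ^ 2) ^ m)⁻¹ • q)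
    ((2 * m * τ * ((1 + τ * ‖p‖ ^ 2) ^ (m + 1))⁻¹ * inner ℝ p q) • p)
  rw [h2] at this
  linarith

lemma one_add_norm_sq_le {τ : ℝ} (hτ : 0 < τ) (p : 𝔼 n) :
    1 + ‖p‖ ^ 2 ≤ (1 + τ⁻¹) * (1 + τ * ‖p‖ ^ 2) := by
  have h1 : τ⁻¹ * (1 + τ * ‖p‖ ^ 2) = τ⁻¹ + ‖p‖ ^ 2 := by field_simp
  rw [add_mul, h1]
  have := inv_pos.2 hτ
  nlinarith [mul_nonneg hτ.le (sq_nonneg ‖p‖)]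

/-- The damping compensates the degenerate ellipticity: |q|² ≤ w³ (Aq·q), while w³ ≤ w⁴ = (1+|p|²)²
is at most the square of (1+1/τ)(1+τ|p|²). -/
lemma dampDen_inv_mul_norm_sq_le {τ : ℝ} (hτ : 0 < τ) {m : ℕ} (hm : 2 ≤ m) (p q : 𝔼 n) :
    (((1 + τ * ‖p‖ ^ 2) ^ m)⁻¹ * ‖q‖) ^ 2 ≤ (1 + τ⁻¹) ^ 2 * inner ℝ (areaHess p q) q := by
  have hσ := one_le_dampDen hτ.le p
  have hσ0 : 0 < 1 + τ * ‖p‖ ^ 2 := by positivity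
  have h1 : ((1 + τ * ‖p‖ ^ 2) ^ m)⁻¹ ≤ ((1 + τ * ‖p‖ ^ 2) ^ 2)⁻¹ := by
    gcongr
  have h2 := inner_areaHess_self_ge p q
  have hw := areaElt_pos p
  have h3 : ‖q‖ ^ 2 ≤ areaElt p ^ 3 * inner ℝ (areaHess p q) q := by
    have := mul_le_mul_of_nonneg_left h2 (pow_pos hw 3).le
    rwa [← mul_assoc, ← mul_pow, mul_inv_cancel₀ hw.ne', one_pow, one_mul] at this
  have ha := inner_areaHess_self_nonneg p q
  have h4 : areaElt p ^ 3 ≤ ((1 + τ⁻¹) * (1 + τ * ‖p‖ ^ 2)) ^ 2 := by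
    calc areaElt p ^ 3 ≤ areaElt p ^ 4 := pow_le_pow_right₀ (one_le_areaElt p) (by norm_num)
      _ = (1 + ‖p‖ ^ 2) ^ 2 := by rw [← areaElt_sq]; ring
      _ ≤ _ := pow_le_pow_left₀ (by positivity) (one_add_norm_sq_le hτ p) 2
  have hi : 0 < τ⁻¹ := inv_pos.2 hτ
  calc (((1 + τ * ‖p‖ ^ 2) ^ m)⁻¹ * ‖q‖) ^ 2
      ≤ (((1 + τ * ‖p‖ ^ 2) ^ 2)⁻¹ * ‖q‖) ^ 2 := by gcongr
    _ = (((1 + τ * ‖p‖ ^ 2) ^ 2)⁻¹) ^ 2 * ‖q‖ ^ 2 := by ring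
    _ ≤ (((1 + τ * ‖p‖ ^ 2) ^ 2)⁻¹) ^ 2 *
        (((1 + τ⁻¹) * (1 + τ * ‖p‖ ^ 2)) ^ 2 * inner ℝ (areaHess p q) q) := by
        gcongr
        exact h3.trans (mul_le_mul_of_nonneg_right h4 ha)
    _ = (1 + τ⁻¹) ^ 2 * inner ℝ (areaHess p q) q * ((1 + τ * ‖p‖ ^ 2) ^ 2)⁻¹ := by
        field_simp
    _ ≤ (1 + τ⁻¹) ^ 2 * inner ℝ (areaHess p q) q * 1 := by
        gcongr
        exact inv_le_one_of_one_le₀ (one_le_pow₀ hσ)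
    _ = _ := mul_one _

/-- The damping absorbs two powers of |p|, so a component of ∇u times a damped test function is
bounded and may be integrated against f'(u), which is only L¹_loc. -/
lemma norm_sq_mul_dampDen_inv_le {τ : ℝ} (hτ : 0 < τ) {m : ℕ} (hm : 1 ≤ m) (p : 𝔼 n) :
    ‖p‖ * ‖damp τ m p‖ ≤ τ⁻¹ := by
  have hσ := one_le_dampDen hτ.le p
  rw [damp, norm_smul, Real.norm_of_nonneg (by positivity)]
  have h1 : ((1 + τ * ‖p‖ ^ 2) ^ m)⁻¹ ≤ (1 + τ * ‖p‖ ^ 2)⁻¹ := by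
    gcongr; exact le_self_pow₀ hσ (by omega)
  calc ‖p‖ * (((1 + τ * ‖p‖ ^ 2) ^ m)⁻¹ * ‖p‖) = ‖p‖ ^ 2 * ((1 + τ * ‖p‖ ^ 2) ^ m)⁻¹ := by ring
    _ ≤ ‖p‖ ^ 2 * (1 + τ * ‖p‖ ^ 2)⁻¹ := by gcongr
    _ ≤ τ⁻¹ := by
        rw [← div_eq_mul_inv, div_le_iff₀ (by positivity), mul_add, mul_one, ← mul_assoc,
          inv_mul_cancel₀ hτ.ne', one_mul]
        linarith [inv_pos.2 hτ]

/-- The weak gradient of `⟨a, damp τ m G⟩`, where `H i` is the weak derivative `∂ᵢ G`. -/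
noncomputable def testGrad (G : (𝔼 n) → 𝔼 n) (H : Fin n → (𝔼 n) → 𝔼 n) (a : (𝔼 n) → 𝔼 n) (τ : ℝ)
    (m : ℕ) (x : 𝔼 n) : 𝔼 n :=
  WithLp.toLp 2 fun i => inner ℝ (fderiv ℝ a x (bv i)) (damp τ m (G x))
    + inner ℝ (a x) (fderiv ℝ (damp τ m) (G x) (H i x))

namespace StableSystem

variable {Ω : Opens (𝔼 n)} {f : ℝ → ℝ} {u : (𝔼 n) → ℝ} {G : (𝔼 n) → 𝔼 n}
  {H L : Fin n → (𝔼 n) → 𝔼 n}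

lemma weak_damp (S : StableSystem Ω f u G H L) {τ : ℝ} (hτ : 0 ≤ τ) (m : ℕ) (i : Fin n) :
    HasWeakDeriv Ω (bv i) (fun x => damp τ m (G x)) fun x => fderiv ℝ (damp τ m) (G x) (H i x) :=
  (S.weak_G i).comp ((contDiff_damp hτ m).of_le (by simp)) (norm_fderiv_damp_le hτ m)

lemma meas_fderiv_damp (S : StableSystem Ω f u G H L) {τ : ℝ} (hτ : 0 ≤ τ) (m : ℕ) (i : Fin n) :
    AEStronglyMeasurable (fun x => fderiv ℝ (damp τ m) (G x) (H i x)) volume := by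
  have h := S.meas_G.prodMk (S.meas_H i)
  have hc := continuous_fderiv_uncurry ((contDiff_damp (n := n) hτ m).of_le (m := 1) (by simp))
  have h' := hc.comp_aestronglyMeasurable h
  exact h'

/-- Boundedness comes from the damping, and square integrability of the second-order part of the
gradient from the local energy bound. -/
lemma isW12Test (S : StableSystem Ω f u G H L) {τ : ℝ} (hτ : 0 < τ) {m : ℕ} (hm : 2 ≤ m)
    {a : (𝔼 n) → 𝔼 n} (ha : ContDiff ℝ ∞ a) (hc : HasCompactSupport a) (hs : tsupport a ⊆ Ω) :
    IsW12Test Ω (fun x => inner ℝ (a x) (damp τ m (G x))) (testGrad G H a τ m) := by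
  obtain ⟨B, hB⟩ := hc.exists_bound_of_continuous ha.continuous
  have hB0 : 0 ≤ B := (norm_nonneg _).trans (hB 0)
  have hτ' := inv_pos.2 hτ
  have hz : ∀ x ∉ tsupport a, testGrad G H a τ m x = 0 := by
    intro x hx
    ext i
    have h1 : fderiv ℝ a x = 0 := image_eq_zero_of_notMem_tsupport
      (f := fderiv ℝ a) fun h => hx (tsupport_fderiv_subset ℝ h)
    simp [testGrad, h1, image_eq_zero_of_notMem_tsupport hx]
  have hw : ∀ i, HasWeakDeriv ⊤ (bv i) (fun x => inner ℝ (a x) (damp τ m (G x)))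
      fun x => testGrad G H a τ m x i := fun i => (S.weak_damp hτ.le m i).inner_smooth ha hc hs
  refine ⟨⟨B * (1 + τ⁻¹), fun x => ?_⟩, ⟨tsupport a, hc, hs, fun x hx => ?_, hz⟩, ?_, hw⟩
  · exact (norm_inner_le_norm _ _).trans (mul_le_mul (hB x) (norm_damp_le hτ (by omega) _)
      (norm_nonneg _) hB0)
  · simp [image_eq_zero_of_notMem_tsupport hx]
  · have hcomp : ∀ i, MemLp (fun x => testGrad G H a τ m x i) 2 volume := by
      intro i
      have hda := contDiff_fderiv_apply_const ha (bv i)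
      have m1 : AEStronglyMeasurable (fun x => inner ℝ (fderiv ℝ a x (bv i)) (damp τ m (G x)))
          volume := hda.continuous.aestronglyMeasurable.inner
            ((contDiff_damp hτ.le m).continuous.comp_aestronglyMeasurable S.meas_G)
      have m2 : AEStronglyMeasurable
          (fun x => inner ℝ (a x) (fderiv ℝ (damp τ m) (G x) (H i x))) volume :=
        ha.continuous.aestronglyMeasurable.inner (S.meas_fderiv_damp hτ.le m i)
      have l1 : MemLp (fun x => inner ℝ (fderiv ℝ a x (bv i)) (damp τ m (G x))) 2 volume := by
        have : MemLp (fun x => (1 + τ⁻¹) * ‖fderiv ℝ a x (bv i)‖) 2 volume :=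
          ((hda.continuous.memLp_of_hasCompactSupport
            (hasCompactSupport_fderiv_apply hc (bv i))).norm).const_mul _
        refine this.mono m1 (Eventually.of_forall fun x => ?_)
        rw [Real.norm_of_nonneg (show 0 ≤ (1 + τ⁻¹) * ‖fderiv ℝ a x (bv i)‖ by positivity), mul_comm]
        exact (norm_inner_le_norm _ _).trans (mul_le_mul_of_nonneg_left
          (norm_damp_le hτ (by omega) _) (norm_nonneg _))
      have l2 : MemLp (fun x => inner ℝ (a x) (fderiv ℝ (damp τ m) (G x) (H i x))) 2 volume := by
        rw [memLp_two_iff_integrable_sq_norm m2]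
        have hK : IntegrableOn (fun x => inner ℝ (areaHess (G x) (H i x)) (H i x)) (tsupport a) :=
          locallyIntegrableOn_opens_iff.1 (S.locInt_energy i) _ hs hc
        have hI : IntegrableOn
            (fun x => ‖inner ℝ (a x) (fderiv ℝ (damp τ m) (G x) (H i x))‖ ^ 2) (tsupport a) := by
          refine Integrable.mono' (hK.const_mul (B ^ 2 * ((1 + 2 * m) ^ 2 * (1 + τ⁻¹) ^ 2)))
            (m2.restrict.norm.pow 2) (Eventually.of_forall fun x => ?_)
          rw [Real.norm_of_nonneg (by positivity)]
          have h1 := norm_inner_le_norm (𝕜 := ℝ) (a x) (fderiv ℝ (damp τ m) (G x) (H i x))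
          have h2 := norm_fderiv_damp_apply_le hτ.le m (G x) (H i x)
          have h3 := dampDen_inv_mul_norm_sq_le hτ hm (G x) (H i x)
          calc ‖inner ℝ (a x) (fderiv ℝ (damp τ m) (G x) (H i x))‖ ^ 2
              ≤ (B * ((1 + 2 * m) * (((1 + τ * ‖G x‖ ^ 2) ^ m)⁻¹ * ‖H i x‖))) ^ 2 := by
                refine pow_le_pow_left₀ (norm_nonneg _) (h1.trans ?_) 2
                exact mul_le_mul (hB x) h2 (norm_nonneg _) hB0
            _ = B ^ 2 * ((1 + 2 * m) ^ 2 * (((1 + τ * ‖G x‖ ^ 2) ^ m)⁻¹ * ‖H i x‖) ^ 2) := by ring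
            _ ≤ B ^ 2 * ((1 + 2 * m) ^ 2 *
                ((1 + τ⁻¹) ^ 2 * inner ℝ (areaHess (G x) (H i x)) (H i x))) := by gcongr
            _ = _ := by ring
        refine (integrableOn_iff_integrable_of_support_subset fun x hx => ?_).1 hI
        by_contra h'
        exact hx (by simp [image_eq_zero_of_notMem_tsupport h'])
      exact l1.add l2
    have hmeas : AEStronglyMeasurable (testGrad G H a τ m) volume := by
      have h1 : AEMeasurable (fun x => (testGrad G H a τ m x).ofLp) volume :=
        aemeasurable_pi_lambda _ fun i => (hcomp i).aestronglyMeasurable.aemeasurable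
      have h2 := (PiLp.continuous_toLp 2 (fun _ : Fin n => ℝ)).comp_aestronglyMeasurable
        h1.aestronglyMeasurable
      exact h2
    rw [memLp_two_iff_integrable_sq_norm hmeas]
    have : (fun x => ‖testGrad G H a τ m x‖ ^ 2) = fun x => ∑ i, ‖testGrad G H a τ m x i‖ ^ 2 := by
      ext x; rw [EuclideanSpace.norm_sq_eq]
    rw [this]
    exact integrable_finsetSum _ fun i _ =>
      (memLp_two_iff_integrable_sq_norm (hcomp i).aestronglyMeasurable).1 (hcomp i)

end StableSystem

lemma IsW12Test.integrable_inner {Ω : Opens (𝔼 n)} {ψ : (𝔼 n) → ℝ} {D : (𝔼 n) → 𝔼 n}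
    (h : IsW12Test Ω ψ D) {X : (𝔼 n) → 𝔼 n}
    (hX : ∀ K ⊆ (Ω : Set (𝔼 n)), IsCompact K → MemLp X 2 (volume.restrict K)) :
    Integrable fun x => inner ℝ (X x) (D x) := by
  obtain ⟨K, hK, hKΩ, -, h1⟩ := h.supp
  have hXK := hX K hKΩ hK
  have hD := h.memLp.restrict K
  have : IntegrableOn (fun x => inner ℝ (X x) (D x)) K :=
    Integrable.mono' (hXK.norm.integrable_mul hD.norm)
      (hXK.aestronglyMeasurable.inner hD.aestronglyMeasurable)
      (Eventually.of_forall fun x => norm_inner_le_norm _ _)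
  refine (integrableOn_iff_integrable_of_support_subset fun x hx => ?_).1 this
  by_contra h'
  exact hx (by simp [h1 x h'])

lemma IsW12Test.integrable_mul {Ω : Opens (𝔼 n)} {ψ : (𝔼 n) → ℝ} {D : (𝔼 n) → 𝔼 n}
    (h : IsW12Test Ω ψ D) (hψ : AEStronglyMeasurable ψ volume) {b : (𝔼 n) → ℝ}
    (hb : LocallyIntegrableOn b Ω volume) :
    Integrable fun x => b x * ψ x := by
  obtain ⟨K, hK, hKΩ, h0, -⟩ := h.supp
  obtain ⟨B, hB⟩ := h.bdd
  have hbK := locallyIntegrableOn_opens_iff.1 hb K hKΩ hK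
  have : IntegrableOn (fun x => b x * ψ x) K :=
    hbK.mul_bdd hψ.restrict (Eventually.of_forall hB)
  refine (integrableOn_iff_integrable_of_support_subset fun x hx => ?_).1 this
  by_contra h'
  exact hx (by simp [h0 x h'])

namespace StableSystem

variable {Ω : Opens (𝔼 n)} {f : ℝ → ℝ} {u : (𝔼 n) → ℝ} {G : (𝔼 n) → 𝔼 n}
  {H L : Fin n → (𝔼 n) → 𝔼 n}

lemma meas_test (S : StableSystem Ω f u G H L) {τ : ℝ} (hτ : 0 ≤ τ) (m : ℕ) {a : (𝔼 n) → 𝔼 n}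
    (ha : Continuous a) :
    AEStronglyMeasurable (fun x => inner ℝ (a x) (damp τ m (G x))) volume :=
  ha.aestronglyMeasurable.inner
    ((contDiff_damp hτ m).continuous.comp_aestronglyMeasurable S.meas_G)

lemma memLp_f_smul (S : StableSystem Ω f u G H L) (k : Fin n) {K : Set (𝔼 n)} (hKΩ : K ⊆ Ω)
    (hK : IsCompact K) : MemLp (fun x => f (u x) • (bv k : 𝔼 n)) 2 (volume.restrict K) := by
  have h := S.memLp_f hKΩ hK
  refine h.mono (h.aestronglyMeasurable.smul_const _) (Eventually.of_forall fun x => ?_)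
  rw [norm_smul]; simp

/-- The derivative `∂ₖ (f(u))` in weak form, against damped test functions. -/
lemma integral_f_testGrad (S : StableSystem Ω f u G H L) {τ : ℝ} (hτ : 0 < τ) {m : ℕ} (hm : 2 ≤ m)
    {a : (𝔼 n) → 𝔼 n} (ha : ContDiff ℝ ∞ a) (hc : HasCompactSupport a) (hs : tsupport a ⊆ Ω)
    (k : Fin n) :
    ∫ x, f (u x) * testGrad G H a τ m x k
      = -∫ x, deriv f (u x) * (G x k * inner ℝ (a x) (damp τ m (G x))) := by
  have hT := S.isW12Test hτ hm ha hc hs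
  have hτ' := inv_pos.2 hτ
  obtain ⟨B, hB⟩ := hc.exists_bound_of_continuous ha.continuous
  have hB0 : 0 ≤ B := (norm_nonneg _).trans (hB 0)
  set D : (𝔼 n) → ℝ := fun x => testGrad G H a τ m x k with hD
  set E : (𝔼 n) → ℝ := fun x => G x k * inner ℝ (a x) (damp τ m (G x)) with hE
  have hmG : AEStronglyMeasurable (fun x => G x k) volume :=
    (EuclideanSpace.proj (𝕜 := ℝ) k).continuous.comp_aestronglyMeasurable S.meas_G
  have hEm : AEStronglyMeasurable E volume := hmG.mul (S.meas_test hτ.le m ha.continuous)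
  have hEb : ∀ x, ‖E x‖ ≤ B * τ⁻¹ := by
    intro x
    rw [hE, norm_mul]
    calc ‖G x k‖ * ‖inner ℝ (a x) (damp τ m (G x))‖
        ≤ ‖G x‖ * (B * ‖damp τ m (G x)‖) := by
          refine mul_le_mul (PiLp.norm_apply_le _ k) ?_ (norm_nonneg _) (norm_nonneg _)
          exact (norm_inner_le_norm _ _).trans (mul_le_mul_of_nonneg_right (hB x) (norm_nonneg _))
      _ = B * (‖G x‖ * ‖damp τ m (G x)‖) := by ring
      _ ≤ B * τ⁻¹ := by gcongr; exact norm_sq_mul_dampDen_inv_le hτ (by omega) _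
  have hE0 : ∀ x ∉ tsupport a, E x = 0 := fun x hx => by
    simp [hE, image_eq_zero_of_notMem_tsupport hx]
  have hEint : ∀ {b : (𝔼 n) → ℝ}, LocallyIntegrableOn b Ω volume →
      Integrable fun x => b x * E x := by
    intro b hb
    have : IntegrableOn (fun x => b x * E x) (tsupport a) :=
      (locallyIntegrableOn_opens_iff.1 hb _ hs hc).mul_bdd hEm.restrict (Eventually.of_forall hEb)
    refine (integrableOn_iff_integrable_of_support_subset fun x hx => ?_).1 this
    by_contra h'
    exact hx (by simp [hE0 x h'])
  have hfD : Integrable fun x => f (u x) * D x := by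
    have := hT.integrable_inner fun K h1 h2 => S.memLp_f_smul k h1 h2
    simpa [real_inner_smul_left, EuclideanSpace.inner_single_left] using this
  have hfE := hEint S.locInt_f
  have hdE := hEint S.locInt_deriv
  -- the identity for compactly supported truncations of `f`
  have htrunc : ∀ F : ℝ → ℝ, ContDiff ℝ 1 F → HasCompactSupport F →
      ∫ x, F (u x) * D x + deriv F (u x) * E x = 0 := by
    intro F hF hFc
    obtain ⟨B1, hB1⟩ := hFc.exists_bound_of_continuous hF.continuous
    obtain ⟨B2, hB2⟩ := hFc.deriv.exists_bound_of_continuous (hF.continuous_deriv le_rfl)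
    have hw := ((S.weak_u k).prodMk (S.weak_G k)).comp (contDiff_scalarDamp hF hτ.le m)
      (norm_fderiv_scalarDamp_le hF hB1 hB2 hτ (show 1 ≤ m by omega))
    obtain ⟨j1, j2, j3⟩ := hw.integral_inner ha hc hs
    have h0 : ∫ x, (inner ℝ (fderiv ℝ a x (bv k)) (scalarDamp F τ m (u x, G x))
        + inner ℝ (a x) (fderiv ℝ (scalarDamp F τ m) (u x, G x) (G x k, H k x))) = 0 := by
      rw [integral_add j1 j2, j3]; ring
    rw [← h0]
    refine integral_congr_ae (Eventually.of_forall fun x => ?_)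
    simp only [fderiv_scalarDamp hF hτ.le, scalarDamp, hD, hE, testGrad, inner_add_right,
      real_inner_smul_right]
    ring
  -- the cutoffs
  let χ : ContDiffBump (0 : ℝ) := ⟨1, 2, one_pos, one_lt_two⟩
  have hχs : ContDiff ℝ 1 (χ : ℝ → ℝ) := χ.contDiff
  obtain ⟨B3, hB3⟩ := χ.hasCompactSupport.deriv.exists_bound_of_continuous
    (hχs.continuous_deriv le_rfl)
  set r : ℕ → ℝ := fun N => 1 / ((N : ℝ) + 1) with hr
  have hr0 : ∀ N, 0 < r N := fun N => by positivity
  have hr1 : ∀ N, r N ≤ 1 := fun N => by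
    rw [hr]; simp only; rw [div_le_one (by positivity)]; linarith [Nat.cast_nonneg (α := ℝ) N]
  have hrt : Tendsto r atTop (𝓝 0) := tendsto_one_div_add_atTop_nhds_zero_nat
  -- Cutoffs at height of order 1/r. The extra term in the derivative carries the factor r, which
  -- tends to 0, and f(u)·E is integrable, so it vanishes in the limit.
  set F : ℕ → ℝ → ℝ := fun N s => f s * χ (s * r N) with hF
  have hFd : ∀ N s, deriv (F N) s = deriv f s * χ (s * r N) + f s * (deriv χ (s * r N) * r N) := by
    intro N s
    have h1 := (S.contDiff_f.differentiable one_ne_zero s).hasDerivAt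
    have h2 : HasDerivAt (fun s => s * r N) (r N) s := by
      simpa using (hasDerivAt_id s).mul_const (r N)
    have h3 := (hχs.differentiable one_ne_zero (s * r N)).hasDerivAt.comp s h2
    exact (h1.mul h3).deriv
  have hF1 : ∀ N, ContDiff ℝ 1 (F N) := fun N =>
    S.contDiff_f.mul (hχs.comp (contDiff_id.mul contDiff_const))
  have hFc : ∀ N, HasCompactSupport (F N) := by
    intro N
    refine HasCompactSupport.intro (isCompact_closedBall (0 : ℝ) (2 / r N)) fun s hs' => ?_
    have : χ (s * r N) = 0 := by
      refine χ.zero_of_le_dist ?_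
      rw [mem_closedBall, not_le, dist_zero_right] at hs'
      rw [dist_zero_right, norm_mul, Real.norm_of_nonneg (hr0 N).le]
      rw [div_lt_iff₀ (hr0 N)] at hs'
      exact hs'.le
    simp [hF, this]
  have hχ1 : ∀ s, ‖χ s‖ ≤ 1 := fun s => by
    rw [Real.norm_of_nonneg χ.nonneg]; exact χ.le_one
  have hχt : ∀ s : ℝ, Tendsto (fun N => χ (s * r N)) atTop (𝓝 1) := by
    intro s
    have h1 : Tendsto (fun N => s * r N) atTop (𝓝 0) := by simpa using hrt.const_mul s
    have h2 := (χ.continuous.tendsto 0).comp h1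
    rwa [χ.one_of_mem_closedBall (mem_closedBall_self χ.rIn_pos.le)] at h2
  have hlim : Tendsto (fun N => ∫ x, F N (u x) * D x + deriv (F N) (u x) * E x) atTop
      (𝓝 (∫ x, f (u x) * D x + deriv f (u x) * E x)) := by
    have hB30 : 0 ≤ B3 := (norm_nonneg _).trans (hB3 0)
    refine tendsto_integral_of_dominated_convergence
      (fun x => ‖f (u x) * D x‖ + (‖deriv f (u x) * E x‖ + B3 * ‖f (u x) * E x‖))
      (fun N => ?_) (hfD.norm.add (hdE.norm.add (hfE.norm.const_mul B3)))
      (fun N => Eventually.of_forall fun x => ?_) (Eventually.of_forall fun x => ?_)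
    · have hDm : AEStronglyMeasurable D volume :=
        (EuclideanSpace.proj (𝕜 := ℝ) k).continuous.comp_aestronglyMeasurable
          hT.memLp.aestronglyMeasurable
      exact (((hF1 N).continuous.comp_aestronglyMeasurable S.meas_u).mul hDm).add
        ((((hF1 N).continuous_deriv le_rfl).comp_aestronglyMeasurable S.meas_u).mul hEm)
    · have e : F N (u x) * D x + deriv (F N) (u x) * E x
          = χ (u x * r N) * (f (u x) * D x) + (χ (u x * r N) * (deriv f (u x) * E x)
            + (deriv χ (u x * r N) * r N) * (f (u x) * E x)) := by
        rw [hFd, hF]; ring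
      rw [e]
      refine (norm_add_le _ _).trans (add_le_add ?_ ((norm_add_le _ _).trans (add_le_add ?_ ?_)))
      · rw [norm_mul]; exact mul_le_of_le_one_left (norm_nonneg _) (hχ1 _)
      · rw [norm_mul]; exact mul_le_of_le_one_left (norm_nonneg _) (hχ1 _)
      · rw [norm_mul]
        refine mul_le_mul_of_nonneg_right ?_ (norm_nonneg _)
        rw [norm_mul, Real.norm_of_nonneg (hr0 N).le]
        calc _ ≤ B3 * 1 := mul_le_mul (hB3 _) (hr1 N) (hr0 N).le hB30
          _ = B3 := mul_one _
    · have t1 : Tendsto (fun N => F N (u x)) atTop (𝓝 (f (u x))) := by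
        simpa [hF] using (hχt (u x)).const_mul (f (u x))
      have t3 : Tendsto (fun N => deriv χ (u x * r N) * r N) atTop (𝓝 0) := by
        refine squeeze_zero_norm (a := fun N => B3 * r N) (fun N => ?_) (by simpa using hrt.const_mul B3)
        rw [norm_mul, Real.norm_of_nonneg (hr0 N).le]
        exact mul_le_mul_of_nonneg_right (hB3 _) (hr0 N).le
      have t2 : Tendsto (fun N => deriv (F N) (u x)) atTop (𝓝 (deriv f (u x))) := by
        simp only [hFd]
        simpa using ((hχt (u x)).const_mul (deriv f (u x))).add (t3.const_mul (f (u x)))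
      exact (t1.mul_const _).add (t2.mul_const _)
  have hfin : ∫ x, f (u x) * D x + deriv f (u x) * E x = 0 := by
    refine tendsto_nhds_unique hlim ?_
    simp only [htrunc _ (hF1 _) (hFc _)]
    exact tendsto_const_nhds
  rw [integral_add hfD hdE] at hfin
  linarith

/-- The linearized equation against damped test functions. -/
lemma integral_areaHess_testGrad (S : StableSystem Ω f u G H L) {τ : ℝ} (hτ : 0 < τ) {m : ℕ}
    (hm : 2 ≤ m) {a : (𝔼 n) → 𝔼 n} (ha : ContDiff ℝ ∞ a) (hc : HasCompactSupport a)
    (hs : tsupport a ⊆ Ω) (k : Fin n) :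
    ∫ x, inner ℝ (areaHess (G x) (H k x)) (testGrad G H a τ m x)
      = ∫ x, deriv f (u x) * (G x k * inner ℝ (a x) (damp τ m (G x))) := by
  have hT := S.isW12Test hτ hm ha hc hs
  have i1 := hT.integrable_inner fun K h1 h2 => S.memLp_areaHess k h1 h2
  have i2 := hT.integrable_inner fun K h1 h2 => S.memLp_f_smul k h1 h2
  -- The linearized equation has zero right-hand side when f(u)eₖ is kept inside the vector field,
  -- and that field is locally square integrable.
  have h1 := hT.integral_inner_eq (b := fun _ => 0)
    (X := fun x => areaHess (G x) (H k x) + f (u x) • bv k)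
    (locallyIntegrableOn_zero)
    (fun K h1 h2 => (S.memLp_areaHess k h1 h2).add (S.memLp_f_smul k h1 h2))
    (fun φ h1 h2 h3 => by simpa using S.linearized k h1 h2 h3)
  simp only [inner_add_left, zero_mul, integral_zero] at h1
  rw [integral_add i1 i2] at h1
  have h2 := S.integral_f_testGrad hτ hm ha hc hs k
  have h3 : ∀ x, inner ℝ (f (u x) • (bv k : 𝔼 n)) (testGrad G H a τ m x)
      = f (u x) * testGrad G H a τ m x k := by
    intro x
    simp [real_inner_smul_left, EuclideanSpace.inner_single_left]
  simp only [h3] at h1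
  linarith

lemma memLp_flux (S : StableSystem Ω f u G H L) {K : Set (𝔼 n)} (hK : IsCompact K) :
    MemLp (fun x => flux (G x)) 2 (volume.restrict K) := by
  have hfin : IsFiniteMeasure (volume.restrict K) :=
    ⟨by rw [Measure.restrict_apply_univ]; exact hK.measure_lt_top⟩
  exact MemLp.of_bound
    (contDiff_flux.continuous.comp_aestronglyMeasurable S.meas_G).restrict 1
    (Eventually.of_forall fun x => norm_flux_le _)

/-- The equation against damped test functions. -/
lemma integral_flux_testGrad (S : StableSystem Ω f u G H L) {τ : ℝ} (hτ : 0 < τ) {m : ℕ}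
    (hm : 2 ≤ m) {a : (𝔼 n) → 𝔼 n} (ha : ContDiff ℝ ∞ a) (hc : HasCompactSupport a)
    (hs : tsupport a ⊆ Ω) :
    ∫ x, inner ℝ (flux (G x)) (testGrad G H a τ m x)
      = ∫ x, f (u x) * inner ℝ (a x) (damp τ m (G x)) :=
  (S.isW12Test hτ hm ha hc hs).integral_inner_eq S.locInt_f (fun _ _ h2 => S.memLp_flux h2)
    S.weak_eq

/-- Polarization: by symmetry the difference of the two quadratic forms is A(X-Y)·(X+Y), and A has
norm at most 1. -/
lemma abs_areaHess_quad_sub_le (p X Y : 𝔼 n) :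
    |inner ℝ (areaHess p X) X - inner ℝ (areaHess p Y) Y| ≤ ‖X - Y‖ * (‖X‖ + ‖Y‖) := by
  have e : inner ℝ (areaHess p X) X - inner ℝ (areaHess p Y) Y
      = inner ℝ (areaHess p (X - Y)) (X + Y) := by
    rw [map_sub, inner_sub_left, inner_add_right, inner_add_right, inner_areaHess_comm p Y X]
    ring
  rw [e, ← Real.norm_eq_abs]
  exact (norm_inner_le_norm _ _).trans (mul_le_mul (norm_areaHess_le _ _) (norm_add_le _ _)
    (norm_nonneg _) (norm_nonneg _))

/-- The stability inequality against damped test functions. -/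
lemma stable_testGrad (S : StableSystem Ω f u G H L) {τ : ℝ} (hτ : 0 < τ) {m : ℕ}
    (hm : 2 ≤ m) {a : (𝔼 n) → 𝔼 n} (ha : ContDiff ℝ ∞ a) (hc : HasCompactSupport a)
    (hs : tsupport a ⊆ Ω) :
    ∫ x, deriv f (u x) * inner ℝ (a x) (damp τ m (G x)) ^ 2
      ≤ ∫ x, inner ℝ (areaHess (G x) (testGrad G H a τ m x)) (testGrad G H a τ m x) :=
  (S.isW12Test hτ hm ha hc hs).integral_sq_le (q := fun x X => inner ℝ (areaHess (G x) X) X)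
    S.locInt_deriv (fun x X Y => abs_areaHess_quad_sub_le _ X Y) (fun x => by simp)
    (fun _ hX => (S.meas_areaHess hX).inner hX) S.stable

end StableSystem

end DampedTest

end MeanCurvature

open Filter Set Metric ContinuousLinearMap
open scoped Topology ContDiff Convolution

namespace MeanCurvature

local notation "𝔼" n => EuclideanSpace ℝ (Fin n)

/-! ### Elimination of f and f' from the damped stability inequality. -/

section DampedInequality

variable {n : ℕ}

/-- The action `∑ᵢ vᵢ ∂ᵢ G` of the Hessian on a vector. -/
noncomputable def hessAct (H : Fin n → (𝔼 n) → 𝔼 n) (v x : 𝔼 n) : 𝔼 n := ∑ i, v i • H i x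

lemma hessAct_apply {H : Fin n → (𝔼 n) → 𝔼 n} {x : 𝔼 n} (hsym : ∀ i j, H i x j = H j x i)
    (v : 𝔼 n) (i : Fin n) : hessAct H v x i = inner ℝ v (H i x) := by
  rw [StableSystem.inner_eq_sum, hessAct, WithLp.ofLp_sum, Finset.sum_apply]
  refine Finset.sum_congr rfl fun j _ => ?_
  rw [PiLp.smul_apply, smul_eq_mul, hsym j i]

/-- Symmetry of the second derivatives is what makes the gradient of y·G equal to G + D²u y, and
that of |G|²/2 equal to D²u G. -/
lemma testGrad_smul_sub {G : (𝔼 n) → 𝔼 n} {H : Fin n → (𝔼 n) → 𝔼 n} {x : 𝔼 n}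
    (hsym : ∀ i j, H i x j = H j x i) (x₀ : 𝔼 n) {b : (𝔼 n) → ℝ} (hb : ContDiff ℝ ∞ b) {τ : ℝ}
    (hτ : 0 ≤ τ) (m : ℕ) :
    testGrad G H (fun z => b z • (z - x₀)) τ m x
      = ((1 + τ * ‖G x‖ ^ 2) ^ m)⁻¹ • (b x • (G x + hessAct H (x - x₀) x)
          + inner ℝ (x - x₀) (G x) • ∇ b x)
        - (2 * m * τ * ((1 + τ * ‖G x‖ ^ 2) ^ (m + 1))⁻¹ * (b x * inner ℝ (x - x₀) (G x)))
          • hessAct H (G x) x := by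
  have hfd : ∀ e, fderiv ℝ (fun z => b z • (z - x₀)) x e
      = b x • e + fderiv ℝ b x e • (x - x₀) := by
    intro e
    have h1 : HasFDerivAt (fun z : 𝔼 n => z - x₀) (ContinuousLinearMap.id ℝ (𝔼 n)) x :=
      (hasFDerivAt_id x).sub_const x₀
    have h2 : HasFDerivAt (fun z => b z • (z - x₀)) _ x :=
      (hb.differentiable (by simp) x).hasFDerivAt.smul h1
    rw [h2.fderiv]; simp
  ext i
  simp only [testGrad, hfd, fderiv_damp_apply hτ, damp, inner_add_left, inner_sub_right,
    real_inner_smul_left, real_inner_smul_right, PiLp.sub_apply, PiLp.smul_apply, PiLp.add_apply,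
    hessAct_apply hsym, gradient_apply, smul_eq_mul, EuclideanSpace.inner_single_left]
  simp only [map_one, one_mul]
  ring

lemma tsupport_smul_subset' {b : (𝔼 n) → ℝ} {a : (𝔼 n) → 𝔼 n} :
    tsupport (fun z => b z • a z) ⊆ tsupport b :=
  closure_mono fun x hx h0 => hx (by simp only [h0, zero_smul])

lemma gradient_sq {η : (𝔼 n) → ℝ} (hη : ContDiff ℝ ∞ η) (x : 𝔼 n) :
    ∇ (fun z => η z ^ 2) x = (2 * η x) • ∇ η x := by
  ext i
  rw [PiLp.smul_apply, gradient_apply, gradient_apply]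
  have h := ((hη.differentiable (by simp) x).hasFDerivAt.pow 2).fderiv
  rw [h]
  simp

lemma gradient_coord_mul {b : (𝔼 n) → ℝ} (hb : ContDiff ℝ ∞ b) (x₀ x : 𝔼 n) (k : Fin n) :
    ∇ (fun z => (z - x₀) k * b z) x = (x - x₀) k • ∇ b x + b x • bv k := by
  have h1 : HasFDerivAt (fun z : 𝔼 n => (z - x₀) k) (EuclideanSpace.proj (𝕜 := ℝ) k) x := by
    have h0 : HasFDerivAt (fun z : 𝔼 n => z - x₀) (ContinuousLinearMap.id ℝ (𝔼 n)) x :=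
      (hasFDerivAt_id x).sub_const x₀
    exact ((EuclideanSpace.proj (𝕜 := ℝ) k).hasFDerivAt.comp x h0)
  have h := (h1.mul (hb.differentiable (by simp) x).hasFDerivAt).fderiv
  ext i
  rw [PiLp.add_apply, PiLp.smul_apply, PiLp.smul_apply, gradient_apply, gradient_apply]
  have h' : fderiv ℝ (fun z => (z - x₀) k * b z) x
    = (x - x₀) k • fderiv ℝ b x + b x • EuclideanSpace.proj (𝕜 := ℝ) k := h
  rw [h']
  by_cases hik : k = i
  · subst hik; simp
  · simp [hik, Ne.symm hik]

/-- The weak gradient of the damped cutoff `η (1 + τ |G|²)^{-2}`. -/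
noncomputable def dampGrad (G : (𝔼 n) → 𝔼 n) (H : Fin n → (𝔼 n) → 𝔼 n) (η : (𝔼 n) → ℝ) (τ : ℝ)
    (x : 𝔼 n) : 𝔼 n :=
  ((1 + τ * ‖G x‖ ^ 2) ^ 2)⁻¹ • ∇ η x
    - (4 * τ * ((1 + τ * ‖G x‖ ^ 2) ^ 3)⁻¹ * η x) • hessAct H (G x) x

/-- The damped cutoff `η (1 + τ |G|²)^{-2}`. -/
noncomputable def dampCut (G : (𝔼 n) → 𝔼 n) (η : (𝔼 n) → ℝ) (τ : ℝ) (x : 𝔼 n) : ℝ :=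
  η x * ((1 + τ * ‖G x‖ ^ 2) ^ 2)⁻¹

/-- The integrand of the damped stability inequality. -/
noncomputable def dampIntegrand (G : (𝔼 n) → 𝔼 n) (H : Fin n → (𝔼 n) → 𝔼 n) (η : (𝔼 n) → ℝ)
    (x₀ : 𝔼 n) (τ : ℝ) (x : 𝔼 n) : ℝ :=
  ((areaElt (G x))⁻¹ + (areaElt (G x))⁻¹ ^ 3) *
      (dampCut G η τ x ^ 2 * (‖G x‖ ^ 2 + inner ℝ (G x) (hessAct H (x - x₀) x))
        + 2 * inner ℝ (x - x₀) (G x) * dampCut G η τ x * inner ℝ (G x) (dampGrad G H η τ x))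
    + inner ℝ (x - x₀) (G x) ^ 2 *
      inner ℝ (areaHess (G x) (dampGrad G H η τ x)) (dampGrad G H η τ x)

/-- The factor w^(-1) + w^(-3) is the derivative of w - 1/w with respect to w, divided by w; this is
why the last second-order term is an exact derivative. -/
lemma areaHess_self_add_flux (p : 𝔼 n) :
    areaHess p p + flux p = ((areaElt p)⁻¹ + (areaElt p)⁻¹ ^ 3) • p := by
  rw [areaHess_apply, flux, ← sub_smul, ← add_smul, real_inner_self_eq_norm_sq]
  congr 1
  have := areaElt_inv_sq_mul p
  have e : (areaElt p)⁻¹ ^ 3 * ‖p‖ ^ 2 = (areaElt p)⁻¹ * ((areaElt p)⁻¹ ^ 2 * ‖p‖ ^ 2) := by ring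
  rw [e, this]; ring

namespace StableSystem

variable {Ω : Opens (𝔼 n)} {f : ℝ → ℝ} {u : (𝔼 n) → ℝ} {G : (𝔼 n) → 𝔼 n}
  {H L : Fin n → (𝔼 n) → 𝔼 n}

lemma ae_symm (S : StableSystem Ω f u G H L) : ∀ᵐ x, ∀ i j, H i x j = H j x i :=
  ae_all_iff.2 fun i => ae_all_iff.2 fun j => S.symm i j

/-- The stability inequality tested with the damped multiple of `(x - x₀) · ∇u`. -/
lemma dampIntegrand_nonneg (S : StableSystem Ω f u G H L) {η : (𝔼 n) → ℝ} (hη : ContDiff ℝ ∞ η)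
    (hc : HasCompactSupport η) (hs : tsupport η ⊆ Ω) (x₀ : 𝔼 n) {τ : ℝ} (hτ : 0 < τ) :
    0 ≤ ∫ x, dampIntegrand G H η x₀ τ x := by
  have hsm : ∀ {b : (𝔼 n) → ℝ}, ContDiff ℝ ∞ b → ContDiff ℝ ∞ fun z => b z • (z - x₀) :=
    fun hb => hb.smul (contDiff_id.sub contDiff_const)
  have hcs : ∀ {b : (𝔼 n) → ℝ}, tsupport b ⊆ tsupport η →
      HasCompactSupport (fun z => b z • (z - x₀)) ∧
      tsupport (fun z => b z • (z - x₀)) ⊆ Ω := fun hb =>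
    ⟨hc.isCompact.of_isClosed_subset (isClosed_tsupport _) (tsupport_smul_subset'.trans hb),
      (tsupport_smul_subset'.trans hb).trans hs⟩
  set η2 : (𝔼 n) → ℝ := fun z => η z ^ 2 with hη2
  have hη2s : ContDiff ℝ ∞ η2 := hη.pow 2
  have hη2t : tsupport η2 ⊆ tsupport η :=
    closure_mono fun x hx h0 => hx (by simp [hη2, h0])
  set bk : Fin n → (𝔼 n) → ℝ := fun k z => (z - x₀) k * η2 z with hbk
  have hbks : ∀ k, ContDiff ℝ ∞ (bk k) := fun k =>
    ContDiff.mul ((EuclideanSpace.proj (𝕜 := ℝ) k).contDiff.comp (contDiff_id.sub contDiff_const))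
      hη2s
  have hbkt : ∀ k, tsupport (bk k) ⊆ tsupport η := fun k => by
    have : tsupport (bk k) ⊆ tsupport η2 := closure_mono fun x hx h0 => hx (by simp [hbk, h0])
    exact this.trans hη2t
  set a1 : (𝔼 n) → 𝔼 n := fun z => η z • (z - x₀) with ha1
  set a2 : (𝔼 n) → 𝔼 n := fun z => η2 z • (z - x₀) with ha2
  set ak : Fin n → (𝔼 n) → 𝔼 n := fun k z => bk k z • (z - x₀) with hak
  obtain ⟨c1, t1⟩ := hcs (b := η) le_rfl
  obtain ⟨c2, t2⟩ := hcs hη2t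
  -- Exponent 2 is used in the quadratic stability inequality and 4 = 2 + 2 in the linear equations,
  -- with η² in place of η, so that the f'(u) terms match exactly.
  have hT1 := S.isW12Test hτ le_rfl (hsm hη) c1 t1
  have hT2 := S.isW12Test hτ (show 2 ≤ 4 by norm_num) (hsm hη2s) c2 t2
  have hTk := fun k => S.isW12Test hτ (show 2 ≤ 4 by norm_num) (hsm (hbks k))
    (hcs (hbkt k)).1 (hcs (hbkt k)).2
  set D1 := testGrad G H a1 τ 2 with hD1
  set D2 := testGrad G H a2 τ 4 with hD2
  set Dk := fun k => testGrad G H (ak k) τ 4 with hDk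
  set ψ : (𝔼 n) → ℝ := fun x => inner ℝ (a2 x) (damp τ 4 (G x)) with hψ
  have q1 := S.stable_testGrad hτ le_rfl (hsm hη) c1 t1
  have q2 := S.integral_flux_testGrad hτ (show 2 ≤ 4 by norm_num) (hsm hη2s) c2 t2
  have qk := fun k => S.integral_areaHess_testGrad hτ (show 2 ≤ 4 by norm_num) (hsm (hbks k))
    (hcs (hbkt k)).1 (hcs (hbkt k)).2 k
  have ik : ∀ k, Integrable fun x => inner ℝ (areaHess (G x) (H k x)) (Dk k x) := fun k =>
    (hTk k).integrable_inner fun K h1 h2 => S.memLp_areaHess k h1 h2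
  have i2 : Integrable fun x => inner ℝ (flux (G x)) (D2 x) :=
    hT2.integrable_inner fun K _ h2 => S.memLp_flux h2
  have i3 : Integrable fun x => f (u x) * ψ x :=
    hT2.integrable_mul (S.meas_test hτ.le 4 (hsm hη2s).continuous) S.locInt_f
  have i1 : Integrable fun x => inner ℝ (areaHess (G x) (D1 x)) (D1 x) := by
    refine Integrable.mono' (hT1.memLp.integrable_norm_pow two_ne_zero)
      ((S.meas_areaHess hT1.memLp.aestronglyMeasurable).inner hT1.memLp.aestronglyMeasurable)
      (Eventually.of_forall fun x => ?_)
    have := abs_areaHess_quad_sub_le (G x) (D1 x) 0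
    simpa [pow_two] using this
  -- summing the linearized equations
  have hsum : ∫ x, ∑ k, inner ℝ (areaHess (G x) (H k x)) (Dk k x)
      = ∫ x, deriv f (u x) * inner ℝ (a1 x) (damp τ 2 (G x)) ^ 2 := by
    rw [integral_finsetSum _ fun k _ => ik k]
    have hint : ∀ k, Integrable fun x =>
        deriv f (u x) * (G x k * inner ℝ (ak k x) (damp τ 4 (G x))) := by
      intro k
      obtain ⟨B, hB⟩ := (hcs (hbkt k)).1.exists_bound_of_continuous (hsm (hbks k)).continuous
      have hm : AEStronglyMeasurable (fun x => G x k * inner ℝ (ak k x) (damp τ 4 (G x))) volume :=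
        ((EuclideanSpace.proj (𝕜 := ℝ) k).continuous.comp_aestronglyMeasurable S.meas_G).mul
          (S.meas_test hτ.le 4 (hsm (hbks k)).continuous)
      have hb : ∀ x, ‖G x k * inner ℝ (ak k x) (damp τ 4 (G x))‖ ≤ B * τ⁻¹ := by
        intro x
        have hB0 : 0 ≤ B := (norm_nonneg _).trans (hB 0)
        rw [norm_mul]
        calc ‖G x k‖ * ‖inner ℝ (ak k x) (damp τ 4 (G x))‖
            ≤ ‖G x‖ * (B * ‖damp τ 4 (G x)‖) := by
              refine mul_le_mul (PiLp.norm_apply_le _ k) ?_ (norm_nonneg _) (norm_nonneg _)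
              exact (norm_inner_le_norm _ _).trans
                (mul_le_mul_of_nonneg_right (hB x) (norm_nonneg _))
          _ = B * (‖G x‖ * ‖damp τ 4 (G x)‖) := by ring
          _ ≤ B * τ⁻¹ := by
            gcongr; exact norm_sq_mul_dampDen_inv_le hτ (by norm_num) _
      have : IntegrableOn (fun x => deriv f (u x) * (G x k * inner ℝ (ak k x) (damp τ 4 (G x))))
          (tsupport η) := (locallyIntegrableOn_opens_iff.1 S.locInt_deriv _ hs hc).mul_bdd
            hm.restrict (Eventually.of_forall hb)
      refine (integrableOn_iff_integrable_of_support_subset fun x hx => ?_).1 this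
      by_contra h'
      refine hx ?_
      simp only [hak, hbk, hη2, image_eq_zero_of_notMem_tsupport h']
      simp
    rw [Finset.sum_congr rfl fun k _ => qk k, ← integral_finsetSum _ fun k _ => hint k]
    refine integral_congr_ae (Eventually.of_forall fun x => ?_)
    simp only
    rw [← Finset.mul_sum]
    congr 1
    have e1 : ∀ k, G x k * inner ℝ (ak k x) (damp τ 4 (G x))
        = ((x - x₀) k * G x k) * (η2 x * (((1 + τ * ‖G x‖ ^ 2) ^ 4)⁻¹ *
          inner ℝ (x - x₀) (G x))) := by
      intro k
      simp only [hak, hbk, damp, real_inner_smul_left, real_inner_smul_right]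
      ring
    rw [Finset.sum_congr rfl fun k _ => e1 k, ← Finset.sum_mul, ← inner_eq_sum]
    simp only [ha1, hη2, damp, real_inner_smul_left, real_inner_smul_right]
    have : ((1 + τ * ‖G x‖ ^ 2) ^ 4)⁻¹ = (((1 + τ * ‖G x‖ ^ 2) ^ 2)⁻¹) ^ 2 := by
      rw [← inv_pow, ← inv_pow, ← pow_mul]
    rw [this]; ring
  -- the pointwise identity
  have hae : ∀ᵐ x, dampIntegrand G H η x₀ τ x = inner ℝ (areaHess (G x) (D1 x)) (D1 x)
      - ∑ k, inner ℝ (areaHess (G x) (H k x)) (Dk k x)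
      + (inner ℝ (flux (G x)) (D2 x) - f (u x) * ψ x) := by
    filter_upwards [S.ae_symm, S.ae_eq] with x hx hfx
    set p := G x with hp
    set y := x - x₀ with hy
    set c := inner ℝ y p with hcdef
    set σ := 1 + τ * ‖p‖ ^ 2 with hσ
    have hσ0 : σ ≠ 0 := by have := one_le_dampDen hτ.le p; positivity
    set X := p + hessAct H y x with hX
    set ζ := dampCut G η τ x with hζ
    set Z := dampGrad G H η τ x with hZ
    have hζ' : ζ = η x * (σ ^ 2)⁻¹ := rfl
    have hZ' : Z = (σ ^ 2)⁻¹ • ∇ η x - (4 * τ * (σ ^ 3)⁻¹ * η x) • hessAct H p x := rfl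
    -- Product rule: `X` is the gradient of c = y·∇u and `Z` that of the damped cutoff ζ. The test
    -- functions are ζc in the stability inequality and ψ = ζ²c in the equation.
    have eD1 : D1 x = ζ • X + c • Z := by
      rw [hD1, ha1, testGrad_smul_sub hx x₀ hη hτ.le 2, hζ', hZ']
      simp only [smul_add, smul_sub, smul_smul]
      push_cast
      match_scalars <;> field_simp <;> ring
    have eD2 : D2 x = ζ ^ 2 • X + (2 * c * ζ) • Z := by
      rw [hD2, ha2, testGrad_smul_sub hx x₀ hη2s hτ.le 4, hζ', hZ', gradient_sq hη]
      simp only [smul_add, smul_sub, smul_smul, hη2]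
      push_cast
      match_scalars <;> field_simp <;> ring
    have eψ : ψ x = ζ ^ 2 * c := by
      simp only [hψ, ha2, damp, real_inner_smul_left, real_inner_smul_right, hη2, hζ']
      have : (σ ^ 4)⁻¹ = ((σ ^ 2)⁻¹) ^ 2 := by rw [← inv_pow, ← inv_pow, ← pow_mul]
      change (σ ^ 4)⁻¹ * (η x ^ 2 * c) = _
      rw [this]; ring
    -- The k-th linearized equation is tested with yₖψ.
    have eDk : ∀ k, Dk k x = y k • D2 x + ψ x • bv k := by
      intro k
      have e1 : ψ x = (σ ^ 4)⁻¹ * (η2 x * c) := by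
        simp only [hψ, ha2, damp, real_inner_smul_left, real_inner_smul_right, hcdef, hσ, hp, hy]
      have e2 : D2 x = (σ ^ 4)⁻¹ • (η2 x • X + c • ∇ η2 x)
          - (2 * (4 : ℕ) * τ * (σ ^ (4 + 1))⁻¹ * (η2 x * c)) • hessAct H p x :=
        testGrad_smul_sub hx x₀ hη2s hτ.le 4
      have e3 : Dk k x = (σ ^ 4)⁻¹ • ((y k * η2 x) • X + c • ∇ (bk k) x)
          - (2 * (4 : ℕ) * τ * (σ ^ (4 + 1))⁻¹ * ((y k * η2 x) * c)) • hessAct H p x :=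
        testGrad_smul_sub hx x₀ (hbks k) hτ.le 4
      have e4 : ∇ (bk k) x = y k • ∇ η2 x + η2 x • bv k := gradient_coord_mul hη2s x₀ x k
      rw [e3, e2, e4, e1]
      simp only [smul_add, smul_sub, smul_smul]
      match_scalars <;> ring
    have hsupp : f (u x) * ψ x = -∑ k, areaHess p (H k x) k * ψ x := by
      by_cases hxΩ : x ∈ Ω
      · rw [hfx hxΩ, neg_mul, Finset.sum_mul]
      · have : η x = 0 := image_eq_zero_of_notMem_tsupport fun h => hxΩ (hs h)
        have : ψ x = 0 := by rw [eψ, hζ', this]; ring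
        simp [this]
    -- The terms yₖ ∂ₖG add up to D²u y, and the terms with eₖ give ψ times the divergence of the
    -- flux, that is, -f(u)ψ.
    have eS : ∑ k, inner ℝ (areaHess p (H k x)) (Dk k x)
        = inner ℝ (areaHess p (hessAct H y x)) (D2 x) + ∑ k, areaHess p (H k x) k * ψ x := by
      rw [hessAct, map_sum, sum_inner, ← Finset.sum_add_distrib]
      refine Finset.sum_congr rfl fun k _ => ?_
      rw [eDk, inner_add_right, real_inner_smul_right, real_inner_smul_right, map_smul,
        real_inner_smul_left, EuclideanSpace.inner_single_right]
      simp only [starRingEnd_apply, star_trivial]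
      ring
    rw [eS, hsupp]
    have eA : inner ℝ (areaHess p (D1 x)) (D1 x)
        = inner ℝ (areaHess p X) (D2 x) + c ^ 2 * inner ℝ (areaHess p Z) Z := by
      rw [eD1, eD2]
      simp only [map_add, map_smul, inner_add_left, inner_add_right, real_inner_smul_left,
        real_inner_smul_right]
      rw [inner_areaHess_comm p Z X]
      ring
    rw [eA]
    -- Since X - D²u y = p, the Hessian of u drops out of the left factor and only Ap + flux(p), a
    -- multiple of p, is paired with `D2`.
    have eF : inner ℝ (areaHess p X) (D2 x) - inner ℝ (areaHess p (hessAct H y x)) (D2 x)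
        + inner ℝ (flux p) (D2 x)
        = ((areaElt p)⁻¹ + (areaElt p)⁻¹ ^ 3) * inner ℝ p (D2 x) := by
      rw [hX, map_add, inner_add_left, add_sub_cancel_right, ← inner_add_left,
        areaHess_self_add_flux, real_inner_smul_left]
    have e3 : inner ℝ p (D2 x) = ζ ^ 2 * (‖p‖ ^ 2 + inner ℝ p (hessAct H y x))
        + 2 * c * ζ * inner ℝ p Z := by
      rw [eD2, inner_add_right, real_inner_smul_right, real_inner_smul_right, hX, inner_add_right,
        real_inner_self_eq_norm_sq]
    have e4 : dampIntegrand G H η x₀ τ x = ((areaElt p)⁻¹ + (areaElt p)⁻¹ ^ 3) *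
        (ζ ^ 2 * (‖p‖ ^ 2 + inner ℝ p (hessAct H y x)) + 2 * c * ζ * inner ℝ p Z)
        + c ^ 2 * inner ℝ (areaHess p Z) Z := rfl
    rw [e4, ← e3, ← eF]
    ring
  have j1 : Integrable fun x => inner ℝ (areaHess (G x) (D1 x)) (D1 x)
      - ∑ k, inner ℝ (areaHess (G x) (H k x)) (Dk k x) :=
    i1.sub (integrable_finsetSum _ fun k _ => ik k)
  have j2 : Integrable fun x => inner ℝ (flux (G x)) (D2 x) - f (u x) * ψ x := i2.sub i3
  rw [integral_congr_ae hae, integral_add j1 j2, integral_sub i1 (integrable_finsetSum _ fun k _ => ik k), integral_sub i2 i3, hsum,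
    q2]
  linarith

end StableSystem

end DampedInequality

end MeanCurvature

open Filter Set Metric ContinuousLinearMap
open scoped Topology ContDiff Convolution

namespace MeanCurvature

local notation "𝔼" n => EuclideanSpace ℝ (Fin n)

/-! ### Removal of the damping and integration by parts of the second-order term. -/

section LimitInequality

variable {n : ℕ}

lemma norm_hessAct_le (H : Fin n → (𝔼 n) → 𝔼 n) (v x : 𝔼 n) :
    ‖hessAct H v x‖ ≤ ‖v‖ * ∑ i, ‖H i x‖ := by
  rw [hessAct, Finset.mul_sum]
  refine (norm_sum_le _ _).trans (Finset.sum_le_sum fun i _ => ?_)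
  rw [norm_smul]
  exact mul_le_mul_of_nonneg_right (PiLp.norm_apply_le v i) (norm_nonneg _)

lemma two_mul_inner_areaHess_le (p q r : 𝔼 n) : 2 * inner ℝ (areaHess p q) r
    ≤ inner ℝ (areaHess p q) q + inner ℝ (areaHess p r) r := by
  have h := inner_areaHess_self_nonneg p (q - r)
  rw [map_sub, inner_sub_left, inner_sub_right, inner_sub_right, inner_areaHess_comm p r q] at h
  linarith

lemma inner_areaHess_sub_le (p q r : 𝔼 n) : inner ℝ (areaHess p (q - r)) (q - r)
    ≤ 2 * (inner ℝ (areaHess p q) q + inner ℝ (areaHess p r) r) := by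
  have h := two_mul_inner_areaHess_le p q (-r)
  rw [map_neg, inner_neg_left, inner_neg_right, inner_neg_right] at h
  rw [map_sub, inner_sub_left, inner_sub_right, inner_sub_right, inner_areaHess_comm p r q]
  linarith

lemma inner_areaHess_sum_le {ι : Type*} (s : Finset ι) (p : 𝔼 n) (v : ι → 𝔼 n) :
    inner ℝ (areaHess p (∑ i ∈ s, v i)) (∑ i ∈ s, v i)
      ≤ s.card * ∑ i ∈ s, inner ℝ (areaHess p (v i)) (v i) := by
  rw [map_sum, sum_inner]
  simp only [inner_sum]
  have h : ∑ i ∈ s, ∑ j ∈ s, inner ℝ (areaHess p (v i)) (v j)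
      ≤ ∑ i ∈ s, ∑ j ∈ s, (inner ℝ (areaHess p (v i)) (v i)
        + inner ℝ (areaHess p (v j)) (v j)) / 2 :=
    Finset.sum_le_sum fun i _ => Finset.sum_le_sum fun j _ => by
      linarith [two_mul_inner_areaHess_le p (v i) (v j)]
  refine h.trans (le_of_eq ?_)
  simp only [add_div, Finset.sum_add_distrib, Finset.sum_const, ← Finset.sum_div, nsmul_eq_mul,
    ← Finset.mul_sum]
  ring

lemma inner_areaHess_hessAct_le (H : Fin n → (𝔼 n) → 𝔼 n) (p v x : 𝔼 n) :
    inner ℝ (areaHess p (hessAct H v x)) (hessAct H v x)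
      ≤ n * (‖v‖ ^ 2 * ∑ i, inner ℝ (areaHess p (H i x)) (H i x)) := by
  refine (inner_areaHess_sum_le Finset.univ p fun i => v i • H i x).trans ?_
  simp only [Finset.card_fin, Finset.mul_sum]
  refine Finset.sum_le_sum fun i _ => mul_le_mul_of_nonneg_left ?_ (Nat.cast_nonneg n)
  rw [map_smul, real_inner_smul_left, real_inner_smul_right, ← mul_assoc, ← pow_two]
  refine mul_le_mul_of_nonneg_right ?_ (inner_areaHess_self_nonneg _ _)
  rw [← sq_abs]
  exact pow_le_pow_left₀ (abs_nonneg _) (PiLp.norm_apply_le v i) 2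

/-- The majorant is independent of τ and uses only locally integrable quantities: |∇u|, |D²u| and
the energy. -/
lemma abs_dampIntegrand_le {G : (𝔼 n) → 𝔼 n} {H : Fin n → (𝔼 n) → 𝔼 n} {η : (𝔼 n) → ℝ}
    {x₀ x : 𝔼 n} {τ M : ℝ} (hτ : 0 ≤ τ) (h1 : |η x| ≤ M) (h2 : ‖∇ η x‖ ≤ M)
    (h3 : ‖x - x₀‖ ≤ M) :
    |dampIntegrand G H η x₀ τ x| ≤ (2 * M ^ 2 + 4 * M ^ 3 + 2 * M ^ 4) * ‖G x‖
      + 18 * M ^ 3 * ∑ i, ‖H i x‖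
      + 32 * n * M ^ 4 * ∑ i, inner ℝ (areaHess (G x) (H i x)) (H i x) := by
  have hM : 0 ≤ M := (abs_nonneg _).trans h1
  set p := G x with hp
  set h := ∑ i, ‖H i x‖ with hh
  set e := ∑ i, inner ℝ (areaHess p (H i x)) (H i x) with he
  set σ := 1 + τ * ‖p‖ ^ 2 with hσ
  have hσ1 : 1 ≤ σ := one_le_dampDen hτ p
  have hσ0 : 0 < σ := by positivity
  have hh0 : 0 ≤ h := Finset.sum_nonneg fun i _ => norm_nonneg _
  have he0 : 0 ≤ e := Finset.sum_nonneg fun i _ => inner_areaHess_self_nonneg _ _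
  set W := (areaElt p)⁻¹ with hW
  have hW0 : 0 < W := areaElt_inv_pos p
  have hW1 : W ≤ 1 := areaElt_inv_le_one p
  have hWp : W * ‖p‖ ≤ 1 := by
    rw [hW, inv_mul_le_iff₀ (areaElt_pos p), mul_one]; exact norm_le_areaElt p
  have hW3 : W + W ^ 3 ≤ 2 * W := by nlinarith [pow_le_one₀ hW0.le hW1 (n := 2)]
  set ζ := dampCut G η τ x with hζ
  have hs2 : (σ ^ 2)⁻¹ ≤ 1 := inv_le_one_of_one_le₀ (one_le_pow₀ hσ1)
  have hζM : |ζ| ≤ M := by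
    have : ζ = η x * (σ ^ 2)⁻¹ := rfl
    rw [this, abs_mul, abs_of_pos (a := (σ ^ 2)⁻¹) (by positivity)]
    calc |η x| * (σ ^ 2)⁻¹ ≤ M * 1 := by gcongr
      _ = M := mul_one M
  set κ := 4 * τ * (σ ^ 3)⁻¹ * η x with hκ
  set Z := dampGrad G H η τ x with hZ
  have hZ' : Z = (σ ^ 2)⁻¹ • ∇ η x - κ • hessAct H p x := rfl
  -- The gradient of the damping brings in D²u p, and the factor y·∇u another |p|. Both powers are
  -- absorbed by κ, uniformly in τ.
  have hκp : |κ| * ‖p‖ ^ 2 ≤ 4 * M := by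
    rw [hκ, abs_mul, abs_of_nonneg (a := 4 * τ * (σ ^ 3)⁻¹) (by positivity)]
    have : τ * ‖p‖ ^ 2 * (σ ^ 3)⁻¹ ≤ 1 := by
      rw [← div_eq_mul_inv, div_le_one (by positivity)]
      calc τ * ‖p‖ ^ 2 ≤ σ := by rw [hσ]; linarith
        _ ≤ σ ^ 3 := le_self_pow₀ hσ1 (by norm_num)
    calc 4 * τ * (σ ^ 3)⁻¹ * |η x| * ‖p‖ ^ 2 = 4 * (τ * ‖p‖ ^ 2 * (σ ^ 3)⁻¹) * |η x| := by ring
      _ ≤ 4 * 1 * M := by gcongr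
      _ = 4 * M := by ring
  set c := inner ℝ (x - x₀) p with hc
  have hcM : |c| ≤ M * ‖p‖ := (abs_real_inner_le_norm _ _).trans (by gcongr)
  have hpS : |inner ℝ p (hessAct H (x - x₀) x)| ≤ ‖p‖ * (M * h) := by
    refine (abs_real_inner_le_norm _ _).trans ?_
    gcongr
    exact (norm_hessAct_le H _ x).trans (by gcongr)
  have hz1 : ‖(σ ^ 2)⁻¹ • ∇ η x‖ ≤ M := by
    rw [norm_smul, Real.norm_of_nonneg (by positivity)]
    calc (σ ^ 2)⁻¹ * ‖∇ η x‖ ≤ 1 * M := by gcongr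
      _ = M := one_mul M
  have hpZ : |inner ℝ p Z| ≤ M * ‖p‖ + 4 * M * h := by
    refine (abs_real_inner_le_norm _ _).trans ?_
    have h5 : ‖κ • hessAct H p x‖ ≤ |κ| * (‖p‖ * h) := by
      rw [norm_smul, Real.norm_eq_abs]
      gcongr
      exact norm_hessAct_le H p x
    calc ‖p‖ * ‖Z‖ ≤ ‖p‖ * (M + |κ| * (‖p‖ * h)) := by
          gcongr; rw [hZ']; exact (norm_sub_le _ _).trans (add_le_add hz1 h5)
      _ = M * ‖p‖ + (|κ| * ‖p‖ ^ 2) * h := by ring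
      _ ≤ M * ‖p‖ + 4 * M * h := by gcongr
  have hq : c ^ 2 * inner ℝ (areaHess p Z) Z ≤ 2 * M ^ 4 * ‖p‖ + 32 * n * M ^ 4 * e := by
    have a1 : inner ℝ (areaHess p ((σ ^ 2)⁻¹ • ∇ η x)) ((σ ^ 2)⁻¹ • ∇ η x) ≤ W * M ^ 2 :=
      (inner_areaHess_self_le _ _).trans (by gcongr)
    have a2 : inner ℝ (areaHess p (κ • hessAct H p x)) (κ • hessAct H p x)
        ≤ |κ| ^ 2 * (n * (‖p‖ ^ 2 * e)) := by
      rw [map_smul, real_inner_smul_left, real_inner_smul_right, ← mul_assoc, ← pow_two, sq_abs]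
      gcongr
      exact inner_areaHess_hessAct_le H p p x
    have a3 : inner ℝ (areaHess p Z) Z ≤ 2 * (W * M ^ 2 + |κ| ^ 2 * (n * (‖p‖ ^ 2 * e))) := by
      rw [hZ']
      exact (inner_areaHess_sub_le _ _ _).trans (by gcongr)
    have a4 : c ^ 2 ≤ M ^ 2 * ‖p‖ ^ 2 := by
      rw [← sq_abs, ← mul_pow]; exact pow_le_pow_left₀ (abs_nonneg _) hcM 2
    calc c ^ 2 * inner ℝ (areaHess p Z) Z
        ≤ M ^ 2 * ‖p‖ ^ 2 * (2 * (W * M ^ 2 + |κ| ^ 2 * (n * (‖p‖ ^ 2 * e)))) :=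
          mul_le_mul a4 a3 (inner_areaHess_self_nonneg _ _) (by positivity)
      _ = 2 * M ^ 4 * ‖p‖ * (W * ‖p‖) + 2 * M ^ 2 * n * (|κ| * ‖p‖ ^ 2) ^ 2 * e := by ring
      _ ≤ 2 * M ^ 4 * ‖p‖ * 1 + 2 * M ^ 2 * n * (4 * M) ^ 2 * e := by gcongr
      _ = _ := by ring
  have hq0 : 0 ≤ c ^ 2 * inner ℝ (areaHess p Z) Z :=
    mul_nonneg (sq_nonneg _) (inner_areaHess_self_nonneg _ _)
  have hlin : |(W + W ^ 3) * (ζ ^ 2 * (‖p‖ ^ 2 + inner ℝ p (hessAct H (x - x₀) x))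
      + 2 * c * ζ * inner ℝ p Z)| ≤ (2 * M ^ 2 + 4 * M ^ 3) * ‖p‖ + 18 * M ^ 3 * h := by
    rw [abs_mul, abs_of_pos (a := W + W ^ 3) (by positivity)]
    have b1 : |ζ ^ 2 * (‖p‖ ^ 2 + inner ℝ p (hessAct H (x - x₀) x))|
        ≤ M ^ 2 * (‖p‖ ^ 2 + ‖p‖ * (M * h)) := by
      rw [abs_mul, abs_pow]
      gcongr
      refine (abs_add_le _ _).trans ?_
      rw [abs_of_nonneg (a := ‖p‖ ^ 2) (by positivity)]
      gcongr
    have b2 : |2 * c * ζ * inner ℝ p Z| ≤ 2 * (M * ‖p‖) * M * (M * ‖p‖ + 4 * M * h) := by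
      rw [abs_mul, abs_mul, abs_mul, abs_two]
      gcongr
    calc (W + W ^ 3) * |ζ ^ 2 * (‖p‖ ^ 2 + inner ℝ p (hessAct H (x - x₀) x))
          + 2 * c * ζ * inner ℝ p Z|
        ≤ 2 * W * (M ^ 2 * (‖p‖ ^ 2 + ‖p‖ * (M * h))
          + 2 * (M * ‖p‖) * M * (M * ‖p‖ + 4 * M * h)) := by
          gcongr
          exact (abs_add_le _ _).trans (add_le_add b1 b2)
      _ = (W * ‖p‖) * ((2 * M ^ 2 + 4 * M ^ 3) * ‖p‖ + 18 * M ^ 3 * h) := by ring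
      _ ≤ 1 * ((2 * M ^ 2 + 4 * M ^ 3) * ‖p‖ + 18 * M ^ 3 * h) := by gcongr
      _ = _ := one_mul _
  have hdef : dampIntegrand G H η x₀ τ x = (W + W ^ 3) * (ζ ^ 2 * (‖p‖ ^ 2
      + inner ℝ p (hessAct H (x - x₀) x)) + 2 * c * ζ * inner ℝ p Z)
      + c ^ 2 * inner ℝ (areaHess p Z) Z := rfl
  rw [hdef]
  refine (abs_add_le _ _).trans ?_
  rw [abs_of_nonneg hq0]
  linarith

lemma dampIntegrand_eq_zero {G : (𝔼 n) → 𝔼 n} {H : Fin n → (𝔼 n) → 𝔼 n} {η : (𝔼 n) → ℝ}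
    {x₀ x : 𝔼 n} {τ : ℝ} (hx : x ∉ tsupport η) : dampIntegrand G H η x₀ τ x = 0 := by
  simp [dampIntegrand, dampCut, dampGrad, image_eq_zero_of_notMem_tsupport hx,
    gradient_eq_zero_of_notMem_tsupport hx]

lemma tendsto_dampIntegrand (G : (𝔼 n) → 𝔼 n) (H : Fin n → (𝔼 n) → 𝔼 n) (η : (𝔼 n) → ℝ)
    (x₀ x : 𝔼 n) : Tendsto (fun τ => dampIntegrand G H η x₀ τ x) (𝓝[>] 0)
      (𝓝 (dampIntegrand G H η x₀ 0 x)) := by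
  have hd : ∀ m : ℕ, ContinuousAt (fun τ : ℝ => ((1 + τ * ‖G x‖ ^ 2) ^ m)⁻¹) 0 := fun m =>
    ContinuousAt.inv₀ (by fun_prop) (by simp)
  have h1 : ContinuousAt (fun τ => dampCut G η τ x) 0 := continuousAt_const.mul (hd 2)
  have h2 : ContinuousAt (fun τ => dampGrad G H η τ x) 0 :=
    ((hd 2).smul continuousAt_const).sub
      ((((continuousAt_const.mul continuousAt_id).mul (hd 3)).mul continuousAt_const).smul
        continuousAt_const)
  have h3 : ContinuousAt (fun τ => areaHess (G x) (dampGrad G H η τ x)) 0 :=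
    (areaHess (G x)).continuous.continuousAt.comp h2
  have h4 : ContinuousAt (fun τ => dampIntegrand G H η x₀ τ x) 0 := by
    refine ContinuousAt.add (continuousAt_const.mul (((h1.pow 2).mul continuousAt_const).add
      ((continuousAt_const.mul h1).mul (ContinuousAt.inner (𝕜 := ℝ) continuousAt_const h2)))) ?_
    exact continuousAt_const.mul (h3.inner (𝕜 := ℝ) h2)
  exact h4.tendsto.mono_left nhdsWithin_le_nhds

/-- The integrand of the stability inequality tested with `η (x - x₀) · ∇u`, after integration by
parts. -/
noncomputable def stabIntegrand (G : (𝔼 n) → 𝔼 n) (η : (𝔼 n) → ℝ) (x₀ x : 𝔼 n) : ℝ :=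
  ((areaElt (G x))⁻¹ + (areaElt (G x))⁻¹ ^ 3) *
      (η x ^ 2 * ‖G x‖ ^ 2 + 2 * inner ℝ (x - x₀) (G x) * η x * inner ℝ (G x) (∇ η x))
    - areaGap (G x) * (n * η x ^ 2 + 2 * η x * inner ℝ (x - x₀) (∇ η x))
    + inner ℝ (x - x₀) (G x) ^ 2 * inner ℝ (areaHess (G x) (∇ η x)) (∇ η x)

namespace StableSystem

variable {Ω : Opens (𝔼 n)} {f : ℝ → ℝ} {u : (𝔼 n) → ℝ} {G : (𝔼 n) → 𝔼 n}
  {H L : Fin n → (𝔼 n) → 𝔼 n}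

lemma meas_hessAct (S : StableSystem Ω f u G H L) {v : (𝔼 n) → 𝔼 n}
    (hv : AEStronglyMeasurable v volume) :
    AEStronglyMeasurable (fun x => hessAct H (v x) x) volume := by
  refine Finset.aestronglyMeasurable_fun_sum Finset.univ fun i _ => ?_
  have h := (EuclideanSpace.proj (𝕜 := ℝ) i).continuous.comp_aestronglyMeasurable hv
  exact h.smul (S.meas_H i)

lemma meas_dampIntegrand (S : StableSystem Ω f u G H L) {η : (𝔼 n) → ℝ} (hη : ContDiff ℝ ∞ η)
    (x₀ : 𝔼 n) {τ : ℝ} (hτ : 0 ≤ τ) :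
    AEStronglyMeasurable (dampIntegrand G H η x₀ τ) volume := by
  have hd : ∀ m : ℕ, AEStronglyMeasurable (fun x => ((1 + τ * ‖G x‖ ^ 2) ^ m)⁻¹) volume := by
    intro m
    have hc : Continuous fun p : 𝔼 n => ((1 + τ * ‖p‖ ^ 2) ^ m)⁻¹ :=
      Continuous.inv₀ (by fun_prop) fun p => by have := one_le_dampDen hτ p; positivity
    exact hc.comp_aestronglyMeasurable S.meas_G
  have hη0 := hη.continuous.aestronglyMeasurable (μ := (volume : Measure (𝔼 n)))
  have hy : AEStronglyMeasurable (fun x : 𝔼 n => x - x₀) volume :=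
    (continuous_id.sub continuous_const).aestronglyMeasurable
  have hg : AEStronglyMeasurable (fun x => ∇ η x) volume :=
    (continuous_gradient hη).aestronglyMeasurable
  have hw : AEStronglyMeasurable (fun x => (areaElt (G x))⁻¹) volume :=
    contDiff_areaElt_inv.continuous.comp_aestronglyMeasurable S.meas_G
  have h1 : AEStronglyMeasurable (fun x => dampCut G η τ x) volume := hη0.mul (hd 2)
  have h2 : AEStronglyMeasurable (fun x => dampGrad G H η τ x) volume :=
    ((hd 2).smul hg).sub ((((hd 3).const_mul (4 * τ)).mul hη0).smul (S.meas_hessAct S.meas_G))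
  have hc := hy.inner (𝕜 := ℝ) S.meas_G
  have hq := (S.meas_areaHess h2).inner (𝕜 := ℝ) h2
  have hA := (h1.pow 2).mul ((S.meas_G.norm.pow 2).add (S.meas_G.inner (𝕜 := ℝ) (S.meas_hessAct hy)))
  have hB := ((hc.const_mul 2).mul h1).mul (S.meas_G.inner (𝕜 := ℝ) h2)
  exact ((hw.add (hw.pow 3)).mul (hA.add hB)).add ((hc.pow 2).mul hq)

/-- The stability inequality tested with `η (x - x₀) · ∇u`. -/
lemma dampIntegrand_zero_nonneg (S : StableSystem Ω f u G H L) {η : (𝔼 n) → ℝ}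
    (hη : ContDiff ℝ ∞ η) (hc : HasCompactSupport η) (hs : tsupport η ⊆ Ω) (x₀ : 𝔼 n) :
    Integrable (dampIntegrand G H η x₀ 0) ∧ 0 ≤ ∫ x, dampIntegrand G H η x₀ 0 x := by
  obtain ⟨M₁, hM₁⟩ := hc.exists_bound_of_continuous hη.continuous
  obtain ⟨M₂, hM₂⟩ := hc.isCompact.exists_bound_of_continuousOn
    (continuous_gradient hη).continuousOn
  obtain ⟨M₃, hM₃⟩ := hc.isCompact.exists_bound_of_continuousOn
    (f := fun x => x - x₀) (continuous_id.sub continuous_const).continuousOn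
  set M := max M₁ (max M₂ M₃) with hM
  set b : (𝔼 n) → ℝ := (tsupport η).indicator fun x =>
    (2 * M ^ 2 + 4 * M ^ 3 + 2 * M ^ 4) * ‖G x‖ + 18 * M ^ 3 * ∑ i, ‖H i x‖
      + 32 * n * M ^ 4 * ∑ i, inner ℝ (areaHess (G x) (H i x)) (H i x) with hb
  have hbound : ∀ τ : ℝ, 0 ≤ τ → ∀ x, ‖dampIntegrand G H η x₀ τ x‖ ≤ b x := by
    intro τ hτ x
    by_cases hx : x ∈ tsupport η
    · rw [hb, indicator_of_mem hx]
      exact abs_dampIntegrand_le hτ ((hM₁ x).trans (le_max_left _ _))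
        ((hM₂ x hx).trans ((le_max_left _ _).trans (le_max_right _ _)))
        ((hM₃ x hx).trans ((le_max_right _ _).trans (le_max_right _ _)))
    · rw [hb, indicator_of_notMem hx, dampIntegrand_eq_zero hx, norm_zero]
  have hbi : Integrable b := by
    rw [hb, integrable_indicator_iff (isClosed_tsupport η).measurableSet]
    refine Integrable.add (Integrable.add ?_ ?_) ?_
    · by_cases hn : Nonempty (Fin n)
      · obtain ⟨i⟩ := hn
        exact ((locallyIntegrableOn_opens_iff.1 (S.weak_G i).locInt _ hs hc).norm).const_mul _
      · have : ∀ x, G x = 0 := fun x => by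
          ext i; exact (hn ⟨i⟩).elim
        simp [this]
    · exact (integrable_finsetSum _ fun i _ =>
        (locallyIntegrableOn_opens_iff.1 (S.weak_H i).locInt _ hs hc).norm).const_mul _
    · exact (integrable_finsetSum _ fun i _ =>
        locallyIntegrableOn_opens_iff.1 (S.locInt_energy i) _ hs hc).const_mul _
  refine ⟨hbi.mono' (S.meas_dampIntegrand hη x₀ le_rfl)
    (Eventually.of_forall (hbound 0 le_rfl)), ?_⟩
  have hlim : Tendsto (fun τ => ∫ x, dampIntegrand G H η x₀ τ x) (𝓝[>] 0)
      (𝓝 (∫ x, dampIntegrand G H η x₀ 0 x)) := by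
    refine tendsto_integral_filter_of_dominated_convergence b ?_ ?_ hbi
      (Eventually.of_forall fun x => tendsto_dampIntegrand G H η x₀ x)
    · exact eventually_mem_nhdsWithin.mono fun τ hτ => S.meas_dampIntegrand hη x₀ (le_of_lt hτ)
    · exact eventually_mem_nhdsWithin.mono fun τ hτ =>
        Eventually.of_forall (hbound τ (le_of_lt hτ))
  exact ge_of_tendsto hlim (eventually_mem_nhdsWithin.mono fun τ hτ =>
    S.dampIntegrand_nonneg hη hc hs x₀ hτ)

/-- Integration by parts of the second-order term. -/
lemma integral_areaGap (S : StableSystem Ω f u G H L) {η : (𝔼 n) → ℝ}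
    (hη : ContDiff ℝ ∞ η) (hc : HasCompactSupport η) (hs : tsupport η ⊆ Ω) (x₀ : 𝔼 n) :
    (Integrable fun x => ((areaElt (G x))⁻¹ + (areaElt (G x))⁻¹ ^ 3) *
        (η x ^ 2 * inner ℝ (G x) (hessAct H (x - x₀) x))) ∧
    (Integrable fun x => areaGap (G x) * (n * η x ^ 2 + 2 * η x * inner ℝ (x - x₀) (∇ η x))) ∧
    ∫ x, ((areaElt (G x))⁻¹ + (areaElt (G x))⁻¹ ^ 3) *
        (η x ^ 2 * inner ℝ (G x) (hessAct H (x - x₀) x))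
      = -∫ x, areaGap (G x) * (n * η x ^ 2 + 2 * η x * inner ℝ (x - x₀) (∇ η x)) := by
  set η2 : (𝔼 n) → ℝ := fun z => η z ^ 2 with hη2
  have hη2s : ContDiff ℝ ∞ η2 := hη.pow 2
  have hη2t : tsupport η2 ⊆ tsupport η := closure_mono fun x hx h0 => hx (by simp [hη2, h0])
  set b : Fin n → (𝔼 n) → ℝ := fun k z => (z - x₀) k * η2 z with hb
  have hbs : ∀ k, ContDiff ℝ ∞ (b k) := fun k =>
    ContDiff.mul ((EuclideanSpace.proj (𝕜 := ℝ) k).contDiff.comp (contDiff_id.sub contDiff_const))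
      hη2s
  have hbt : ∀ k, tsupport (b k) ⊆ tsupport η := fun k => by
    have : tsupport (b k) ⊆ tsupport η2 := closure_mono fun x hx h0 => hx (by simp [hb, h0])
    exact this.trans hη2t
  have hbc : ∀ k, HasCompactSupport (b k) := fun k =>
    hc.isCompact.of_isClosed_subset (isClosed_tsupport _) (hbt k)
  -- The second-order term is η² y·∇(w - 1/w). It is integrated by parts with the test functions
  -- yₖη², whose total divergence is nη² + 2η y·∇η.
  have hw := fun k => (S.weak_G k).comp (contDiff_areaGap.of_le (by simp)) norm_fderiv_areaGap_le
  have i1 := fun k => integrable_smul_of_tsupport_subset (hw k).locInt_deriv (hbs k).continuous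
    (hbc k) ((hbt k).trans hs)
  have i2 := fun k => integrable_smul_of_tsupport_subset (hw k).locInt
    (contDiff_fderiv_apply_const (hbs k) (bv k)).continuous
    (hasCompactSupport_fderiv_apply (hbc k) (bv k))
    ((tsupport_fderiv_apply_subset' (φ := b k) (bv k)).trans ((hbt k).trans hs))
  have hI := fun k => (hw k).integral_eq (b k) (hbs k) (hbc k) ((hbt k).trans hs)
  have e1 : ∀ x, ((areaElt (G x))⁻¹ + (areaElt (G x))⁻¹ ^ 3) *
        (η x ^ 2 * inner ℝ (G x) (hessAct H (x - x₀) x))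
      = ∑ k, b k x • fderiv ℝ areaGap (G x) (H k x) := by
    intro x
    simp only [hessAct, inner_sum, real_inner_smul_right, fderiv_areaGap, smul_eq_mul,
      Finset.mul_sum, hb, hη2]
    exact Finset.sum_congr rfl fun k _ => by ring
  have e2 : ∀ x, areaGap (G x) * (n * η x ^ 2 + 2 * η x * inner ℝ (x - x₀) (∇ η x))
      = ∑ k, fderiv ℝ (b k) x (bv k) • areaGap (G x) := by
    intro x
    have : ∀ k, fderiv ℝ (b k) x (bv k) = η x ^ 2 + 2 * η x * ((x - x₀) k * ∇ η x k) := by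
      intro k
      have h := congrArg (fun v : 𝔼 n => v k) (gradient_coord_mul hη2s x₀ x k)
      simp only [hη2, gradient_sq hη] at h
      have h' := gradient_apply (b k) x k
      rw [← h', hb]
      simp only [hη2]
      rw [h]
      simp
      ring
    simp only [this, smul_eq_mul, ← Finset.sum_mul, Finset.sum_add_distrib, Finset.sum_const,
      Finset.card_univ, Fintype.card_fin, nsmul_eq_mul, ← Finset.mul_sum]
    rw [inner_eq_sum]
    ring
  refine ⟨?_, ?_, ?_⟩
  · simp only [e1]; exact integrable_finsetSum _ fun k _ => i1 k
  · simp only [e2]; exact integrable_finsetSum _ fun k _ => i2 k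
  · simp only [e1, e2]
    rw [integral_finsetSum _ fun k _ => i1 k, integral_finsetSum _ fun k _ => i2 k,
      ← Finset.sum_neg_distrib]
    exact Finset.sum_congr rfl fun k _ => by rw [hI k, neg_neg]

/-- At τ = 0 the damped cutoff is η itself, and a single term still contains D²u; replacing it by
its integrated form leaves a first-order inequality. -/
lemma stabIntegrand_nonneg (S : StableSystem Ω f u G H L) {η : (𝔼 n) → ℝ}
    (hη : ContDiff ℝ ∞ η) (hc : HasCompactSupport η) (hs : tsupport η ⊆ Ω) (x₀ : 𝔼 n) :
    Integrable (stabIntegrand G η x₀) ∧ 0 ≤ ∫ x, stabIntegrand G η x₀ x := by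
  obtain ⟨h1, h2⟩ := S.dampIntegrand_zero_nonneg hη hc hs x₀
  obtain ⟨h3, h4, h5⟩ := S.integral_areaGap hη hc hs x₀
  have e : ∀ x, stabIntegrand G η x₀ x = dampIntegrand G H η x₀ 0 x
      - ((areaElt (G x))⁻¹ + (areaElt (G x))⁻¹ ^ 3) *
        (η x ^ 2 * inner ℝ (G x) (hessAct H (x - x₀) x))
      - areaGap (G x) * (n * η x ^ 2 + 2 * η x * inner ℝ (x - x₀) (∇ η x)) := by
    intro x
    simp only [stabIntegrand, dampIntegrand, dampCut, dampGrad, zero_mul, add_zero, one_pow,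
      inv_one, mul_one, mul_zero, zero_smul, sub_zero, one_smul]
    ring
  have h6 : Integrable fun x => dampIntegrand G H η x₀ 0 x
      - ((areaElt (G x))⁻¹ + (areaElt (G x))⁻¹ ^ 3) *
        (η x ^ 2 * inner ℝ (G x) (hessAct H (x - x₀) x)) := h1.sub h3
  refine ⟨(h6.sub h4).congr (Eventually.of_forall fun x => (e x).symm), ?_⟩
  rw [integral_congr_ae (Eventually.of_forall e), integral_sub h6 h4, integral_sub h1 h3, h5]
  linarith

end StableSystem

end LimitInequality

end MeanCurvature

open Filter Set Metric ContinuousLinearMap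
open scoped Topology ContDiff Convolution

namespace MeanCurvature

local notation "𝔼" n => EuclideanSpace ℝ (Fin n)

/-! ### Pointwise bounds for the first-order integrand and the choice of a power weight. -/

section PointwiseEstimates

variable {n : ℕ}

lemma areaGap_eq (p : 𝔼 n) : areaGap p = (areaElt p)⁻¹ * ‖p‖ ^ 2 := by
  have h := areaElt_sq p
  have h0 := (areaElt_pos p).ne'
  have : ‖p‖ ^ 2 = areaElt p ^ 2 - 1 := by linarith
  rw [areaGap, this]; field_simp

lemma areaGap_le_norm (p : 𝔼 n) : (areaElt p)⁻¹ * ‖p‖ ^ 2 ≤ ‖p‖ := by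
  have h : (areaElt p)⁻¹ * ‖p‖ ≤ 1 := by
    rw [inv_mul_le_iff₀ (areaElt_pos p), mul_one]; exact norm_le_areaElt p
  calc (areaElt p)⁻¹ * ‖p‖ ^ 2 = ((areaElt p)⁻¹ * ‖p‖) * ‖p‖ := by ring
    _ ≤ 1 * ‖p‖ := by gcongr
    _ = ‖p‖ := one_mul _

/-- The quantity |p|²/w agrees with |p| up to an additive constant. This is one source of the 1 in
the final estimate. -/
lemma norm_sub_one_le_areaGap (p : 𝔼 n) : ‖p‖ - 1 ≤ (areaElt p)⁻¹ * ‖p‖ ^ 2 := by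
  rw [← areaGap_eq, areaGap]
  linarith [norm_le_areaElt p, areaElt_inv_le_one p]

/-- The scalar inequality behind the Morrey exponent. -/
lemma hardy_scalar_le {a N q s : ℝ}
    (hN : ∀ s ∈ Icc (0 : ℝ) 1, (1 - s) * (a + a ^ 2 / 4 * s) ≤ N)
    (hq : q ∈ Icc (0 : ℝ) 1) (hs : s ∈ Icc (0 : ℝ) 1) :
    (1 - s) * (a * q + a ^ 2 / 4 * q ^ 2 * s) ≤ N * q := by
  -- Here q = |y|²/(|y|²+ρ²) in the application; q² ≤ q reduces the regularized weight to the pure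
  -- power.
  have h1 : q ^ 2 ≤ q := by nlinarith [hq.1, hq.2]
  have h2 : 0 ≤ 1 - s := by linarith [hs.2]
  have h3 : 0 ≤ a ^ 2 / 4 * s := mul_nonneg (by positivity) hs.1
  calc (1 - s) * (a * q + a ^ 2 / 4 * q ^ 2 * s)
      = (1 - s) * (a * q) + (1 - s) * (a ^ 2 / 4 * s) * q ^ 2 := by ring
    _ ≤ (1 - s) * (a * q) + (1 - s) * (a ^ 2 / 4 * s) * q := by
        gcongr
    _ = (1 - s) * (a + a ^ 2 / 4 * s) * q := by ring
    _ ≤ N * q := mul_le_mul_of_nonneg_right (hN s hs) hq.1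

/-- Estimate of the stability integrand where `η` is a radial power weight. -/
lemma stabIntegrand_le_of_gradient_eq {G : (𝔼 n) → 𝔼 n} {η : (𝔼 n) → ℝ} {x₀ x : 𝔼 n} {a D : ℝ}
    (ha : 0 ≤ a) (hN : ∀ s ∈ Icc (0 : ℝ) 1, (1 - s) * (a + a ^ 2 / 4 * s) ≤ n - 1)
    (hD0 : 0 < D) (hD : ‖x - x₀‖ ^ 2 ≤ D)
    (hη : ∇ η x = (-(a / 2) * (η x / D)) • (x - x₀)) :
    stabIntegrand G η x₀ x ≤ η x ^ 2 * (-((n - 1) * (1 - ‖x - x₀‖ ^ 2 / D) * ‖G x‖)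
      + (n + a ^ 2 / 4)) := by
  have hn1 : (0 : ℝ) ≤ n - 1 := by
    have := hN 1 (by simp)
    simpa using this
  have hm := norm_sub_one_le_areaGap (G x)
  have hgap := areaGap_eq (G x)
  have hWP := areaElt_inv_sq_mul (G x)
  have hW0 := areaElt_inv_pos (G x)
  have hW1 := areaElt_inv_le_one (G x)
  set p := G x
  set y := x - x₀
  set W := (areaElt p)⁻¹
  set P := ‖p‖ ^ 2 with hP
  set c := inner ℝ y p with hc
  set q := ‖y‖ ^ 2 / D with hq
  have hqm : q ∈ Icc (0 : ℝ) 1 := ⟨by positivity, (div_le_one hD0).2 hD⟩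
  have hyq : ‖y‖ ^ 2 = q * D := by rw [hq]; field_simp
  have hc2 : c ^ 2 ≤ ‖y‖ ^ 2 * P := inner_sq_le y p
  -- The squared cosine of the angle between y and ∇u, with 0 chosen when one of them vanishes.
  obtain ⟨s, hs, hcs⟩ : ∃ s ∈ Icc (0 : ℝ) 1, c ^ 2 = P * (q * D) * s := by
    rw [hyq] at hc2
    rcases eq_or_ne (P * (q * D)) 0 with h0 | h0
    · refine ⟨0, by simp, ?_⟩
      have : c ^ 2 ≤ 0 := by rw [← h0, mul_comm P]; exact hc2
      rw [mul_zero]; exact le_antisymm this (sq_nonneg _)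
    · have hpos : 0 < P * (q * D) := lt_of_le_of_ne
        (mul_nonneg (sq_nonneg _) (mul_nonneg hqm.1 hD0.le)) (Ne.symm h0)
      exact ⟨c ^ 2 / (P * (q * D)), ⟨by positivity, (div_le_one hpos).2 (by linarith)⟩,
        (mul_div_cancel₀ _ h0).symm⟩
  have e1 : inner ℝ p (∇ η x) = -(a / 2) * (η x / D) * c := by
    rw [hη, real_inner_smul_right, real_inner_comm]
  have e2 : inner ℝ y (∇ η x) = -(a / 2) * (η x / D) * (q * D) := by
    rw [hη, real_inner_smul_right, real_inner_self_eq_norm_sq, hyq]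
  have e3 : inner ℝ (areaHess p (∇ η x)) (∇ η x)
      = (a / 2 * (η x / D)) ^ 2 * (W * (q * D) - W ^ 3 * c ^ 2) := by
    rw [hη, map_smul, real_inner_smul_left, real_inner_smul_right, inner_areaHess_self_eq, hyq,
      real_inner_comm]
    ring
  -- The order-one part, of size WP ~ |p|, carries the scalar inequality; the part with the extra W²
  -- is bounded and goes into the constant.
  have e4 : stabIntegrand G η x₀ x = η x ^ 2 * (W * P * (-(n - 1 - (1 - s) *
      (a * q + a ^ 2 / 4 * q ^ 2 * s)) + W ^ 2 * (1 - a / 2 * q * s) ^ 2)) := by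
    have h0 : stabIntegrand G η x₀ x = (W + W ^ 3) * (η x ^ 2 * P + 2 * c * η x
        * inner ℝ p (∇ η x)) - areaGap p * (n * η x ^ 2 + 2 * η x * inner ℝ y (∇ η x))
        + c ^ 2 * inner ℝ (areaHess p (∇ η x)) (∇ η x) := rfl
    rw [h0, e1, e2, e3, hgap]
    have h1 : 2 * c * η x * (-(a / 2) * (η x / D) * c) = -(a * η x ^ 2) * (P * q * s) := by
      have : 2 * c * η x * (-(a / 2) * (η x / D) * c) = -(a * η x ^ 2) * (c ^ 2 / D) := by ring
      rw [this, hcs]; field_simp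
    have h2 : 2 * η x * (-(a / 2) * (η x / D) * (q * D)) = -(a * q * η x ^ 2) := by
      field_simp
    have h3 : c ^ 2 * ((a / 2 * (η x / D)) ^ 2 * (W * (q * D) - W ^ 3 * c ^ 2))
        = P * q * s * (a ^ 2 / 4 * η x ^ 2) * (W * q - W * (W ^ 2 * P) * q * s) := by
      rw [hcs]; field_simp; ring
    rw [h1, h2, h3, hWP]
    ring
  rw [e4]
  refine mul_le_mul_of_nonneg_left ?_ (sq_nonneg _)
  have hh := hardy_scalar_le hN hqm hs
  have hWP0 : 0 ≤ W * P := mul_nonneg hW0.le (sq_nonneg _)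
  have hz : 0 ≤ a / 2 * q * s := mul_nonneg (mul_nonneg (by positivity) hqm.1) hs.1
  have hz1 : a / 2 * q * s ≤ a / 2 := by
    have : q * s ≤ 1 := mul_le_one₀ hqm.2 hs.1 hs.2
    calc a / 2 * q * s = a / 2 * (q * s) := by ring
      _ ≤ a / 2 * 1 := by gcongr
      _ = a / 2 := mul_one _
  have hz2 : (1 - a / 2 * q * s) ^ 2 ≤ 1 + a ^ 2 / 4 := by nlinarith
  have t1 : W * P * (W ^ 2 * (1 - a / 2 * q * s) ^ 2) ≤ 1 + a ^ 2 / 4 := by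
    have : W * P * W ^ 2 ≤ 1 := by
      calc W * P * W ^ 2 = W * (W ^ 2 * P) := by ring
        _ ≤ 1 * 1 := by
          rw [hWP]
          exact mul_le_mul hW1 (by linarith [sq_nonneg W]) (by nlinarith) zero_le_one
        _ = 1 := one_mul 1
    calc W * P * (W ^ 2 * (1 - a / 2 * q * s) ^ 2)
        = W * P * W ^ 2 * (1 - a / 2 * q * s) ^ 2 := by ring
      _ ≤ 1 * (1 + a ^ 2 / 4) := by gcongr
      _ = _ := one_mul _
  have t2 : W * P * ((n - 1) * (1 - q)) ≤ W * P * (n - 1 - (1 - s) *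
      (a * q + a ^ 2 / 4 * q ^ 2 * s)) := by
    refine mul_le_mul_of_nonneg_left ?_ hWP0
    linarith
  have h1q : 0 ≤ 1 - q := by linarith [hqm.2]
  have t3 : (‖p‖ - 1) * ((n - 1) * (1 - q)) ≤ W * P * ((n - 1) * (1 - q)) :=
    mul_le_mul_of_nonneg_right hm (mul_nonneg hn1 h1q)
  have t4 : ((n : ℝ) - 1) * (1 - q) ≤ n - 1 := mul_le_of_le_one_right hn1 (by linarith [hqm.1])
  have t5 : (‖p‖ - 1) * ((n - 1) * (1 - q)) = (n - 1) * (1 - q) * ‖p‖ - (n - 1) * (1 - q) := by ring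
  rw [mul_add, mul_neg]
  linarith

/-- Crude estimate of the stability integrand. -/
lemma stabIntegrand_le_of_bound {G : (𝔼 n) → 𝔼 n} {η : (𝔼 n) → ℝ} {x₀ x : 𝔼 n} {M : ℝ}
    (h1 : |η x| ≤ M) (h2 : ‖∇ η x‖ ≤ M) (h3 : ‖x - x₀‖ ≤ 1) :
    stabIntegrand G η x₀ x ≤ (n + 9) * M ^ 2 * ‖G x‖ := by
  have hM : 0 ≤ M := (abs_nonneg _).trans h1
  have hgap := areaGap_eq (G x)
  have hle := areaGap_le_norm (G x)
  have hW0 := areaElt_inv_pos (G x)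
  have hW1 := areaElt_inv_le_one (G x)
  set p := G x
  set y := x - x₀
  set W := (areaElt p)⁻¹
  set c := inner ℝ y p with hc
  have hcM : |c| ≤ ‖p‖ := (abs_real_inner_le_norm _ _).trans (mul_le_of_le_one_left (norm_nonneg _) h3)
  have hW3 : W + W ^ 3 ≤ 2 * W := by nlinarith [pow_le_one₀ hW0.le hW1 (n := 2)]
  have b1 : η x ^ 2 ≤ M ^ 2 := by rw [← sq_abs]; exact pow_le_pow_left₀ (abs_nonneg _) h1 2
  have b2 : 2 * c * η x * inner ℝ p (∇ η x) ≤ 2 * ‖p‖ * M * (‖p‖ * M) := by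
    refine (le_abs_self _).trans ?_
    rw [abs_mul, abs_mul, abs_mul, abs_two]
    gcongr
    exact (abs_real_inner_le_norm _ _).trans (by gcongr)
  have b3 : -(n * η x ^ 2 + 2 * η x * inner ℝ y (∇ η x)) ≤ (n + 2) * M ^ 2 := by
    have h5 : -(2 * η x * inner ℝ y (∇ η x)) ≤ 2 * M * (1 * M) := by
      refine (neg_le_abs _).trans ?_
      rw [abs_mul, abs_mul, abs_two]
      gcongr
      exact (abs_real_inner_le_norm _ _).trans (by gcongr)
    have h6 : (0 : ℝ) ≤ n * η x ^ 2 := by positivity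
    nlinarith [mul_nonneg (Nat.cast_nonneg (α := ℝ) n) (sq_nonneg M)]
  have b4 : c ^ 2 * inner ℝ (areaHess p (∇ η x)) (∇ η x) ≤ ‖p‖ ^ 2 * (W * M ^ 2) := by
    refine mul_le_mul ?_ ((inner_areaHess_self_le _ _).trans (by gcongr))
      (inner_areaHess_self_nonneg _ _) (sq_nonneg _)
    rw [← sq_abs]; exact pow_le_pow_left₀ (abs_nonneg _) hcM 2
  have h0 : stabIntegrand G η x₀ x = (W + W ^ 3) * (η x ^ 2 * ‖p‖ ^ 2 + 2 * c * η x
      * inner ℝ p (∇ η x)) + (W * ‖p‖ ^ 2) * -(n * η x ^ 2 + 2 * η x * inner ℝ y (∇ η x))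
      + c ^ 2 * inner ℝ (areaHess p (∇ η x)) (∇ η x) := by
    rw [← hgap, stabIntegrand]; ring
  rw [h0]
  calc _ ≤ 2 * W * (M ^ 2 * ‖p‖ ^ 2 + 2 * ‖p‖ * M * (‖p‖ * M))
        + (W * ‖p‖ ^ 2) * ((n + 2) * M ^ 2) + ‖p‖ ^ 2 * (W * M ^ 2) := by
        have c1 : (W + W ^ 3) * (η x ^ 2 * ‖p‖ ^ 2 + 2 * c * η x * inner ℝ p (∇ η x))
            ≤ (W + W ^ 3) * (M ^ 2 * ‖p‖ ^ 2 + 2 * ‖p‖ * M * (‖p‖ * M)) := by gcongr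
        have c2 : (W + W ^ 3) * (M ^ 2 * ‖p‖ ^ 2 + 2 * ‖p‖ * M * (‖p‖ * M))
            ≤ 2 * W * (M ^ 2 * ‖p‖ ^ 2 + 2 * ‖p‖ * M * (‖p‖ * M)) := by gcongr
        have c3 : (W * ‖p‖ ^ 2) * -(n * η x ^ 2 + 2 * η x * inner ℝ y (∇ η x))
            ≤ (W * ‖p‖ ^ 2) * ((n + 2) * M ^ 2) := by gcongr
        linarith
    _ = (n + 9) * M ^ 2 * (W * ‖p‖ ^ 2) := by ring
    _ ≤ (n + 9) * M ^ 2 * ‖p‖ := by gcongr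

lemma stabIntegrand_eq_zero {G : (𝔼 n) → 𝔼 n} {η : (𝔼 n) → ℝ} {x₀ x : 𝔼 n}
    (hx : x ∉ tsupport η) : stabIntegrand G η x₀ x = 0 := by
  simp [stabIntegrand, image_eq_zero_of_notMem_tsupport hx,
    gradient_eq_zero_of_notMem_tsupport hx]

/-! ### The power weight -/

/-- The regularized power weight `(|x - x₀|² + ρ²)^{-a/4}`. -/
noncomputable def powWeight (a ρ : ℝ) (x₀ x : 𝔼 n) : ℝ := (‖x - x₀‖ ^ 2 + ρ ^ 2) ^ (-a / 4)

lemma contDiff_powWeight (a : ℝ) {ρ : ℝ} (hρ : 0 < ρ) (x₀ : 𝔼 n) :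
    ContDiff ℝ ∞ (powWeight a ρ x₀) :=
  ContDiff.rpow_const_of_ne
    (((contDiff_id.sub contDiff_const).norm_sq ℝ).add contDiff_const) fun x => by positivity

lemma powWeight_pos (a : ℝ) {ρ : ℝ} (hρ : 0 < ρ) (x₀ x : 𝔼 n) : 0 < powWeight a ρ x₀ x :=
  Real.rpow_pos_of_pos (by positivity) _

lemma gradient_powWeight (a : ℝ) {ρ : ℝ} (hρ : 0 < ρ) (x₀ x : 𝔼 n) :
    ∇ (powWeight a ρ x₀) x
      = (-(a / 2) * (powWeight a ρ x₀ x / (‖x - x₀‖ ^ 2 + ρ ^ 2))) • (x - x₀) := by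
  have hD : 0 < ‖x - x₀‖ ^ 2 + ρ ^ 2 := by positivity
  have h1 : HasFDerivAt (fun z : 𝔼 n => ‖z - x₀‖ ^ 2 + ρ ^ 2) (2 • innerSL ℝ (x - x₀)) x := by
    have := ((hasStrictFDerivAt_norm_sq (x - x₀)).hasFDerivAt.comp x
      ((hasFDerivAt_id x).sub_const x₀)).add_const (ρ ^ 2)
    exact this
  have h2 := (h1.rpow_const (p := -a / 4) (Or.inl hD.ne')).fderiv
  refine ext_inner_right ℝ fun e => ?_
  rw [inner_gradient, powWeight, real_inner_smul_left]
  have h3 : fderiv ℝ (powWeight a ρ x₀) x = _ := h2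
  rw [h3]
  simp only [smul_apply, innerSL_apply_apply, smul_eq_mul, nsmul_eq_mul]
  rw [Real.rpow_sub_one hD.ne']
  push_cast
  ring

lemma powWeight_sq_le {a ρ : ℝ} (ha : 0 ≤ a) {x₀ x : 𝔼 n} (hx : x ≠ x₀) :
    powWeight a ρ x₀ x ^ 2 ≤ ‖x - x₀‖ ^ (-a) := by
  have h0 : 0 < ‖x - x₀‖ := norm_pos_iff.2 (sub_ne_zero.2 hx)
  rw [powWeight, ← Real.rpow_natCast, ← Real.rpow_mul (by positivity)]
  have e : ‖x - x₀‖ ^ (-a) = (‖x - x₀‖ ^ 2) ^ (-a / 4 * (2 : ℕ)) := by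
    rw [← Real.rpow_natCast, ← Real.rpow_mul h0.le]; congr 1; push_cast; ring
  rw [e]
  refine Real.rpow_le_rpow_of_nonpos (by positivity) (by linarith [sq_nonneg ρ]) ?_
  push_cast; linarith

lemma le_powWeight_sq {a ρ : ℝ} (ha : 0 ≤ a) (hρ : 0 < ρ) {x₀ x : 𝔼 n} (hx : ‖x - x₀‖ ≤ ρ) :
    2 ^ (-a / 2) * ρ ^ (-a) ≤ powWeight a ρ x₀ x ^ 2 := by
  rw [powWeight, ← Real.rpow_natCast, ← Real.rpow_mul (by positivity)]
  have e : (2 : ℝ) ^ (-a / 2) * ρ ^ (-a) = (2 * ρ ^ 2) ^ (-a / 4 * (2 : ℕ)) := by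
    rw [Real.mul_rpow (by norm_num) (by positivity), ← Real.rpow_natCast ρ, ← Real.rpow_mul hρ.le]
    congr 2 <;> push_cast <;> ring
  rw [e]
  refine Real.rpow_le_rpow_of_nonpos (by positivity) ?_ ?_
  · have := pow_le_pow_left₀ (norm_nonneg _) hx 2
    linarith
  · push_cast; linarith

lemma powWeight_le {a ρ : ℝ} (ha : 0 ≤ a) {x₀ x : 𝔼 n} (hx : 1 / 4 ≤ ‖x - x₀‖) :
    powWeight a ρ x₀ x ≤ 2 ^ a := by
  have e : (2 : ℝ) ^ a = ((1 / 4) ^ 2) ^ (-a / 4) := by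
    rw [show ((1 : ℝ) / 4) ^ 2 = 2 ^ (-4 : ℝ) by norm_num [Real.rpow_neg], ← Real.rpow_mul (by norm_num)]
    congr 1; ring
  rw [e, powWeight]
  refine Real.rpow_le_rpow_of_nonpos (by positivity) ?_ (by linarith)
  have := pow_le_pow_left₀ (by norm_num) hx 2
  linarith [sq_nonneg ρ]

lemma integrableOn_norm_rpow_neg {a : ℝ} (hn : 1 ≤ n) (ha : a < n) (r : ℝ) :
    IntegrableOn (fun x : 𝔼 n => ‖x‖ ^ (-a)) (ball 0 r) := by
  refine integrableOn_ball_of_norm_le_rpow (C := 1) (α := a) (by simpa using hn) (by simpa using ha)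
    (Eventually.of_forall fun x => ?_) (measurable_norm.pow_const _).aestronglyMeasurable
  rw [one_mul, Real.norm_of_nonneg (Real.rpow_nonneg (norm_nonneg _) _)]

/-- A cutoff equal to `1` on the ball of radius `1/4` and vanishing outside that of radius `1/2`. -/
noncomputable def unitCutoff (n : ℕ) : ContDiffBump (0 : 𝔼 n) := ⟨1 / 4, 1 / 2, by norm_num, by norm_num⟩

/-- The localized power weight. -/
noncomputable def cutWeight (a ρ : ℝ) (x₀ x : 𝔼 n) : ℝ := unitCutoff n (x - x₀) * powWeight a ρ x₀ x

lemma contDiff_cutWeight (a : ℝ) {ρ : ℝ} (hρ : 0 < ρ) (x₀ : 𝔼 n) :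
    ContDiff ℝ ∞ (cutWeight a ρ x₀) :=
  ((unitCutoff n).contDiff.comp (contDiff_id.sub contDiff_const)).mul (contDiff_powWeight a hρ x₀)

lemma tsupport_cutWeight_subset (a ρ : ℝ) (x₀ : 𝔼 n) :
    tsupport (cutWeight a ρ x₀) ⊆ closedBall x₀ (1 / 2) := by
  refine closure_minimal (fun x hx => ?_) isClosed_closedBall
  by_contra h
  refine hx ?_
  have : unitCutoff n (x - x₀) = 0 := (unitCutoff n).zero_of_le_dist (by
    rw [mem_closedBall, not_le] at h
    rw [dist_zero_right, ← dist_eq_norm]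
    exact h.le)
  simp [cutWeight, this]

lemma hasCompactSupport_cutWeight (a ρ : ℝ) (x₀ : 𝔼 n) : HasCompactSupport (cutWeight a ρ x₀) :=
  (isCompact_closedBall x₀ (1 / 2)).of_isClosed_subset (isClosed_tsupport _)
    (tsupport_cutWeight_subset a ρ x₀)

lemma cutWeight_eventuallyEq (a ρ : ℝ) {x₀ x : 𝔼 n} (hx : ‖x - x₀‖ < 1 / 4) :
    cutWeight a ρ x₀ =ᶠ[𝓝 x] powWeight a ρ x₀ := by
  have : ball x₀ (1 / 4) ∈ 𝓝 x := isOpen_ball.mem_nhds (by rwa [mem_ball, dist_eq_norm])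
  filter_upwards [this] with z hz
  have : unitCutoff n (z - x₀) = 1 := (unitCutoff n).one_of_mem_closedBall (by
    rw [mem_closedBall, dist_zero_right, ← dist_eq_norm]
    exact (mem_ball.1 hz).le)
  rw [cutWeight, this, one_mul]

lemma gradient_cutWeight {a ρ : ℝ} (hρ : 0 < ρ) {x₀ x : 𝔼 n} :
    ∇ (cutWeight a ρ x₀) x = powWeight a ρ x₀ x • ∇ (unitCutoff n) (x - x₀)
      + unitCutoff n (x - x₀) • ∇ (powWeight a ρ x₀) x := by
  have h1 : HasFDerivAt (fun z => unitCutoff n (z - x₀)) (fderiv ℝ (unitCutoff n) (x - x₀)) x := by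
    have h := (((unitCutoff n).contDiff (n := 1)).differentiable one_ne_zero (x - x₀)).hasFDerivAt
    exact h.comp x ((hasFDerivAt_id x).sub_const x₀)
  have h2 := ((contDiff_powWeight a hρ x₀).differentiable (by simp) x).hasFDerivAt
  have h3 : fderiv ℝ (cutWeight a ρ x₀) x = _ := (h1.mul h2).fderiv
  refine ext_inner_right ℝ fun e => ?_
  rw [inner_gradient, h3, inner_add_left, real_inner_smul_left, real_inner_smul_left,
    inner_gradient, inner_gradient]
  simp [add_comm]

/-- In the transition annulus of the cutoff the weight is away from its singularity, so the bounds
are uniform in ρ and x₀. The constant 2^a is (1/16)^(-a/4). -/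
lemma exists_cutWeight_bound (n : ℕ) {a : ℝ} (ha : 0 ≤ a) :
    ∃ M : ℝ, ∀ ρ > 0, ∀ x₀ x : 𝔼 n, 1 / 4 ≤ ‖x - x₀‖ → ‖x - x₀‖ ≤ 1 / 2 →
      |cutWeight a ρ x₀ x| ≤ M ∧ ‖∇ (cutWeight a ρ x₀) x‖ ≤ M := by
  obtain ⟨B, hB⟩ := (isCompact_closedBall (0 : 𝔼 n) 1).exists_bound_of_continuousOn
    (continuous_gradient (φ := unitCutoff n) (unitCutoff n).contDiff).continuousOn
  have hB0 : 0 ≤ B := (norm_nonneg _).trans (hB 0 (by simp))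
  have h2a : (0 : ℝ) < 2 ^ a := Real.rpow_pos_of_pos two_pos _
  refine ⟨2 ^ a + 2 ^ a * B + 4 * a * 2 ^ a, fun ρ hρ x₀ x h1 h2 => ?_⟩
  have hw := powWeight_le (ρ := ρ) ha h1
  have hw0 := powWeight_pos a hρ x₀ x
  have hc0 := (unitCutoff n).nonneg' (x - x₀)
  have hc1 := (unitCutoff n).le_one (x := x - x₀)
  constructor
  · rw [cutWeight, abs_of_nonneg (by positivity)]
    calc unitCutoff n (x - x₀) * powWeight a ρ x₀ x ≤ 1 * 2 ^ a := by gcongr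
      _ ≤ _ := by
        have : 0 ≤ 2 ^ a * B + 4 * a * 2 ^ a := by positivity
        linarith
  · rw [gradient_cutWeight hρ]
    refine (norm_add_le _ _).trans ?_
    have g1 : ‖powWeight a ρ x₀ x • ∇ (unitCutoff n) (x - x₀)‖ ≤ 2 ^ a * B := by
      rw [norm_smul, Real.norm_of_nonneg hw0.le]
      gcongr
      exact hB _ (by rw [mem_closedBall, dist_zero_right]; linarith)
    have g2 : ‖∇ (powWeight a ρ x₀) x‖ ≤ 4 * a * 2 ^ a := by
      rw [gradient_powWeight a hρ, norm_smul, norm_mul, norm_neg, Real.norm_of_nonneg (by positivity),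
        Real.norm_of_nonneg (by positivity)]
      have : powWeight a ρ x₀ x / (‖x - x₀‖ ^ 2 + ρ ^ 2) ≤ 2 ^ a / (1 / 16) := by
        have := pow_le_pow_left₀ (by norm_num) h1 2
        gcongr
        linarith [sq_nonneg ρ]
      calc a / 2 * (powWeight a ρ x₀ x / (‖x - x₀‖ ^ 2 + ρ ^ 2)) * ‖x - x₀‖
          ≤ a / 2 * (2 ^ a / (1 / 16)) * (1 / 2) := by gcongr
        _ = 4 * a * 2 ^ a := by ring
    have g3 : ‖unitCutoff n (x - x₀) • ∇ (powWeight a ρ x₀) x‖ ≤ 4 * a * 2 ^ a := by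
      rw [norm_smul, Real.norm_of_nonneg hc0]
      exact (mul_le_of_le_one_left (norm_nonneg _) hc1).trans g2
    linarith

/-- Within distance 1/4 the weight is a pure radial power and the scalar inequality gives the
negative term; in the annulus up to 1/2 the crude bound by |G| suffices; beyond it everything
vanishes. -/
lemma stabIntegrand_cutWeight_le {a : ℝ} (ha : 0 ≤ a) (hn : 2 ≤ n)
    (hN : ∀ s ∈ Icc (0 : ℝ) 1, (1 - s) * (a + a ^ 2 / 4 * s) ≤ n - 1) :
    ∃ C : ℝ, 0 ≤ C ∧ ∀ (G : (𝔼 n) → 𝔼 n) (x₀ x : 𝔼 n) (ρ : ℝ), 0 < ρ → ρ ≤ 1 / 4 → x ≠ x₀ →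
      stabIntegrand G (cutWeight a ρ x₀) x₀ x
        ≤ -(2 ^ (-a / 2) / 2 * ρ ^ (-a)) * (ball x₀ ρ).indicator (fun x => ‖G x‖) x
          + C * ((ball 0 1).indicator (fun z => ‖z‖ ^ (-a)) (x - x₀)
            + (closedBall x₀ (1 / 2)).indicator (fun x => ‖G x‖) x) := by
  obtain ⟨M, hM⟩ := exists_cutWeight_bound n ha
  refine ⟨(n + a ^ 2 / 4) + (n + 9) * M ^ 2, by positivity, fun G x₀ x ρ hρ hρ4 hx => ?_⟩
  have hn' : (2 : ℝ) ≤ n := by exact_mod_cast hn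
  set C := (n + a ^ 2 / 4) + (n + 9) * M ^ 2 with hC
  have hC0 : 0 ≤ C := by positivity
  have hj0 : 0 ≤ (ball (0 : 𝔼 n) 1).indicator (fun z => ‖z‖ ^ (-a)) (x - x₀) :=
    indicator_nonneg (fun z _ => Real.rpow_nonneg (norm_nonneg _) _) _
  have hg0 : 0 ≤ (closedBall x₀ (1 / 2)).indicator (fun x => ‖G x‖) x :=
    indicator_nonneg (fun z _ => norm_nonneg _) _
  rcases lt_or_ge ‖x - x₀‖ (1 / 4) with h | h
  · have heq := cutWeight_eventuallyEq a ρ h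
    have hval := heq.eq_of_nhds
    have hD0 : 0 < ‖x - x₀‖ ^ 2 + ρ ^ 2 := by positivity
    have hgrad : ∇ (cutWeight a ρ x₀) x
        = (-(a / 2) * (cutWeight a ρ x₀ x / (‖x - x₀‖ ^ 2 + ρ ^ 2))) • (x - x₀) := by
      rw [hval, ← gradient_powWeight a hρ, gradient, gradient, heq.fderiv_eq]
    have hmain := stabIntegrand_le_of_gradient_eq (G := G) ha hN hD0
      (by linarith [sq_nonneg ρ]) hgrad
    rw [hval] at hmain
    refine hmain.trans ?_
    have hj : (ball (0 : 𝔼 n) 1).indicator (fun z => ‖z‖ ^ (-a)) (x - x₀) = ‖x - x₀‖ ^ (-a) :=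
      indicator_of_mem (by rw [mem_ball, dist_zero_right]; linarith) _
    have hw := powWeight_sq_le (ρ := ρ) ha hx
    have hCle : (n : ℝ) + a ^ 2 / 4 ≤ C := by
      have : 0 ≤ ((n : ℝ) + 9) * M ^ 2 := by positivity
      linarith
    have t1 : powWeight a ρ x₀ x ^ 2 * (n + a ^ 2 / 4) ≤ C * ‖x - x₀‖ ^ (-a) := by
      rw [mul_comm]
      gcongr
    have hq : ‖x - x₀‖ ^ 2 / (‖x - x₀‖ ^ 2 + ρ ^ 2) ≤ 1 :=
      (div_le_one hD0).2 (by linarith [sq_nonneg ρ])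
    have t2 : 2 ^ (-a / 2) / 2 * ρ ^ (-a) * (ball x₀ ρ).indicator (fun x => ‖G x‖) x
        ≤ powWeight a ρ x₀ x ^ 2 *
          ((n - 1) * (1 - ‖x - x₀‖ ^ 2 / (‖x - x₀‖ ^ 2 + ρ ^ 2)) * ‖G x‖) := by
      by_cases hb : x ∈ ball x₀ ρ
      · rw [indicator_of_mem hb]
        rw [mem_ball, dist_eq_norm] at hb
        have u1 := le_powWeight_sq ha hρ hb.le
        -- The regularization is what produces the gain: inside radius ρ the ratio is at most 1/2,
        -- and n - 1 ≥ 1.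
        have u2 : (1 : ℝ) / 2 ≤ (n - 1) * (1 - ‖x - x₀‖ ^ 2 / (‖x - x₀‖ ^ 2 + ρ ^ 2)) := by
          have : ‖x - x₀‖ ^ 2 / (‖x - x₀‖ ^ 2 + ρ ^ 2) ≤ 1 / 2 := by
            rw [div_le_iff₀ hD0]
            have := pow_le_pow_left₀ (norm_nonneg _) hb.le 2
            linarith
          nlinarith
        calc 2 ^ (-a / 2) / 2 * ρ ^ (-a) * ‖G x‖
            = (2 ^ (-a / 2) * ρ ^ (-a)) * (1 / 2 * ‖G x‖) := by ring
          _ ≤ _ := by gcongr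
      · rw [indicator_of_notMem hb, mul_zero]
        have : 0 ≤ ((n : ℝ) - 1) * (1 - ‖x - x₀‖ ^ 2 / (‖x - x₀‖ ^ 2 + ρ ^ 2)) :=
          mul_nonneg (by linarith) (by linarith)
        positivity
    rw [hj]
    have t3 : 0 ≤ C * (closedBall x₀ (1 / 2)).indicator (fun x => ‖G x‖) x := mul_nonneg hC0 hg0
    rw [mul_add, mul_add, mul_neg, neg_mul]
    linarith
  · have hb : x ∉ ball x₀ ρ := by
      rw [mem_ball, dist_eq_norm, not_lt]; linarith
    rw [indicator_of_notMem hb, mul_zero, zero_add]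
    rcases le_or_gt ‖x - x₀‖ (1 / 2) with h' | h'
    · have hmem : x ∈ closedBall x₀ (1 / 2) := by rwa [mem_closedBall, dist_eq_norm]
      rw [indicator_of_mem hmem] at hg0 ⊢
      obtain ⟨m1, m2⟩ := hM ρ hρ x₀ x h h'
      refine (stabIntegrand_le_of_bound m1 m2 (by linarith)).trans ?_
      have : (n + 9) * M ^ 2 ≤ C := by
        have : 0 ≤ (n : ℝ) + a ^ 2 / 4 := by positivity
        linarith
      calc (n + 9) * M ^ 2 * ‖G x‖ ≤ C * ‖G x‖ := by gcongr
        _ ≤ _ := by gcongr; linarith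
    · have : x ∉ tsupport (cutWeight a ρ x₀) := fun hm => by
        have := tsupport_cutWeight_subset a ρ x₀ hm
        rw [mem_closedBall, dist_eq_norm] at this
        linarith
      rw [stabIntegrand_eq_zero this]
      positivity

/-- The Morrey estimate on small balls. -/
lemma exists_morrey_const {a : ℝ} (ha : 0 ≤ a) (hn : 2 ≤ n)
    (hN : ∀ s ∈ Icc (0 : ℝ) 1, (1 - s) * (a + a ^ 2 / 4 * s) ≤ n - 1) :
    ∃ C : ℝ, 0 ≤ C ∧ ∀ {f : ℝ → ℝ} {u : (𝔼 n) → ℝ} {G : (𝔼 n) → 𝔼 n} {H L : Fin n → (𝔼 n) → 𝔼 n},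
      StableSystem (B n 2) f u G H L → ∀ x₀ ∈ ball (0 : 𝔼 n) 1, ∀ ρ : ℝ, 0 < ρ → ρ ≤ 1 / 4 →
        ∫ x in ball x₀ ρ, ‖G x‖ ≤ C * ρ ^ a * (1 + ∫ x in closedBall x₀ (1 / 2), ‖G x‖) := by
  obtain ⟨C, hC, hle⟩ := stabIntegrand_cutWeight_le ha hn hN
  set j : (𝔼 n) → ℝ := (ball 0 1).indicator (fun z => ‖z‖ ^ (-a)) with hj
  -- The hypothesis at s = 0 reads a ≤ n - 1, which makes |y|^(-a) integrable near 0.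
  have han : a < n := by
    have := hN 0 (by simp)
    norm_num at this
    linarith
  have hji : Integrable j :=
    (integrable_indicator_iff measurableSet_ball).2 (integrableOn_norm_rpow_neg (by omega) han 1)
  have hJ0 : 0 ≤ ∫ z, j z := integral_nonneg fun z =>
    indicator_nonneg (fun z _ => Real.rpow_nonneg (norm_nonneg _) _) z
  set κ : ℝ := 2 ^ (-a / 2) / 2 with hκ
  have hκ0 : 0 < κ := half_pos (Real.rpow_pos_of_pos two_pos _)
  refine ⟨κ⁻¹ * (C * (1 + ∫ z, j z)), by positivity, fun {f u G H L} S x₀ hx₀ ρ hρ hρ4 => ?_⟩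
  have hsub : closedBall x₀ (1 / 2) ⊆ (B n 2 : Set (𝔼 n)) := by
    intro z hz
    change z ∈ ball 0 2
    rw [mem_ball] at hx₀ ⊢
    rw [mem_closedBall] at hz
    linarith [dist_triangle z x₀ 0]
  obtain ⟨hi, h0⟩ := S.stabIntegrand_nonneg (contDiff_cutWeight a hρ x₀)
    (hasCompactSupport_cutWeight a ρ x₀) ((tsupport_cutWeight_subset a ρ x₀).trans hsub) x₀
  have hG : IntegrableOn (fun x => ‖G x‖) (closedBall x₀ (1 / 2)) :=
    (locallyIntegrableOn_opens_iff.1 (S.weak_G ⟨0, by omega⟩).locInt _ hsub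
      (isCompact_closedBall _ _)).norm
  have hGρ : IntegrableOn (fun x => ‖G x‖) (ball x₀ ρ) :=
    hG.mono_set (ball_subset_closedBall.trans (closedBall_subset_closedBall (by linarith)))
  have i1 : Integrable ((ball x₀ ρ).indicator fun x => ‖G x‖) :=
    (integrable_indicator_iff measurableSet_ball).2 hGρ
  have i2 : Integrable ((closedBall x₀ (1 / 2)).indicator fun x => ‖G x‖) :=
    (integrable_indicator_iff measurableSet_closedBall).2 hG
  have i3 : Integrable fun x => j (x - x₀) := hji.comp_sub_right x₀
  have i4 : Integrable fun x => j (x - x₀) + (closedBall x₀ (1 / 2)).indicator (fun x => ‖G x‖) x :=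
    i3.add i2
  have hnon : Nontrivial (𝔼 n) := by
    have : Nonempty (Fin n) := ⟨⟨0, by omega⟩⟩
    infer_instance
  -- The centre is excluded because for a > 0 the real power 0^(-a) is 0 and does not dominate the
  -- weight there.
  have hae : ∀ᵐ x : 𝔼 n, x ≠ x₀ := by
    rw [ae_iff]; simp
  have hint : 0 ≤ ∫ x, (-(κ * ρ ^ (-a)) * (ball x₀ ρ).indicator (fun x => ‖G x‖) x
      + C * (j (x - x₀) + (closedBall x₀ (1 / 2)).indicator (fun x => ‖G x‖) x)) :=
    h0.trans (integral_mono_ae hi ((i1.const_mul _).add (i4.const_mul C)) (by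
      filter_upwards [hae] with x hx using hle G x₀ x ρ hρ hρ4 hx))
  rw [integral_add (i1.const_mul _) (i4.const_mul C), integral_const_mul, integral_const_mul,
    integral_add i3 i2, integral_indicator measurableSet_ball,
    integral_indicator measurableSet_closedBall, integral_sub_right_eq_self] at hint
  set I := ∫ x in ball x₀ ρ, ‖G x‖
  set K := ∫ x in closedBall x₀ (1 / 2), ‖G x‖ with hK
  have hK0 : 0 ≤ K := integral_nonneg fun x => norm_nonneg _
  have h1 : κ * ρ ^ (-a) * I ≤ C * ((∫ z, j z) + K) := by linarith
  have hρa : 0 < ρ ^ a := Real.rpow_pos_of_pos hρ _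
  have h2 : I = κ⁻¹ * ρ ^ a * (κ * ρ ^ (-a) * I) := by
    rw [Real.rpow_neg hρ.le]; field_simp
  rw [h2]
  calc κ⁻¹ * ρ ^ a * (κ * ρ ^ (-a) * I) ≤ κ⁻¹ * ρ ^ a * (C * ((∫ z, j z) + K)) := by gcongr
    _ ≤ κ⁻¹ * ρ ^ a * (C * ((1 + ∫ z, j z) * (1 + K))) := by
        gcongr
        nlinarith [mul_nonneg hJ0 hK0]
    _ = _ := by ring

end PointwiseEstimates

end MeanCurvature

open Filter Set Metric ContinuousLinearMap
open scoped Topology ContDiff Convolution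

namespace MeanCurvature

local notation "𝔼" n => EuclideanSpace ℝ (Fin n)

/-! ### From the definition of a stable solution to the working system of weak identities. -/

section Construction

set_option linter.unusedSectionVars false

variable {n : ℕ} {F : Type*} [NormedAddCommGroup F] [NormedSpace ℝ F] {Ω : Opens (𝔼 n)}

lemma LocallyIntegrableOn.congr_ae_on {g g' : (𝔼 n) → F} (h : LocallyIntegrableOn g Ω volume)
    (hg : ∀ᵐ x, x ∈ Ω → g x = g' x) : LocallyIntegrableOn g' Ω volume := by
  rw [locallyIntegrableOn_opens_iff] at *
  intro K hK hKc
  refine (h K hK hKc).congr ?_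
  rw [EventuallyEq, ae_restrict_iff' hKc.measurableSet]
  filter_upwards [hg] with x hx hxK using hx (hK hxK)

lemma LocallyIntegrableOn.aestronglyMeasurable_indicator {g : (𝔼 n) → F}
    (h : LocallyIntegrableOn g Ω volume) :
    AEStronglyMeasurable ((Ω : Set (𝔼 n)).indicator g) volume :=
  (aestronglyMeasurable_indicator_iff Ω.isOpen.measurableSet).2 h.aestronglyMeasurable

lemma HasWeakDeriv.congr_on {e : 𝔼 n} {g g' v v' : (𝔼 n) → F} (h : HasWeakDeriv Ω e g v)
    (hg : ∀ᵐ x, x ∈ Ω → g x = g' x) (hv : ∀ᵐ x, x ∈ Ω → v x = v' x) :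
    HasWeakDeriv Ω e g' v' := by
  refine ⟨LocallyIntegrableOn.congr_ae_on h.locInt hg,
    LocallyIntegrableOn.congr_ae_on h.locInt_deriv hv, fun φ h1 h2 h3 => ?_⟩
  have e1 : ∫ x, fderiv ℝ φ x e • g x = ∫ x, fderiv ℝ φ x e • g' x := by
    refine integral_congr_ae ?_
    filter_upwards [hg] with x hx
    by_cases hxΩ : x ∈ Ω
    · rw [hx hxΩ]
    · have : fderiv ℝ φ x e = 0 := image_eq_zero_of_notMem_tsupport
        (f := fun x => fderiv ℝ φ x e) fun hm => hxΩ (h3 (tsupport_fderiv_apply_subset' e hm))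
      rw [this, zero_smul, zero_smul]
  have e2 : ∫ x, φ x • v x = ∫ x, φ x • v' x := by
    refine integral_congr_ae ?_
    filter_upwards [hv] with x hx
    by_cases hxΩ : x ∈ Ω
    · rw [hx hxΩ]
    · rw [image_eq_zero_of_notMem_tsupport fun hm => hxΩ (h3 hm), zero_smul, zero_smul]
  rw [← e1, ← e2]
  exact h.integral_eq φ h1 h2 h3

lemma ae_mem_indicator_eq (g : (𝔼 n) → F) :
    ∀ᵐ x, x ∈ Ω → g x = (Ω : Set (𝔼 n)).indicator g x :=
  Eventually.of_forall fun _ hx => (indicator_of_mem (s := (Ω : Set (𝔼 n))) hx g).symm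

lemma HasWeakDeriv.ae_unique [CompleteSpace F] {e : 𝔼 n} {g v v' : (𝔼 n) → F}
    (h : HasWeakDeriv Ω e g v) (h' : HasWeakDeriv Ω e g v') : ∀ᵐ x, x ∈ Ω → v x = v' x := by
  have := Ω.isOpen.ae_eq_zero_of_integral_contDiff_smul_eq_zero
    (h.locInt_deriv.sub h'.locInt_deriv) fun φ h1 h2 h3 => by
      have e1 := h.integral_eq φ h1 h2 h3
      rw [h'.integral_eq φ h1 h2 h3, neg_inj] at e1
      simp only [Pi.sub_apply, smul_sub]
      rw [integral_sub (integrable_smul_of_tsupport_subset h.locInt_deriv h1.continuous h2 h3)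
        (integrable_smul_of_tsupport_subset h'.locInt_deriv h1.continuous h2 h3), e1, sub_self]
  filter_upwards [this] with x hx hxΩ using sub_eq_zero.1 (hx hxΩ)

lemma setIntegral_opens_eq {φ b : (𝔼 n) → ℝ} (hs : tsupport φ ⊆ Ω)
    (h : ∀ x ∉ tsupport φ, b x = 0) : ∫ x in Ω, b x = ∫ x, b x :=
  setIntegral_eq_integral_of_forall_compl_eq_zero fun x hx => h x fun hm => hx (hs hm)

lemma HasWeakPartial.hasWeakDeriv {i : Fin n} {u v : (𝔼 n) → ℝ} (h : HasWeakPartial Ω i u v) :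
    HasWeakDeriv Ω (bv i) u v := by
  refine ⟨h.locInt, h.locInt_partial, fun φ h1 h2 h3 => ?_⟩
  have e := h.integral_eq ⟨φ, h1, h2, h3⟩
  have e1 : ∫ x in Ω, u x * fderiv ℝ φ x (bv i) = ∫ x, u x * fderiv ℝ φ x (bv i) :=
    setIntegral_opens_eq h3 fun x hx => by
      rw [image_eq_zero_of_notMem_tsupport (f := fun x => fderiv ℝ φ x (bv i)) fun hm =>
        hx (tsupport_fderiv_apply_subset' _ hm), mul_zero]
  have e2 : ∫ x in Ω, v x * φ x = ∫ x, v x * φ x :=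
    setIntegral_opens_eq h3 fun x hx => by
      rw [image_eq_zero_of_notMem_tsupport hx, mul_zero]
  simp only [smul_eq_mul, mul_comm (fderiv ℝ φ _ _), mul_comm (φ _)]
  rw [← e1, ← e2]
  exact e

lemma locallyIntegrableOn_toLp {v : Fin n → (𝔼 n) → ℝ}
    (h : ∀ j, LocallyIntegrableOn (v j) Ω volume) :
    LocallyIntegrableOn (fun x => (WithLp.toLp 2 fun j => v j x : 𝔼 n)) Ω volume := by
  have e : (fun x => (WithLp.toLp 2 fun j => v j x : 𝔼 n)) = fun x => ∑ j, v j x • bv j := by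
    ext x k
    simp [Finset.sum_apply, Pi.single_apply]
  rw [e]
  simp only [locallyIntegrableOn_opens_iff] at *
  exact fun K h1 h2 => integrable_finsetSum _ fun j _ => (h j K h1 h2).smul_const _

lemma HasWeakDeriv.toLp {e : 𝔼 n} {g v : Fin n → (𝔼 n) → ℝ}
    (h : ∀ j, HasWeakDeriv Ω e (g j) (v j)) :
    HasWeakDeriv Ω e (fun x => (WithLp.toLp 2 fun j => g j x : 𝔼 n))
      fun x => WithLp.toLp 2 fun j => v j x := by
  have l1 := locallyIntegrableOn_toLp fun j => (h j).locInt
  have l2 := locallyIntegrableOn_toLp fun j => (h j).locInt_deriv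
  refine ⟨l1, l2, fun φ h1 h2 h3 => ?_⟩
  have i1 := integrable_smul_of_tsupport_subset l1 (contDiff_fderiv_apply_const h1 e).continuous
    (hasCompactSupport_fderiv_apply h2 e) ((tsupport_fderiv_apply_subset' e).trans h3)
  have i2 := integrable_smul_of_tsupport_subset l2 h1.continuous h2 h3
  ext j
  have c1 := (EuclideanSpace.proj (𝕜 := ℝ) j : (𝔼 n) →L[ℝ] ℝ).integral_comp_comm i1
  have c2 := (EuclideanSpace.proj (𝕜 := ℝ) j : (𝔼 n) →L[ℝ] ℝ).integral_comp_comm i2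
  exact c1.symm.trans (((h j).integral_eq φ h1 h2 h3).trans (congrArg Neg.neg c2))

lemma fderiv_fderiv_apply_comm {φ : (𝔼 n) → ℝ} (h : ContDiff ℝ ∞ φ) (e e' x : 𝔼 n) :
    fderiv ℝ (fun z => fderiv ℝ φ z e) x e' = fderiv ℝ (fun z => fderiv ℝ φ z e') x e := by
  have hd : DifferentiableAt ℝ (fderiv ℝ φ) x :=
    (h.fderiv_right (m := ∞) (by simp)).differentiable (by simp) x
  have hsym : IsSymmSndFDerivAt ℝ φ x := h.contDiffAt.isSymmSndFDerivAt (by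
    simp only [minSmoothness_of_isRCLikeNormedField]
    exact WithTop.coe_le_coe.2 (le_top : (2 : ℕ∞) ≤ ⊤))
  have key : ∀ v w, fderiv ℝ (fun z => fderiv ℝ φ z v) x w = fderiv ℝ (fderiv ℝ φ) x w v := by
    intro v w
    rw [fderiv_clm_apply hd (differentiableAt_const v)]
    simp
  rw [key, key]
  exact hsym e' e

/-- Mixed weak derivatives commute because those of the test functions do, and weak derivatives are
unique; this gives the symmetry of D²u. -/
lemma HasWeakDeriv.ae_comm {e e' : 𝔼 n} {u g g' h h' : (𝔼 n) → ℝ} (h1 : HasWeakDeriv Ω e u g)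
    (h2 : HasWeakDeriv Ω e' g h) (h1' : HasWeakDeriv Ω e' u g') (h2' : HasWeakDeriv Ω e g' h') :
    ∀ᵐ x, x ∈ Ω → h x = h' x := by
  have h3 : HasWeakDeriv Ω e' g h' := by
    refine ⟨h2.locInt, h2'.locInt_deriv, fun φ c1 c2 c3 => ?_⟩
    have a1 := h1.integral_eq _ (contDiff_fderiv_apply_const c1 e')
      (hasCompactSupport_fderiv_apply c2 e') ((tsupport_fderiv_apply_subset' e').trans c3)
    have a2 := h1'.integral_eq _ (contDiff_fderiv_apply_const c1 e)
      (hasCompactSupport_fderiv_apply c2 e) ((tsupport_fderiv_apply_subset' e).trans c3)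
    have a3 := h2'.integral_eq φ c1 c2 c3
    simp only [fderiv_fderiv_apply_comm c1 e' e] at a1
    rw [a1, neg_inj] at a2
    rw [a2, a3]
  exact h2.ae_unique h3

lemma rpow_three_half (p : 𝔼 n) : (1 + ‖p‖ ^ 2) ^ (3 / 2 : ℝ) = areaElt p ^ 3 := by
  rw [areaElt, Real.sqrt_eq_rpow, ← Real.rpow_natCast _ 3, ← Real.rpow_mul (by positivity)]
  norm_num

/-- A stable solution in `W^{3,1}_loc` gives a stable system. -/
lemma IsStableSolution.exists_stableSystem {f : ℝ → ℝ} {u : (𝔼 n) → ℝ} {G : (𝔼 n) → 𝔼 n}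
    (hf : ContDiff ℝ 1 f) (hu : MemW1Loc Ω 3 u) (h : IsStableSolution Ω f u G) :
    ∃ H L, StableSystem Ω f ((Ω : Set (𝔼 n)).indicator u) ((Ω : Set (𝔼 n)).indicator G) H L := by
  obtain ⟨-, hu1⟩ := hu
  choose v hv hv1 using hu1
  have hv2 := fun i => (hv1 i).2
  choose vv hvv hvv1 using hv2
  have hvv2 := fun i k => (hvv1 i k).2
  choose w hw hw1 using hvv2
  -- Extension by zero makes all functions measurable on the whole space without affecting any
  -- identity tested inside Ω.
  set χ : ((𝔼 n) → ℝ) → (𝔼 n) → ℝ := fun g => (Ω : Set (𝔼 n)).indicator g with hχ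
  set G' := (Ω : Set (𝔼 n)).indicator G with hG'
  have hG'mem : ∀ x ∈ Ω, G' x = G x := fun x hx => indicator_of_mem (s := (Ω : Set (𝔼 n))) hx G
  have hu'mem : ∀ x ∈ Ω, χ u x = u x := fun x hx => indicator_of_mem (s := (Ω : Set (𝔼 n))) hx u
  have hwg := h.weakSolution.weakGradient
  have hGv : ∀ i, ∀ᵐ x, x ∈ Ω → G x i = v i x := fun i =>
    (hwg.weakPartial i).hasWeakDeriv.ae_unique (hv i).hasWeakDeriv
  have wχ : ∀ {k} {g g' : (𝔼 n) → ℝ}, HasWeakPartial Ω k g g' →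
      HasWeakDeriv Ω (bv k) (χ g) (χ g') := fun hg =>
    hg.hasWeakDeriv.congr_on (ae_mem_indicator_eq _) (ae_mem_indicator_eq _)
  -- `H k` is ∂ₖ∇u, assembled from the chosen derivatives. Of the third derivatives only the
  -- repeated ones ∂ₖ∂ₖ∇u are needed, in the energy estimate.
  set H : Fin n → (𝔼 n) → 𝔼 n := fun k x => WithLp.toLp 2 fun i => χ (vv i k) x with hH
  set L : Fin n → (𝔼 n) → 𝔼 n := fun k x => WithLp.toLp 2 fun i => χ (w i k k) x with hL
  refine ⟨H, L, ?_⟩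
  have wH : ∀ k, HasWeakDeriv Ω (bv k) (H k) (L k) := fun k =>
    HasWeakDeriv.toLp fun i => wχ (hw i k k)
  have wG : ∀ k, HasWeakDeriv Ω (bv k) G' (H k) := fun k => by
    refine (HasWeakDeriv.toLp fun i => wχ (hvv i k)).congr_on ?_
      (Eventually.of_forall fun _ _ => rfl)
    filter_upwards [ae_all_iff.2 hGv] with x hx hxΩ
    ext i
    rw [hG'mem x hxΩ, hx i hxΩ]
    exact indicator_of_mem (s := (Ω : Set (𝔼 n))) hxΩ (v i)
  refine
    { contDiff_f := hf
      meas_u := LocallyIntegrableOn.aestronglyMeasurable_indicator hwg.locInt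
      meas_G := LocallyIntegrableOn.aestronglyMeasurable_indicator hwg.locInt_grad
      meas_H := fun k => ?_
      weak_u := fun i => ?_
      weak_G := wG
      weak_H := wH
      symm := fun i j => ?_
      locInt_f := ?_
      locInt_deriv := ?_
      weak_eq := fun φ h1 h2 h3 => ?_
      stable := fun φ h1 h2 h3 => ?_ }
  · have e : H k = (Ω : Set (𝔼 n)).indicator (H k) := by
      ext x i
      by_cases hx : x ∈ (Ω : Set (𝔼 n))
      · rw [indicator_of_mem hx]
      · rw [indicator_of_notMem hx]
        exact indicator_of_notMem hx _
    rw [e]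
    exact LocallyIntegrableOn.aestronglyMeasurable_indicator (wH k).locInt
  · refine (hwg.weakPartial i).hasWeakDeriv.congr_on (ae_mem_indicator_eq _)
      (Eventually.of_forall fun x hx => ?_)
    rw [hG'mem x hx]
  · have := (hv j).hasWeakDeriv.ae_comm (hvv j i).hasWeakDeriv (hv i).hasWeakDeriv
      (hvv i j).hasWeakDeriv
    filter_upwards [this] with x hx
    by_cases hxΩ : x ∈ (Ω : Set (𝔼 n))
    · simp only [hH, hχ, indicator_of_mem hxΩ]
      exact hx hxΩ
    · simp only [hH, hχ, indicator_of_notMem hxΩ]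
  · refine LocallyIntegrableOn.congr_ae_on h.weakSolution.locInt_f
      (Eventually.of_forall fun x hx => ?_)
    rw [← hu'mem x hx]
  · refine LocallyIntegrableOn.congr_ae_on h.locInt_deriv (Eventually.of_forall fun x hx => ?_)
    rw [← hu'mem x hx]
  · have e := h.weakSolution.weak_eq ⟨φ, h1, h2, h3⟩
    rw [← setIntegral_opens_eq h3 (b := fun x => inner ℝ (flux (G' x)) (∇ φ x)) fun x hx => by
        rw [gradient_eq_zero_of_notMem_tsupport hx, inner_zero_right],
      ← setIntegral_opens_eq h3 (b := fun x => f (χ u x) * φ x) fun x hx => by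
        rw [image_eq_zero_of_notMem_tsupport hx, mul_zero]]
    refine Eq.trans ?_ (e.trans ?_)
    · refine setIntegral_congr_fun Ω.isOpen.measurableSet fun x hx => ?_
      rw [hG'mem x hx, flux, real_inner_smul_left, areaElt, div_eq_inv_mul]
      rfl
    · refine setIntegral_congr_fun Ω.isOpen.measurableSet fun x hx => ?_
      rw [hu'mem x hx]
      rfl
  · have e := h.stable ⟨φ, h1, h2, h3⟩
    rw [← setIntegral_opens_eq h3
        (b := fun x => inner ℝ (areaHess (G' x) (∇ φ x)) (∇ φ x)) fun x hx => by
          rw [gradient_eq_zero_of_notMem_tsupport hx, inner_zero_right],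
      ← setIntegral_opens_eq h3 (b := fun x => deriv f (χ u x) * φ x ^ 2) fun x hx => by
        rw [image_eq_zero_of_notMem_tsupport hx]; ring]
    refine le_of_eq_of_le ?_ (e.trans (le_of_eq ?_))
    · refine setIntegral_congr_fun Ω.isOpen.measurableSet fun x hx => ?_
      rw [hu'mem x hx]
      rfl
    · refine setIntegral_congr_fun Ω.isOpen.measurableSet fun x hx => ?_
      rw [hG'mem x hx, inner_areaHess_self_eq, rpow_three_half, div_eq_inv_mul, div_eq_inv_mul,
        inv_pow]
      rfl

end Construction

end MeanCurvature

open Filter Set Metric ContinuousLinearMap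
open scoped Topology ContDiff Convolution

namespace MeanCurvature

local notation "𝔼" n => EuclideanSpace ℝ (Fin n)

/-! ### The exponent and the Morrey bound. -/

section Morrey

/-- Here a = n(1-1/p) is n - 1 for n ≤ 5 and 4(√(n-1)-1) otherwise. In the first case the maximum
over s is at s = 0; in the second it is interior and equals n - 1. -/
lemma morreyExponent_spec {n : ℕ} (hn : 2 ≤ n) :
    0 ≤ (n : ℝ) * (1 - 1 / morreyExponent n) ∧ ∀ s ∈ Icc (0 : ℝ) 1,
      (1 - s) * ((n : ℝ) * (1 - 1 / morreyExponent n)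
        + ((n : ℝ) * (1 - 1 / morreyExponent n)) ^ 2 / 4 * s) ≤ n - 1 := by
  have hn2 : (2 : ℝ) ≤ n := by exact_mod_cast hn
  have hn0 : (n : ℝ) ≠ 0 := by positivity
  by_cases h5 : n ≤ 5
  · have e : (n : ℝ) * (1 - 1 / morreyExponent n) = n - 1 := by
      rw [morreyExponent, if_pos h5]; field_simp
    rw [e]
    have h5' : (n : ℝ) ≤ 5 := by exact_mod_cast h5
    refine ⟨by linarith, fun s hs => ?_⟩
    -- This is where n ≤ 5 enters: (n-1)/4 ≤ 1 bounds the product by (1-s)(1+s).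
    have h1 : (1 - s) * (1 + (n - 1) / 4 * s) ≤ 1 := by nlinarith [hs.1, hs.2, mul_nonneg hs.1 hs.1]
    calc (1 - s) * ((n : ℝ) - 1 + (n - 1) ^ 2 / 4 * s)
        = (n - 1) * ((1 - s) * (1 + (n - 1) / 4 * s)) := by ring
      _ ≤ (n - 1) * 1 := by gcongr; linarith
      _ = n - 1 := mul_one _
  · have e : (n : ℝ) * (1 - 1 / morreyExponent n) = 4 * (√((n : ℝ) - 1) - 1) := by
      rw [morreyExponent, if_neg h5, one_div_div]; field_simp; ring
    rw [e]
    have hs1 : 1 ≤ √((n : ℝ) - 1) := Real.one_le_sqrt.2 (by linarith)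
    have hsq : √((n : ℝ) - 1) ^ 2 = n - 1 := Real.sq_sqrt (by linarith)
    set b := √((n : ℝ) - 1) - 1 with hb
    have hb' : √((n : ℝ) - 1) = 1 + b := by rw [hb]; ring
    refine ⟨by linarith, fun s _ => ?_⟩
    rw [← hsq, hb']
    -- With a = 4b the left side is 4·b(1-s)·(1+bs), and the two factors have sum 1 + b = √(n-1):
    -- the arithmetic-geometric mean inequality.
    nlinarith [sq_nonneg (b * (1 - s) - (1 + b * s))]

/-- The Morrey bound for stable solutions on `B_2`, in terms of the mass of the gradient on the
closed ball of radius `3/2`. -/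
lemma exists_morreyBound {n : ℕ} (hn : 2 ≤ n) :
    ∃ C : ℝ, 0 < C ∧ ∀ {f : ℝ → ℝ} {u : (𝔼 n) → ℝ} {G : (𝔼 n) → 𝔼 n}, ContDiff ℝ 1 f →
      MemW1Loc (B n 2) 3 u → IsStableSolution (B n 2) f u G →
        MorreyBound (B n 1) (morreyExponent n) G
          (ENNReal.ofReal C * (1 + ∫⁻ x in closedBall 0 (3 / 2), ‖G x‖ₑ)) := by
  obtain ⟨ha, hN⟩ := morreyExponent_spec hn
  set a := (n : ℝ) * (1 - 1 / morreyExponent n) with ha_def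
  obtain ⟨C₀, hC₀, hC⟩ := exists_morrey_const ha hn hN
  have h4a : (0 : ℝ) < 4 ^ a := Real.rpow_pos_of_pos (by norm_num) _
  -- The summand 4^a covers radii above 1/4, where (4ρ)^a ≥ 1 and the mass on the larger ball is
  -- already enough.
  refine ⟨C₀ + 4 ^ a, by positivity, fun {f u G} hf hu h => ?_⟩
  obtain ⟨H, L, S⟩ := h.exists_stableSystem hf hu
  intro x₀ hx₀ ρ hρ _
  have hx₀' : x₀ ∈ ball (0 : 𝔼 n) 1 := hx₀
  rw [← ha_def]
  set T := ∫⁻ x in closedBall (0 : 𝔼 n) (3 / 2), ‖G x‖ₑ with hT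
  have hρa : 0 < ρ ^ a := Real.rpow_pos_of_pos hρ _
  rcases le_or_gt ρ (1 / 4) with hρ4 | hρ4
  · have hest := hC S x₀ hx₀' ρ hρ hρ4
    set G' := (B n 2 : Set (𝔼 n)).indicator G with hG'
    have hsub : closedBall x₀ (1 / 2) ⊆ closedBall (0 : 𝔼 n) (3 / 2) := by
      refine closedBall_subset_closedBall' ?_
      rw [mem_ball] at hx₀'
      linarith
    have hsub2 : closedBall (0 : 𝔼 n) (3 / 2) ⊆ (B n 2 : Set (𝔼 n)) :=
      closedBall_subset_ball (by norm_num)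
    have hbsub : ball x₀ ρ ⊆ closedBall x₀ (1 / 2) :=
      ball_subset_closedBall.trans (closedBall_subset_closedBall (by linarith))
    have hGi : IntegrableOn G (closedBall x₀ (1 / 2)) :=
      locallyIntegrableOn_opens_iff.1 h.weakSolution.weakGradient.locInt_grad _
        (hsub.trans hsub2) (isCompact_closedBall _ _)
    have e1 : ∫ x in ball x₀ ρ, ‖G' x‖ = ∫ x in ball x₀ ρ, ‖G x‖ :=
      setIntegral_congr_fun measurableSet_ball fun x hx => by
        rw [hG', indicator_of_mem (hsub2 (hsub (hbsub hx)))]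
    have e2 : ∫ x in closedBall x₀ (1 / 2), ‖G' x‖ = ∫ x in closedBall x₀ (1 / 2), ‖G x‖ :=
      setIntegral_congr_fun measurableSet_closedBall fun x hx => by
        rw [hG', indicator_of_mem (hsub2 (hsub hx))]
    rw [e1, e2] at hest
    have f1 := ofReal_integral_norm_eq_lintegral_enorm (hGi.mono_set hbsub)
    have f2 := ofReal_integral_norm_eq_lintegral_enorm hGi
    have hI0 : 0 ≤ ∫ x in closedBall x₀ (1 / 2), ‖G x‖ := integral_nonneg fun x => norm_nonneg _
    calc ∫⁻ x in ball x₀ ρ ∩ (B n 1 : Set (𝔼 n)), ‖G x‖ₑ ≤ ∫⁻ x in ball x₀ ρ, ‖G x‖ₑ :=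
          lintegral_mono_set inter_subset_left
      _ = ENNReal.ofReal (∫ x in ball x₀ ρ, ‖G x‖) := f1.symm
      _ ≤ ENNReal.ofReal (C₀ * ρ ^ a * (1 + ∫ x in closedBall x₀ (1 / 2), ‖G x‖)) :=
          ENNReal.ofReal_le_ofReal hest
      _ = ENNReal.ofReal C₀ * (1 + ∫⁻ x in closedBall x₀ (1 / 2), ‖G x‖ₑ)
            * ENNReal.ofReal (ρ ^ a) := by
          rw [ENNReal.ofReal_mul (by positivity), ENNReal.ofReal_mul hC₀,
            ENNReal.ofReal_add zero_le_one hI0, ENNReal.ofReal_one, f2]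
          ring
      _ ≤ ENNReal.ofReal (C₀ + 4 ^ a) * (1 + T) * ENNReal.ofReal (ρ ^ a) := by
          have g1 : ∫⁻ x in closedBall x₀ (1 / 2), ‖G x‖ₑ ≤ T := lintegral_mono_set hsub
          gcongr
          linarith
  · have hball : ball x₀ ρ ∩ (B n 1 : Set (𝔼 n)) ⊆ closedBall (0 : 𝔼 n) (3 / 2) :=
      inter_subset_right.trans
        (ball_subset_closedBall.trans (closedBall_subset_closedBall (by norm_num)))
    have hone : (1 : ℝ) ≤ (C₀ + 4 ^ a) * ρ ^ a := by
      have g1 : (1 : ℝ) ≤ 4 ^ a * ρ ^ a := by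
        rw [← Real.mul_rpow (by norm_num) hρ.le]
        exact Real.one_le_rpow (by linarith) ha
      nlinarith [mul_nonneg hC₀ hρa.le]
    calc ∫⁻ x in ball x₀ ρ ∩ (B n 1 : Set (𝔼 n)), ‖G x‖ₑ ≤ T := lintegral_mono_set hball
      _ ≤ 1 * (1 + T) := by rw [one_mul]; exact le_add_self
      _ ≤ ENNReal.ofReal ((C₀ + 4 ^ a) * ρ ^ a) * (1 + T) := by
          gcongr
          rw [← ENNReal.ofReal_one]
          exact ENNReal.ofReal_le_ofReal hone
      _ = ENNReal.ofReal (C₀ + 4 ^ a) * (1 + T) * ENNReal.ofReal (ρ ^ a) := by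
          rw [ENNReal.ofReal_mul (by positivity)]; ring

end Morrey

end MeanCurvature

theorem theorem1p1 (n : ℕ) (hn : 2 ≤ n) :
    ∃ C : ℝ≥0, ∀ (f : ℝ → ℝ) (u : EuclideanSpace ℝ (Fin n) → ℝ)
      (G : EuclideanSpace ℝ (Fin n) → EuclideanSpace ℝ (Fin n)),
      ContDiff ℝ 1 f →
      MeanCurvature.MemW1Loc (MeanCurvature.B n 2) 3 u →
      MeanCurvature.IsStableSolution (MeanCurvature.B n 2) f u G →
      MeanCurvature.MemMorrey (MeanCurvature.B n 1) (MeanCurvature.morreyExponent n) G ∧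
      MeanCurvature.morreyNorm (MeanCurvature.B n 1) (MeanCurvature.morreyExponent n) G ≤
        C * (1 + eLpNorm G 1 (volume.restrict (MeanCurvature.B n 2))) := by
  obtain ⟨C, hC, hbound⟩ := MeanCurvature.exists_morreyBound hn
  refine ⟨C.toNNReal, fun f u G hf hu h => ?_⟩
  have hM := hbound hf hu h
  have hloc := h.weakSolution.weakGradient.locInt_grad
  have hsub : Metric.closedBall (0 : EuclideanSpace ℝ (Fin n)) (3 / 2) ⊆
      (MeanCurvature.B n 2 : Set (EuclideanSpace ℝ (Fin n))) :=
    Metric.closedBall_subset_ball (by norm_num)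
  have hfin : ∫⁻ x in Metric.closedBall 0 (3 / 2), ‖G x‖ₑ < ⊤ :=
    (MeanCurvature.locallyIntegrableOn_opens_iff.1 hloc _ hsub
      (isCompact_closedBall _ _)).hasFiniteIntegral
  refine ⟨⟨hloc.mono_set (Metric.ball_subset_ball one_le_two), ?_⟩, ?_⟩
  -- Membership uses the mass on the compact ball of radius 3/2, finite by local integrability, so
  -- it holds even when the integral over the ball of radius 2 is infinite.
  · have hK : ENNReal.ofReal C * (1 + ∫⁻ x in Metric.closedBall 0 (3 / 2), ‖G x‖ₑ) ≠ ⊤ :=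
      ENNReal.mul_ne_top ENNReal.ofReal_ne_top (ENNReal.add_ne_top.2 ⟨ENNReal.one_ne_top, hfin.ne⟩)
    refine ⟨_, ENNReal.toNNReal_pos ?_ hK, ?_⟩
    · exact mul_ne_zero (ENNReal.ofReal_pos.2 hC).ne' (by simp)
    · rwa [ENNReal.coe_toNNReal hK]
  · refine (sInf_le hM).trans ?_
    rw [eLpNorm_one_eq_lintegral_enorm]
    exact mul_le_mul_right (add_le_add_right (lintegral_mono_set hsub) 1) _
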